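/- Let $d\ge 2$ and let $\Omega\subset\mathbb R^d$ be a bounded Lipschitz domain. Let $L^2_\sigma(\Omega)$ and $H^1_{0,\sigma}(\Omega)$ be the closures of the smooth, compactly supported, divergence-free vector fields $C^\infty_{c,\sigma}(\Omega;\mathbb R^d)$ in $L^2(\Omega)$ and in $H^1(\Omega)$, and let $H^{-1}(\Omega)=(H^1_0(\Omega;\mathbb R^d))^*$ with the dual norm. For $T>0$ put $\mathbb X=L^\infty(0,T;L^2_\sigma(\Omega))\cap L^2(0,T;H^1_{0,\sigma}(\Omega))$. For a viscosity $\nu>0$, a constant $\kappa>0$ and exponents $0<s<\infty$, $0<r\le\infty$ with $\frac2s+\frac dr\le 1$ put $$\mathcal R(v|w)=\tfrac12\|v-w\|_{L^2(\Omega)}^2,\qquad \mathcal W(v|w)=\tfrac\nu2\|\nabla v-\nabla w\|_{L^2(\Omega)}^2,\qquad \mathcal K(w)=\kappa\|w\|_{L^r(\Omega)}^s .$$ *Weak solutions.* Given $f\in L^2(0,T;H^{-1}(\Omega))$ and $v_0\in L^2_\sigma(\Omega)$, a weak solution of the Navier–Stokes equations for the data $(v_0,f)$ is a $v\in\mathbb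 X$ with $$-\int_0^T\!\!\int_\Omega v\cdot\partial_t\varphi\,dx\,dt+\int_0^T\!\!\int_\Omega\big(\nu\nabla v:\nabla\varphi+(v\cdot\nabla)v\cdot\varphi\big)\,dx\,dt=\int_0^T\langle f,\varphi\rangle\,dt+\int_\Omega v_0\cdot\varphi(0)\,dx$$ for all $\varphi\in C^1_c([0,T);C^\infty_{c,\sigma}(\Omega;\mathbb R^d))$. *Dissipative solutions.* A dissipative solution for the data $(v_0,f)$ is a $v\in\mathbb X$ such that for every $w\in C^1([0,T];H^2(\Omega)\cap H^1_{0,\sigma}(\Omega))$ with $\int_0^T\mathcal K(w)\,dt<\infty$ and for a.e. $t\in(0,T)$ $$\mathcal R(v(t)|w(t))+\int_0^t\big(\mathcal W(v|w)+\langle\mathcal A_f(w),v-w\rangle\big)e^{\int_\sigma^t\mathcal K(w)\,d\tau}\,d\sigma\le\mathcal R(v_0|w(0))\,e^{\int_0^t\mathcal K(w)\,d\tau},$$ where $\langle\mathcal A_f(w),z\rangle=\int_\Omega\big(\partial_tw\cdot z+(w\cdot\nabla)w\cdot z+\nu\nabla w:\nabla z\big)\,dx-\langle f,z\rangle$ for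 $z\in H^1_{0,\sigma}(\Omega)$. **Proposition.** There is a constant $c>0$ depending only on $\Omega$ such that for all $T,\nu,\kappa,s,r$ as above the following holds. Let $f\in L^2(0,T;H^{-1}(\Omega))$, $v_0\in L^2_\sigma(\Omega)$, and let $v\in\mathbb X$ be a weak solution for the data $(v_0,f)$ with $v\in L^s(0,T;L^r(\Omega))$. Let $f^1\in L^2(0,T;H^{-1}(\Omega))$, $v^1_0\in L^2_\sigma(\Omega)$, and let $v^1$ be any dissipative solution for the data $(v^1_0,f^1)$. Then for a.e. $t\in(0,T)$ $$\mathcal R(v^1(t)|v(t))+\frac12\int_0^t\mathcal W(v^1|v)\,e^{\int_\sigma^t\mathcal K(v)\,d\tau}\,d\sigma\le\mathcal R(v^1_0|v_0)\,e^{\int_0^t\mathcal K(v)\,d\tau}+\frac c\nu\int_0^t\|f-f^1\|_{H^{-1}(\Omega)}^2\,e^{\int_\sigma^t\mathcal K(v)\,d\tau}\,d\sigma .$$ -/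

import Mathlib

open MeasureTheory Set
open scoped ENNReal ContDiff

noncomputable section

namespace NSDiss

/-! ### Domains -/

/-- Physical space `ℝ^d` with the Euclidean norm. -/
abbrev Space (d : ℕ) := EuclideanSpace ℝ (Fin d)

/-- `d × d` matrices with the Frobenius norm. -/
abbrev Mat (d : ℕ) := EuclideanSpace ℝ (Fin d × Fin d)

/-- Third order tensors with the Euclidean norm. -/
abbrev Ten (d : ℕ) := EuclideanSpace ℝ (Fin d × Fin d × Fin d)

/-- The `k`-th standard basis vector. -/
abbrev basisVec {d : ℕ} (k : Fin d) : Space d := EuclideanSpace.single k 1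

/-- Bounded Lipschitz domains: open, connected, bounded sets that lie, near each boundary point and
for a suitable direction `n`, exactly on one side of the graph of a Lipschitz function defined on
the hyperplane orthogonal to `n`. -/
structure IsLipschitzDomain {d : ℕ} (Ω : Set (Space d)) : Prop where
  isOpen : IsOpen Ω
  isConnected : IsConnected Ω
  isBounded : Bornology.IsBounded Ω
  lipschitz_boundary : ∀ x ∈ frontier Ω, ∃ U : Set (Space d), IsOpen U ∧ x ∈ U ∧
    ∃ n : Space d, ‖n‖ = 1 ∧ ∃ (L : NNReal) (g : (ℝ ∙ n)ᗮ → ℝ), LipschitzWith L g ∧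
      ∀ y ∈ U, y ∈ Ω ↔ g ((ℝ ∙ n)ᗮ.orthogonalProjectionOnto y) < inner ℝ n y

/-! ### Test fields -/

/-- The classical Jacobian `(∇φ)_{ij} = ∂_j φ_i`. -/
def grad {d : ℕ} (φ : Space d → Space d) (x : Space d) : Mat d :=
  WithLp.toLp 2 fun p => fderiv ℝ φ x (basisVec p.2) p.1

/-- `C_c^∞(Ω; ℝ^d)`. -/
def TestField {d : ℕ} (Ω : Set (Space d)) : Submodule ℝ (Space d → Space d) where
  carrier := {φ | ContDiff ℝ ∞ φ ∧ HasCompactSupport φ ∧ tsupport φ ⊆ Ω}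
  zero_mem' := ⟨contDiff_const, HasCompactSupport.zero, by simp⟩
  add_mem' := by
    rintro φ ψ ⟨h1, h2, h3⟩ ⟨k1, k2, k3⟩
    exact ⟨h1.add k1, h2.add k2, (tsupport_add φ ψ).trans (union_subset h3 k3)⟩
  smul_mem' := by
    rintro c φ ⟨h1, h2, h3⟩
    exact ⟨contDiff_const.smul h1, h2.smul_left (f := fun _ => c),
      (tsupport_smul_subset_right (fun _ => c) φ).trans h3⟩

theorem differentiable_testField {d : ℕ} {Ω : Set (Space d)} (φ : TestField Ω) :
    Differentiable ℝ φ.1 := φ.2.1.differentiable (by simp)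

theorem grad_add {d : ℕ} {Ω : Set (Space d)} (φ ψ : TestField Ω) :
    grad (φ.1 + ψ.1) = grad φ.1 + grad ψ.1 := by
  funext x
  ext p
  simp [grad, fderiv_add (differentiable_testField φ x) (differentiable_testField ψ x)]

theorem grad_smul {d : ℕ} {Ω : Set (Space d)} (c : ℝ) (φ : TestField Ω) :
    grad (c • φ.1) = c • grad φ.1 := by
  funext x
  ext p
  simp [grad, fderiv_const_smul (differentiable_testField φ x) c]

/-- `C_{c,σ}^∞(Ω; ℝ^d)`: the divergence free test fields. -/
def SolTestField {d : ℕ} (Ω : Set (Space d)) : Submodule ℝ (TestField Ω) where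
  carrier := {φ | ∀ x, ∑ i, grad φ.1 x (i, i) = 0}
  zero_mem' := by
    intro x
    have : grad (0 : Space d → Space d) x = 0 := by
      ext p
      simp [grad]
    simp [this]
  add_mem' := by
    intro φ ψ h k x
    simp [grad_add, Finset.sum_add_distrib, h x, k x]
  smul_mem' := by
    intro c φ h x
    simp [grad_smul, ← Finset.mul_sum, h x]

/-! ### Function spaces -/

/-- `L²(Ω; F)`. -/
abbrev L2 {d : ℕ} (Ω : Set (Space d)) (F : Type) [NormedAddCommGroup F] :=
  Lp F 2 (volume.restrict Ω)

theorem memLp_testField {d : ℕ} {Ω : Set (Space d)} (φ : TestField Ω) :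
    MemLp φ.1 2 (volume.restrict Ω) :=
  (φ.2.1.continuous.memLp_of_hasCompactSupport φ.2.2.1)

theorem continuous_grad {d : ℕ} {Ω : Set (Space d)} (φ : TestField Ω) :
    Continuous (grad φ.1) := by
  have h : Continuous (fderiv ℝ φ.1) := φ.2.1.continuous_fderiv (by simp)
  unfold grad
  fun_prop

theorem hasCompactSupport_grad {d : ℕ} {Ω : Set (Space d)} (φ : TestField Ω) :
    HasCompactSupport (grad φ.1) := by
  refine (φ.2.2.1.fderiv (𝕜 := ℝ)).mono ?_
  intro x hx hx'
  apply hx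
  ext p
  simp [grad, hx']

theorem memLp_grad {d : ℕ} {Ω : Set (Space d)} (φ : TestField Ω) :
    MemLp (grad φ.1) 2 (volume.restrict Ω) :=
  (continuous_grad φ).memLp_of_hasCompactSupport (hasCompactSupport_grad φ)

/-- The Hilbert space of pairs `(v, G)` in `L²(Ω; ℝ^d) × L²(Ω; ℝ^{d×d})`, with norm
`(‖v‖² + ‖G‖²)^{1/2}`.  For `G = ∇v` this is the `H¹` norm. -/
abbrev GraphSpace {d : ℕ} (Ω : Set (Space d)) := WithLp 2 (L2 Ω (Space d) × L2 Ω (Mat d))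

/-- The class in `L²` of a test field. -/
def toL2 {d : ℕ} {Ω : Set (Space d)} : TestField Ω →ₗ[ℝ] L2 Ω (Space d) where
  toFun φ := (memLp_testField φ).toLp φ.1
  map_add' φ ψ := MemLp.toLp_add (memLp_testField φ) (memLp_testField ψ)
  map_smul' c φ := MemLp.toLp_const_smul c (memLp_testField φ)

/-- The pair `(φ, ∇φ)` of a test field. -/
def toGraph {d : ℕ} {Ω : Set (Space d)} : TestField Ω →ₗ[ℝ] GraphSpace Ω where
  toFun φ := WithLp.toLp 2 (toL2 φ, (memLp_grad φ).toLp (grad φ.1))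
  map_add' φ ψ := by
    rw [map_add, ← WithLp.toLp_add, Prod.mk_add_mk]
    congr 2
    rw [← MemLp.toLp_add]
    exact MemLp.toLp_congr _ _ (by rw [← grad_add]; rfl)
  map_smul' c φ := by
    rw [map_smul, RingHom.id_apply, ← WithLp.toLp_smul, Prod.smul_mk]
    congr 2
    rw [← MemLp.toLp_const_smul]
    exact MemLp.toLp_congr _ _ (by rw [← grad_smul]; rfl)

/-- `L²_σ(Ω)`: the closure of the divergence free test fields in `L²(Ω; ℝ^d)`. -/
def L2sol {d : ℕ} (Ω : Set (Space d)) : Submodule ℝ (L2 Ω (Space d)) :=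
  ((SolTestField Ω).map toL2).topologicalClosure

/-- `H¹_0(Ω; ℝ^d)`: the closure of the test fields in the `H¹` norm; an element carries its weak
gradient as its second component. -/
def H10 {d : ℕ} (Ω : Set (Space d)) : Submodule ℝ (GraphSpace Ω) :=
  (LinearMap.range (toGraph (Ω := Ω))).topologicalClosure

/-- `H¹_{0,σ}(Ω)`: the closure of the divergence free test fields in the `H¹` norm. -/
def H10sol {d : ℕ} (Ω : Set (Space d)) : Submodule ℝ (GraphSpace Ω) :=
  ((SolTestField Ω).map toGraph).topologicalClosure

theorem H10sol_le_H10 {d : ℕ} (Ω : Set (Space d)) : H10sol Ω ≤ H10 Ω :=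
  Submodule.topologicalClosure_mono (LinearMap.map_le_range)

/-- `H^{-1}(Ω) = (H¹_0(Ω; ℝ^d))^*` with the dual norm. -/
abbrev Hneg1 {d : ℕ} (Ω : Set (Space d)) := StrongDual ℝ (H10 Ω)

/-- The underlying `L²` field of an element of `H¹_{0,σ}`. -/
def val {d : ℕ} {Ω : Set (Space d)} (w : H10sol Ω) : L2 Ω (Space d) := w.1.fst

/-- The weak gradient of an element of `H¹_{0,σ}`. -/
def wgrad {d : ℕ} {Ω : Set (Space d)} (w : H10sol Ω) : L2 Ω (Mat d) := w.1.snd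

/-- The duality pairing of `H^{-1}` with `H¹_{0,σ} ⊆ H¹_0`. -/
def pair {d : ℕ} {Ω : Set (Space d)} (f : Hneg1 Ω) (w : H10sol Ω) : ℝ :=
  f (Submodule.inclusion (H10sol_le_H10 Ω) w)

/-- A divergence free test field as an element of `H¹_{0,σ}`. -/
def solToH {d : ℕ} {Ω : Set (Space d)} (φ : SolTestField Ω) : H10sol Ω :=
  ⟨toGraph φ.1, Submodule.le_topologicalClosure _ (Submodule.mem_map_of_mem φ.2)⟩

/-- `S` is the weak derivative of `G`: `S_{ijk} = ∂_k G_{ij}` in the sense of distributions. -/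
def IsWeakDeriv {d : ℕ} {Ω : Set (Space d)} (G : L2 Ω (Mat d)) (S : L2 Ω (Ten d)) : Prop :=
  ∀ φ : Space d → ℝ, ContDiff ℝ ∞ φ → HasCompactSupport φ → tsupport φ ⊆ Ω →
    ∀ i j k, ∫ x in Ω, G x (i, j) * fderiv ℝ φ x (basisVec k) = - ∫ x in Ω, S x (i, j, k) * φ x

theorem integrable_coord_mul {d : ℕ} {Ω : Set (Space d)} {ι : Type} [Fintype ι]
    (G : L2 Ω (EuclideanSpace ℝ ι)) (a : ι) {h : Space d → ℝ} (hc : Continuous h)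
    (hs : HasCompactSupport h) : Integrable (fun x => G x a * h x) (volume.restrict Ω) := by
  have h1 : MemLp (fun x => G x a) 2 (volume.restrict Ω) :=
    (Lp.memLp G).continuousLinearMap_comp (EuclideanSpace.proj (𝕜 := ℝ) a)
  have h2 : MemLp h 2 (volume.restrict Ω) := hc.memLp_of_hasCompactSupport hs
  exact h1.integrable_mul h2

theorem integral_coord_add {d : ℕ} {Ω : Set (Space d)} {ι : Type} [Fintype ι]
    (G H : L2 Ω (EuclideanSpace ℝ ι)) (a : ι) {h : Space d → ℝ} (hc : Continuous h)
    (hs : HasCompactSupport h) :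
    ∫ x in Ω, (G + H) x a * h x = (∫ x in Ω, G x a * h x) + ∫ x in Ω, H x a * h x := by
  rw [← integral_add (integrable_coord_mul G a hc hs) (integrable_coord_mul H a hc hs)]
  refine integral_congr_ae ?_
  filter_upwards [Lp.coeFn_add G H] with x hx
  rw [hx, Pi.add_apply, PiLp.add_apply, add_mul]

theorem integral_coord_smul {d : ℕ} {Ω : Set (Space d)} {ι : Type} [Fintype ι]
    (c : ℝ) (G : L2 Ω (EuclideanSpace ℝ ι)) (a : ι) (h : Space d → ℝ) :
    ∫ x in Ω, (c • G) x a * h x = c * ∫ x in Ω, G x a * h x := by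
  rw [← integral_const_mul]
  refine integral_congr_ae ?_
  filter_upwards [Lp.coeFn_smul c G] with x hx
  rw [hx, Pi.smul_apply, PiLp.smul_apply, smul_eq_mul, mul_assoc]

/-- `H²(Ω; ℝ^d) ∩ H¹_{0,σ}(Ω)`: an element of `H¹_{0,σ}` together with its weak second derivative
in `L²`; the norm is the `H²` norm. -/
def H2sol {d : ℕ} (Ω : Set (Space d)) : Submodule ℝ (WithLp 2 (H10sol Ω × L2 Ω (Ten d))) where
  carrier := {w | IsWeakDeriv (wgrad w.fst) w.snd}
  zero_mem' := by
    intro φ _ _ _ i j k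
    have h1 := integral_coord_smul (Ω := Ω) 0 0 (i, j) (fun x => fderiv ℝ φ x (basisVec k))
    have h2 := integral_coord_smul (Ω := Ω) 0 0 (i, j, k) φ
    rw [smul_zero, zero_mul] at h1 h2
    change ∫ x in Ω, (0 : L2 Ω (Mat d)) x (i, j) * fderiv ℝ φ x (basisVec k) =
      - ∫ x in Ω, (0 : L2 Ω (Ten d)) x (i, j, k) * φ x
    rw [h1, h2, neg_zero]
  add_mem' := by
    intro u w hu hw φ h1 h2 h3 i j k
    have hc : Continuous (fun x => fderiv ℝ φ x (basisVec k)) :=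
      (h1.continuous_fderiv (by simp)).clm_apply continuous_const
    have hs : HasCompactSupport (fun x => fderiv ℝ φ x (basisVec k)) :=
      h2.fderiv_apply (𝕜 := ℝ) (basisVec k)
    change ∫ x in Ω, (wgrad u.fst + wgrad w.fst) x (i, j) * fderiv ℝ φ x (basisVec k) =
      - ∫ x in Ω, (u.snd + w.snd) x (i, j, k) * φ x
    rw [integral_coord_add _ _ _ hc hs, integral_coord_add _ _ _ h1.continuous h2,
      hu φ h1 h2 h3 i j k, hw φ h1 h2 h3 i j k]
    ring
  smul_mem' := by
    intro c u hu φ h1 h2 h3 i j k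
    change ∫ x in Ω, (c • wgrad u.fst) x (i, j) * fderiv ℝ φ x (basisVec k) =
      - ∫ x in Ω, (c • u.snd) x (i, j, k) * φ x
    rw [integral_coord_smul, integral_coord_smul, hu φ h1 h2 h3 i j k]
    ring

/-- The element of `H¹_{0,σ}` underlying an element of `H² ∩ H¹_{0,σ}`. -/
def toH10sol {d : ℕ} {Ω : Set (Space d)} (w : H2sol Ω) : H10sol Ω := w.1.fst

/-! ### The Navier-Stokes functionals -/

/-- Lebesgue measure on the time interval `(0, T)`. -/
abbrev timeMeasure (T : ℝ) : Measure ℝ := volume.restrict (Ioo 0 T)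

/-- `𝕏 = L^∞(0,T; L²_σ) ∩ L²(0,T; H¹_{0,σ})`.  Members of the second space take values in
`H¹_{0,σ} ⊆ L²_σ` at almost every time, so only the `L²` bound remains of the first one. -/
structure MemX {d : ℕ} {Ω : Set (Space d)} (T : ℝ) (v : ℝ → H10sol Ω) : Prop where
  memLp_H1 : MemLp v 2 (timeMeasure T)
  memLp_L2 : MemLp (fun t => val (v t)) ⊤ (timeMeasure T)

/-- The convective form `∫_Ω (a · ∇) u · b`, where `G = ∇u`. -/
def conv {d : ℕ} {Ω : Set (Space d)} (a : L2 Ω (Space d)) (G : L2 Ω (Mat d))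
    (b : L2 Ω (Space d)) : ℝ :=
  ∫ x in Ω, ∑ i, ∑ j, a x j * G x (i, j) * b x i

/-- The relative energy `½ ‖v - w‖²`. -/
def relEnergy {d : ℕ} {Ω : Set (Space d)} (v w : L2 Ω (Space d)) : ℝ := 1 / 2 * ‖v - w‖ ^ 2

/-- The relative dissipation `(ν/2) ‖∇v - ∇w‖²`. -/
def relDiss {d : ℕ} {Ω : Set (Space d)} (ν : ℝ) (v w : H10sol Ω) : ℝ :=
  ν / 2 * ‖wgrad v - wgrad w‖ ^ 2

/-- The regularity measure `𝒦(v) = κ ‖v‖_{L^r}^s`. -/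
def regMeasure {d : ℕ} {Ω : Set (Space d)} (κ s : ℝ) (r : ℝ≥0∞) (v : H10sol Ω) : ℝ :=
  κ * (eLpNorm (val v) r (volume.restrict Ω)).toReal ^ s

/-- `v ∈ L^s(0,T; L^r(Ω))` for finite `s`. -/
def MemLsLr {d : ℕ} {Ω : Set (Space d)} (T s : ℝ) (r : ℝ≥0∞) (v : ℝ → H10sol Ω) : Prop :=
  ∫⁻ t in Ioo 0 T, eLpNorm (val (v t)) r (volume.restrict Ω) ^ s < ⊤

/-- `⟨𝒜(w), z⟩ = ⟨∂_t w + (w·∇)w - ν Δw - f, z⟩` in weak form at a fixed time, where `w'` stands for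
`∂_t w`.  The pressure gradient vanishes on the divergence free `z`. -/
def solOp {d : ℕ} {Ω : Set (Space d)} (ν : ℝ) (f : Hneg1 Ω) (w w' z : H10sol Ω) : ℝ :=
  inner ℝ (val w') (val z) + conv (val w) (wgrad w) (val z)
    + ν * inner ℝ (wgrad w) (wgrad z) - pair f z

/-! ### Weak solutions -/

/-- `φ ∈ C¹_c([0,T); C_{c,σ}^∞(Ω; ℝ^d))` with time derivative `φ'`: the supports lie in one compact
subset of `Ω`, `φ` vanishes near `T`, and all space derivatives of `φ` and of `φ'` are
jointly continuous. -/
structure IsTimeTest {d : ℕ} {Ω : Set (Space d)} (T : ℝ) (φ φ' : ℝ → SolTestField Ω) : Prop where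
  support_space : ∃ C : Set (Space d), IsCompact C ∧ C ⊆ Ω ∧ ∀ t, tsupport (φ t).1.1 ⊆ C
  support_time : ∃ T' < T, ∀ t, T' ≤ t → φ t = 0
  hasDeriv : ∀ x, ∀ t ∈ Icc 0 T,
    HasDerivWithinAt (fun τ => (φ τ).1.1 x) ((φ' t).1.1 x) (Icc 0 T) t
  continuous_space : ∀ m : ℕ,
    ContinuousOn (fun p : ℝ × Space d => iteratedFDeriv ℝ m (φ p.1).1.1 p.2) (Icc 0 T ×ˢ univ)
  continuous_time : ∀ m : ℕ,
    ContinuousOn (fun p : ℝ × Space d => iteratedFDeriv ℝ m (φ' p.1).1.1 p.2) (Icc 0 T ×ˢ univ)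

/-- Weak solutions in `𝕏` of the Navier-Stokes equations with viscosity `ν`, right-hand side `f`
and initial datum `v₀`. -/
structure IsWeakSolution {d : ℕ} {Ω : Set (Space d)} (T ν : ℝ) (f : ℝ → Hneg1 Ω)
    (v₀ : L2 Ω (Space d)) (v : ℝ → H10sol Ω) : Prop where
  memX : MemX T v
  weak_form : ∀ φ φ' : ℝ → SolTestField Ω, IsTimeTest T φ φ' →
    - (∫ t in Ioo 0 T, inner ℝ (val (v t)) (toL2 (φ' t).1))
      + (∫ t in Ioo 0 T, (ν * inner ℝ (wgrad (v t)) (wgrad (solToH (φ t)))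
          + conv (val (v t)) (wgrad (v t)) (toL2 (φ t).1)))
      = (∫ t in Ioo 0 T, pair (f t) (solToH (φ t))) + inner ℝ v₀ (toL2 (φ 0).1)

/-! ### Dissipative solutions -/

/-- Dissipative solutions, for the regularity measure `𝒦(w) = κ ‖w‖_{L^r}^s`: fields in `𝕏` that
satisfy the relative energy inequality against every `w ∈ C¹([0,T]; H² ∩ H¹_{0,σ})` for which
`𝒦(w)` is integrable on `(0,T)`. -/
structure IsDissipativeSolution {d : ℕ} {Ω : Set (Space d)} (T ν κ s : ℝ) (r : ℝ≥0∞)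
    (f : ℝ → Hneg1 Ω) (v₀ : L2 Ω (Space d)) (v : ℝ → H10sol Ω) : Prop where
  memX : MemX T v
  rel_energy : ∀ w : ℝ → H2sol Ω, ContDiffOn ℝ 1 w (Icc 0 T) →
    MemLsLr T s r (fun t => toH10sol (w t)) →
    ∀ᵐ t ∂(timeMeasure T),
      relEnergy (val (v t)) (val (toH10sol (w t)))
        + ∫ σ in (0 : ℝ)..t,
            (relDiss ν (v σ) (toH10sol (w σ))
              + solOp ν (f σ) (toH10sol (w σ)) (toH10sol (derivWithin w (Icc 0 T) σ))
                  (v σ - toH10sol (w σ)))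
            * Real.exp (∫ τ in σ..t, regMeasure κ s r (toH10sol (w τ)))
      ≤ relEnergy v₀ (val (toH10sol (w 0)))
          * Real.exp (∫ τ in (0 : ℝ)..t, regMeasure κ s r (toH10sol (w τ)))

end NSDiss

end

set_option linter.unusedSectionVars false

namespace NSDiss

open Filter Topology Metric

/-! ### Mollification -/

/-! The relative energy inequality of the dissipative solution `v¹` may be tested only with smooth
`w`, while the claim follows from what it would say for `w = v`. There the residual `𝒜_{f¹}(v)`
equals `f - f¹`, because `v` solves the equation with right-hand side `f`. The pairing of `f - f¹`
with `v¹ - v` is at most `C ‖f - f¹‖ ‖∇v¹ - ∇v‖` by Poincaré's inequality (`exists_norm_le_wgrad`),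
and Young's inequality spends half of the dissipation on it (`le_add_of_abs_le_mul`); hence `c =
C²`. The work lies in justifying `w = v` by approximation, which is
`IsDissipativeSolution.rel_energy_weak_of_lt`.

The Serrin condition makes this possible. Interpolated with the energy bounds it puts `v` in
`L⁴(0,T;L⁴)` (`exists_eLpNorm_four_le`), so `v ⊗ v` is in `L²(0,T;L²)`, and every term of the
equation, hence also `∂_t v`, is square integrable in time with values in the dual of `H¹_{0,σ}`.
Identifying this dual with `H¹_{0,σ}` by Riesz, the weak formulation reads `(L†L v)' = g`, where `L`
is the embedding into `L²` and `g` is `flux` (`IsWeakEvolution`). The residual of `w` is an affine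
bounded expression in `L†L ∂_t w`, `∇w` and `w ⊗ w`, so only these three have to converge in `L²`.

In time, `v` is mollified with kernels supported in `(-δ, 0)`, which look only into the future. The
mollified curve therefore satisfies the mollified equation exactly on `[0, T - δ)`, the initial time
included (`IsWeakEvolution.deriv_mollify`). The energy identity for the difference of two
mollifications makes their values at time zero a Cauchy family, and the weak form identifies the
limit as `v₀` (`IsWeakEvolution.exists_norm_mollify_zero_sub_le`).

In space, zero extension followed by mollification keeps fields divergence free but enlarges the
support. A Piola transform `φ ↦ adj(DΨ) (φ ∘ Ψ)` repairs this, where `Ψ` is close to the identity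
and moves the complement of `Ω` away from its closure. Such `Ψ` is a composition of small
displacements along the chart directions of the Lipschitz boundary (`exists_isPiola_outward`,
`exists_smoothing`). For fixed `δ` the mollified curve and its derivative are continuous in
`H¹_{0,σ}`, so strong convergence of the spatial operators suffices and no commutators have to be
estimated (`IsWeakEvolution.exists_approx`). Boundedness of these operators into `H²`, needed for
admissibility, comes from the closed graph theorem (`exists_lift_of_injective`).

It remains to pass to the limit in `𝒦(w)` and `w ⊗ w`. Jensen's inequality in time and norm factors
tending to one in space show that `∫ ‖w‖_r^s` and `∫ ‖w‖_4^4` do not exceed their values at `v` in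
the limit; the norms are lower semicontinuous under convergence in `L²`. The parallelogram identity
turns the two facts into strong convergence (`tendsto_eLpNorm_sub_of_le_liminf`), without any
density statement in `L^r`, so `r = ∞` is covered. The weighted integrals converge by
`tendsto_integral_mul_exp` on `(0, b)` with `b < T`, and `b` exhausts `T`. -/

/-- Mollification kernels of radius `δ`. -/
structure IsKernel {G : Type*} [NormedAddCommGroup G] [NormedSpace ℝ G] [MeasureSpace G]
    (δ : ℝ) (ρ : G → ℝ) : Prop where
  contDiff : ContDiff ℝ ∞ ρ
  hasCompactSupport : HasCompactSupport ρ
  nonneg : ∀ x, 0 ≤ ρ x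
  integral_eq_one : ∫ x, ρ x = 1
  support_subset : Function.support ρ ⊆ ball 0 δ

section

variable {G E : Type*} [NormedAddCommGroup G] [NormedSpace ℝ G] [FiniteDimensional ℝ G]
  [MeasureSpace G] [BorelSpace G] [(volume : Measure G).IsAddHaarMeasure]
  [NormedAddCommGroup E] [NormedSpace ℝ E]

/-- The average of `f` against the kernel `ρ`. -/
noncomputable def mollify (ρ : G → ℝ) (f : G → E) : G → E :=
  convolution ρ f (ContinuousLinearMap.lsmul ℝ ℝ) volume

theorem mollify_apply (ρ : G → ℝ) (f : G → E) (x : G) :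
    mollify ρ f x = ∫ y, ρ y • f (x - y) := rfl

theorem mollify_apply_swap (ρ : G → ℝ) (f : G → E) (x : G) :
    mollify ρ f x = ∫ y, ρ (x - y) • f y := convolution_lsmul_swap

variable {δ : ℝ} {ρ : G → ℝ}

theorem IsKernel.integrable (h : IsKernel δ ρ) : Integrable ρ :=
  integrable_of_integral_eq_one h.integral_eq_one

theorem IsKernel.lintegral_eq_one (h : IsKernel δ ρ) : ∫⁻ x, ENNReal.ofReal (ρ x) = 1 := by
  rw [← ofReal_integral_eq_lintegral_ofReal h.integrable (Eventually.of_forall h.nonneg),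
    h.integral_eq_one, ENNReal.ofReal_one]

theorem IsKernel.isProbabilityMeasure (h : IsKernel δ ρ) :
    IsProbabilityMeasure ((volume : Measure G).withDensity fun x => ENNReal.ofReal (ρ x)) :=
  ⟨by rw [withDensity_apply _ MeasurableSet.univ, Measure.restrict_univ, h.lintegral_eq_one]⟩

theorem IsKernel.measurable_ofReal (h : IsKernel δ ρ) :
    Measurable fun x => ENNReal.ofReal (ρ x) :=
  h.contDiff.continuous.measurable.ennreal_ofReal

theorem IsKernel.exists_mollify (h : IsKernel δ ρ) {f : G → E} (hf : LocallyIntegrable f) (x : G) :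
    Integrable fun y => ρ y • f (x - y) :=
  h.hasCompactSupport.convolutionExists_left (ContinuousLinearMap.lsmul ℝ ℝ)
    h.contDiff.continuous hf x

theorem IsKernel.mollify_add (h : IsKernel δ ρ) {f g : G → E} (hf : LocallyIntegrable f)
    (hg : LocallyIntegrable g) : mollify ρ (f + g) = mollify ρ f + mollify ρ g := by
  funext x
  simp only [mollify_apply, Pi.add_apply, smul_add]
  exact integral_add (h.exists_mollify hf x) (h.exists_mollify hg x)

theorem IsKernel.mollify_sub (h : IsKernel δ ρ) {f g : G → E} (hf : LocallyIntegrable f)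
    (hg : LocallyIntegrable g) : mollify ρ (f - g) = mollify ρ f - mollify ρ g := by
  funext x
  simp only [mollify_apply, Pi.sub_apply, smul_sub]
  exact integral_sub (h.exists_mollify hf x) (h.exists_mollify hg x)

theorem mollify_const_smul (c : ℝ) (f : G → E) : mollify ρ (c • f) = c • mollify ρ f := by
  funext x
  simp only [mollify_apply, Pi.smul_apply, smul_comm _ c, integral_smul]

theorem mollify_congr {f g : G → E} (h : f =ᵐ[volume] g) : mollify ρ f = mollify ρ g := by
  funext x
  rw [mollify_apply_swap, mollify_apply_swap]
  refine integral_congr_ae ?_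
  filter_upwards [h] with y hy
  rw [hy]

theorem IsKernel.contDiff_mollify (h : IsKernel δ ρ) {f : G → E} (hf : LocallyIntegrable f) :
    ContDiff ℝ ∞ (mollify ρ f) :=
  h.hasCompactSupport.contDiff_convolution_left (ContinuousLinearMap.lsmul ℝ ℝ) h.contDiff hf

theorem enorm_mollify_le (h : IsKernel δ ρ) (f : G → E) (x : G) :
    ‖mollify ρ f x‖ₑ ≤ ∫⁻ y, ENNReal.ofReal (ρ y) * ‖f (x - y)‖ₑ := by
  refine (enorm_integral_le_lintegral_enorm _).trans (lintegral_mono fun y => ?_)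
  rw [ContinuousLinearMap.lsmul_apply, enorm_smul, Real.enorm_eq_ofReal (h.nonneg y)]

/-- Jensen's inequality for averages of nonnegative functions. -/
theorem IsKernel.lintegral_rpow_le (h : IsKernel δ ρ) {φ : G → ℝ≥0∞} (hφ : AEMeasurable φ)
    {p : ℝ} (hp : 1 ≤ p) :
    (∫⁻ y, ENNReal.ofReal (ρ y) * φ y) ^ p ≤ ∫⁻ y, ENNReal.ofReal (ρ y) * φ y ^ p := by
  have hp0 : 0 < p := by linarith
  have hm := h.measurable_ofReal.aemeasurable (μ := volume)
  -- Hölder with exponents `1/p` and `1 - 1/p` for the pair `ρ φ^p`, `ρ`; the second factor has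
  -- total mass one.
  have h1 := ENNReal.lintegral_mul_norm_pow_le (μ := volume)
    (f := fun y => ENNReal.ofReal (ρ y) * φ y ^ p) (g := fun y => ENNReal.ofReal (ρ y))
    (hm.mul (hφ.pow_const p)) hm (p := p⁻¹) (q := 1 - p⁻¹) (by positivity)
    (by rw [sub_nonneg]; exact inv_le_one_of_one_le₀ hp) (by ring)
  rw [h.lintegral_eq_one, ENNReal.one_rpow, mul_one] at h1
  have h2 : ∀ y, (ENNReal.ofReal (ρ y) * φ y ^ p) ^ p⁻¹ * ENNReal.ofReal (ρ y) ^ (1 - p⁻¹)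
      = ENNReal.ofReal (ρ y) * φ y := by
    intro y
    rw [ENNReal.mul_rpow_of_nonneg _ _ (by positivity), ← ENNReal.rpow_mul,
      mul_inv_cancel₀ hp0.ne', ENNReal.rpow_one, mul_right_comm,
      ← ENNReal.rpow_add_of_nonneg _ _ (by positivity)
        (by rw [sub_nonneg]; exact inv_le_one_of_one_le₀ hp)]
    simp
  simp only [h2] at h1
  calc (∫⁻ y, ENNReal.ofReal (ρ y) * φ y) ^ p
      ≤ ((∫⁻ y, ENNReal.ofReal (ρ y) * φ y ^ p) ^ p⁻¹) ^ p :=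
        ENNReal.rpow_le_rpow h1 hp0.le
    _ = _ := by rw [← ENNReal.rpow_mul, inv_mul_cancel₀ hp0.ne', ENNReal.rpow_one]

/-- Tonelli and translation invariance reduce the double integral to the total mass of the kernel.
-/
theorem lintegral_lintegral_translate (h : IsKernel δ ρ) {φ : G → ℝ≥0∞} (hφ : AEMeasurable φ) :
    ∫⁻ x, ∫⁻ y, ENNReal.ofReal (ρ y) * φ (x - y) = ∫⁻ x, φ x := by
  rw [lintegral_lintegral_swap]
  · have : ∀ y, ∫⁻ x, ENNReal.ofReal (ρ y) * φ (x - y) = ENNReal.ofReal (ρ y) * ∫⁻ x, φ x := by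
      intro y
      rw [lintegral_const_mul' _ _ ENNReal.ofReal_ne_top, lintegral_sub_right_eq_self φ y]
    simp only [this]
    rw [lintegral_mul_const _ h.measurable_ofReal, h.lintegral_eq_one, one_mul]
  · refine (h.measurable_ofReal.aemeasurable.comp_snd).mul ?_
    exact hφ.comp_quasiMeasurePreserving (quasiMeasurePreserving_sub volume volume)

/-- Young's inequality for mollification. -/
theorem IsKernel.eLpNorm_mollify_le (h : IsKernel δ ρ) {f : G → E}
    (hf : AEStronglyMeasurable f) {p : ℝ≥0∞} (hp : 1 ≤ p) :
    eLpNorm (mollify ρ f) p volume ≤ eLpNorm f p volume := by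
  have hp0 : p ≠ 0 := (zero_lt_one.trans_le hp).ne'
  have hfx : ∀ x, AEMeasurable (fun y => ‖f (x - y)‖ₑ) := fun x =>
    hf.enorm.comp_quasiMeasurePreserving (quasiMeasurePreserving_sub_left volume x)
  rcases eq_or_ne p ⊤ with rfl | hp'
  · simp only [eLpNorm_exponent_top]
    refine eLpNormEssSup_le_of_ae_enorm_bound (Eventually.of_forall fun x => ?_)
    refine (enorm_mollify_le h f x).trans ?_
    have h1 : ∀ᵐ y, ‖f (x - y)‖ₑ ≤ eLpNormEssSup f volume :=
      (quasiMeasurePreserving_sub_left (volume : Measure G) x).ae (ae_le_eLpNormEssSup (f := f))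
    calc ∫⁻ y, ENNReal.ofReal (ρ y) * ‖f (x - y)‖ₑ
        ≤ ∫⁻ y, ENNReal.ofReal (ρ y) * eLpNormEssSup f volume := by
          refine lintegral_mono_ae ?_
          filter_upwards [h1] with y hy
          gcongr
      _ = eLpNormEssSup f volume := by
          rw [lintegral_mul_const _ h.measurable_ofReal, h.lintegral_eq_one, one_mul]
  · have hp1 : 1 ≤ p.toReal := by
      rw [← ENNReal.toReal_one]
      exact ENNReal.toReal_mono hp' hp
    rw [eLpNorm_eq_lintegral_rpow_enorm_toReal hp0 hp', eLpNorm_eq_lintegral_rpow_enorm_toReal hp0 hp']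
    refine ENNReal.rpow_le_rpow ?_ (by positivity)
    calc ∫⁻ x, ‖mollify ρ f x‖ₑ ^ p.toReal
        ≤ ∫⁻ x, ∫⁻ y, ENNReal.ofReal (ρ y) * ‖f (x - y)‖ₑ ^ p.toReal := by
          refine lintegral_mono fun x => ?_
          exact (ENNReal.rpow_le_rpow (enorm_mollify_le h f x) (by positivity)).trans
            (h.lintegral_rpow_le (hfx x) hp1)
      _ = _ := lintegral_lintegral_translate h (hf.enorm.pow_const _)

theorem IsKernel.memLp_mollify (h : IsKernel δ ρ) {f : G → E} {p : ℝ≥0∞} (hp : 1 ≤ p)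
    (hf : MemLp f p volume) : MemLp (mollify ρ f) p volume :=
  ⟨(h.contDiff_mollify (hf.locallyIntegrable hp)).continuous.aestronglyMeasurable,
    (h.eLpNorm_mollify_le hf.1 hp).trans_lt hf.2⟩

theorem IsKernel.mollify_eq_zero (h : IsKernel δ ρ) {f : G → E} {x : G}
    (hx : ∀ y ∈ ball x δ, f y = 0) : mollify ρ f x = 0 := by
  rw [mollify_apply]
  refine integral_eq_zero_of_ae (Eventually.of_forall fun y => ?_)
  by_cases hy : ρ y = 0
  · simp [hy]
  · have := h.support_subset hy
    have h2 := hx (x - y) (by simpa [mem_ball, dist_eq_norm] using this)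
    simp [h2]

theorem IsKernel.dist_mollify_le [CompleteSpace E] (h : IsKernel δ ρ) {f : G → E} {x : G} {z : E}
    {ε : ℝ} (hε : 0 ≤ ε) (hf : AEStronglyMeasurable f) (hx : ∀ y ∈ ball x δ, dist (f y) z ≤ ε) :
    dist (mollify ρ f x) z ≤ ε :=
  dist_convolution_le hε h.support_subset h.nonneg h.integral_eq_one hf hx

/-- Mollifications converge in `L^p`, uniformly over all kernels of small radius. -/
theorem exists_eLpNorm_mollify_sub_le [CompleteSpace E] {f : G → E} {p : ℝ≥0∞} (hp : 1 ≤ p)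
    (hp' : p ≠ ⊤) (hf : MemLp f p (volume : Measure G)) {ε : ℝ≥0∞} (hε : ε ≠ 0) :
    ∃ δ₀ > 0, ∀ (δ : ℝ) (ρ : G → ℝ), δ ≤ δ₀ → IsKernel δ ρ →
      eLpNorm (mollify ρ f - f) p volume ≤ ε := by
  have hε3 : ε / 3 ≠ 0 := by simp [hε]
  have hp0 : p ≠ 0 := (zero_lt_one.trans_le hp).ne'
  obtain ⟨g, hgs, hfg, hgc, hgm⟩ := hf.exists_hasCompactSupport_eLpNorm_sub_le hp' hε3
  -- Mollifications of `g` with radius at most one live in `K`, so a uniform error `η` on `K` is an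
  -- `L^p` error. `K` depends on `g` alone, which makes `δ₀` independent of the kernel.
  set K := cthickening 1 (tsupport g)
  have hK : IsCompact K := hgs.isCompact.cthickening
  have hKm : volume K ≠ ⊤ := hK.measure_lt_top.ne
  obtain ⟨η, hη, hηε⟩ : ∃ η : ℝ, 0 < η ∧ ENNReal.ofReal η * volume K ^ (1 / p.toReal) ≤ ε / 3 := by
    have ht : Tendsto (fun η : ℝ => ENNReal.ofReal η * volume K ^ (1 / p.toReal)) (𝓝[>] 0)
        (𝓝 (ENNReal.ofReal 0 * volume K ^ (1 / p.toReal))) := by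
      refine ENNReal.Tendsto.mul_const ?_ (Or.inr ?_)
      · exact (ENNReal.continuous_ofReal.tendsto 0).mono_left nhdsWithin_le_nhds
      · exact ENNReal.rpow_ne_top_of_nonneg (by positivity) hKm
    rw [ENNReal.ofReal_zero, zero_mul] at ht
    have := (ht.eventually (ge_mem_nhds (pos_iff_ne_zero.2 hε3))).and self_mem_nhdsWithin
    obtain ⟨η, h1, h2⟩ := this.exists
    exact ⟨η, h2, h1⟩
  obtain ⟨δ₁, hδ₁, hunif⟩ := Metric.uniformContinuous_iff.1
    (hgs.uniformContinuous_of_continuous hgc) η hη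
  refine ⟨min δ₁ 1, by positivity, fun δ ρ hδ h => ?_⟩
  have hfl := hf.locallyIntegrable hp
  have hgl := hgm.locallyIntegrable hp
  have hclose : ∀ x, ‖(mollify ρ g - g) x‖ ≤ ‖K.indicator (fun _ => η) x‖ := by
    intro x
    by_cases hx : x ∈ K
    · rw [indicator_of_mem hx, Pi.sub_apply, ← dist_eq_norm, Real.norm_of_nonneg hη.le]
      refine h.dist_mollify_le hη.le hgm.1 fun y hy => (hunif ?_).le
      exact (mem_ball.1 hy).trans_le (hδ.trans (min_le_left _ _))
    · have h0 : ∀ y ∈ ball x 1, g y = 0 := by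
        intro y hy
        by_contra hne
        exact hx (mem_cthickening_of_dist_le x y 1 _ (subset_tsupport _ hne)
          (by rw [dist_comm]; exact (mem_ball.1 hy).le))
      have h1 : mollify ρ g x = 0 := h.mollify_eq_zero fun y hy =>
        h0 y (ball_subset_ball (hδ.trans (min_le_right _ _)) hy)
      simp [h1, h0 x (mem_ball_self one_pos)]
  have e1 : mollify ρ f - f = mollify ρ (f - g) + (mollify ρ g - g) + (g - f) := by
    rw [h.mollify_sub hfl hgl]
    abel
  have m1 : MemLp (mollify ρ (f - g)) p volume := h.memLp_mollify hp (hf.sub hgm)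
  have m2 : MemLp (mollify ρ g - g) p volume := (h.memLp_mollify hp hgm).sub hgm
  have b1 : eLpNorm (mollify ρ (f - g)) p volume ≤ ε / 3 :=
    (h.eLpNorm_mollify_le (hf.1.sub hgm.1) hp).trans hfg
  have b2 : eLpNorm (mollify ρ g - g) p volume ≤ ε / 3 := by
    refine (eLpNorm_mono hclose).trans ?_
    rw [eLpNorm_indicator_const hK.measurableSet hp0 hp', Real.enorm_eq_ofReal hη.le]
    exact hηε
  have b3 : eLpNorm (g - f) p volume ≤ ε / 3 := by
    rw [← neg_sub, eLpNorm_neg]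
    exact hfg
  rw [e1]
  calc _ ≤ eLpNorm (mollify ρ (f - g) + (mollify ρ g - g)) p volume + eLpNorm (g - f) p volume :=
        eLpNorm_add_le (m1.add m2).1 (hgm.sub hf).1 hp
    _ ≤ (eLpNorm (mollify ρ (f - g)) p volume + eLpNorm (mollify ρ g - g) p volume)
          + eLpNorm (g - f) p volume := by
        gcongr
        exact eLpNorm_add_le m1.1 m2.1 hp
    _ ≤ ε / 3 + ε / 3 + ε / 3 := by gcongr
    _ = ε := ENNReal.add_thirds ε

end

/-- Kernels of arbitrarily small radius exist. -/
theorem exists_isKernel {G : Type*} [NormedAddCommGroup G] [InnerProductSpace ℝ G]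
    [FiniteDimensional ℝ G] [MeasureSpace G] [BorelSpace G]
    [(volume : Measure G).IsAddHaarMeasure] {δ : ℝ} (hδ : 0 < δ) :
    ∃ ρ : G → ℝ, IsKernel δ ρ := by
  let φ : ContDiffBump (0 : G) := ⟨δ / 2, δ, by positivity, by linarith⟩
  exact ⟨φ.normed volume, φ.contDiff_normed, φ.hasCompactSupport_normed, φ.nonneg_normed,
    φ.integral_normed, φ.support_normed_eq.subset⟩

/-- One-sided kernels on the line. -/
theorem exists_isKernel_of_neg {δ : ℝ} (hδ : 0 < δ) :
    ∃ ρ : ℝ → ℝ, IsKernel δ ρ ∧ Function.support ρ ⊆ Ioo (-δ) 0 := by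
  -- As `mollify ρ f t` averages `f (t - y)`, support in `(-δ, 0)` means that only values of `f` on
  -- `(t, t + δ)` enter.
  let φ : ContDiffBump (-(δ / 2)) := ⟨δ / 4, δ / 2, by positivity, by linarith⟩
  have hs : Function.support (φ.normed volume) ⊆ Ioo (-δ) 0 := by
    rw [φ.support_normed_eq, Real.ball_eq_Ioo]
    intro x hx
    simp only [φ, mem_Ioo] at hx ⊢
    constructor <;> linarith [hx.1, hx.2]
  refine ⟨φ.normed volume, ⟨φ.contDiff_normed, φ.hasCompactSupport_normed, φ.nonneg_normed,
    φ.integral_normed, hs.trans ?_⟩, hs⟩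
  rw [Real.ball_eq_Ioo]
  exact Ioo_subset_Ioo (by simp) (by linarith)

/-! ### Piola transforms -/

section Divergence

variable {d : ℕ}

/-- The trace of an endomorphism of `ℝ^d` in the standard basis. -/
noncomputable def divg (L : Space d →L[ℝ] Space d) : ℝ := ∑ i, L (basisVec i) i

theorem divg_add (L K : Space d →L[ℝ] Space d) : divg (L + K) = divg L + divg K := by
  simp [divg, Finset.sum_add_distrib]

theorem divg_smul (c : ℝ) (L : Space d →L[ℝ] Space d) : divg (c • L) = c * divg L := by
  simp [divg, Finset.mul_sum]

theorem sum_smul_basisVec (x : Space d) : ∑ i, x i • (basisVec i : Space d) = x := by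
  ext j
  simp [Finset.sum_apply, Pi.single_apply]

/-- Traces of rank-one maps are evaluations; this is how the divergence in `divg_elementary` is
reduced to scalars that cancel. -/
theorem divg_smulRight (c : Space d →L[ℝ] ℝ) (v : Space d) : divg (c.smulRight v) = c v := by
  conv_rhs => rw [← sum_smul_basisVec v]
  simp [divg, map_sum, mul_comm]

theorem sum_grad_diag (φ : Space d → Space d) (x : Space d) :
    ∑ i, grad φ x (i, i) = divg (fderiv ℝ φ x) := rfl

end Divergence

/-- A Piola transform `φ ↦ M (φ ∘ Ψ)` that preserves divergence free fields and is `κ`-close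
to the identity. -/
structure IsPiola {d : ℕ} (κ : ℝ) (Ψ : Space d → Space d)
    (M : Space d → Space d →L[ℝ] Space d) : Prop where
  contDiff_map : ContDiff ℝ ∞ Ψ
  contDiff_mat : ContDiff ℝ ∞ M
  map_sub : ∀ x, ‖Ψ x - x‖ ≤ κ
  fderiv_map_sub : ∀ x, ‖fderiv ℝ Ψ x - ContinuousLinearMap.id ℝ _‖ ≤ κ
  mat_sub : ∀ x, ‖M x - ContinuousLinearMap.id ℝ _‖ ≤ κ
  fderiv_mat : ∀ x, ‖fderiv ℝ M x‖ ≤ κ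
  map_volume : Measure.map Ψ volume ≤ ENNReal.ofReal (1 + κ) • volume
  divFree : ∀ φ : Space d → Space d, ContDiff ℝ ∞ φ → (∀ x, divg (fderiv ℝ φ x) = 0) →
    ∀ x, divg (fderiv ℝ (fun x => M x (φ (Ψ x))) x) = 0

section Piola

variable {d : ℕ} {κ : ℝ} {Ψ : Space d → Space d} {M : Space d → Space d →L[ℝ] Space d}

theorem IsPiola.mono (h : IsPiola κ Ψ M) {κ' : ℝ} (hκ : κ ≤ κ') : IsPiola κ' Ψ M where
  contDiff_map := h.contDiff_map
  contDiff_mat := h.contDiff_mat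
  map_sub x := (h.map_sub x).trans hκ
  fderiv_map_sub x := (h.fderiv_map_sub x).trans hκ
  mat_sub x := (h.mat_sub x).trans hκ
  fderiv_mat x := (h.fderiv_mat x).trans hκ
  map_volume := h.map_volume.trans (by gcongr)
  divFree := h.divFree

theorem isPiola_id : IsPiola 0 (fun x : Space d => x) fun _ => ContinuousLinearMap.id ℝ _ where
  contDiff_map := contDiff_id
  contDiff_mat := contDiff_const
  map_sub x := by simp
  fderiv_map_sub x := by simp
  mat_sub x := by simp
  fderiv_mat x := by
    rw [fderiv_fun_const]
    exact (norm_zero (E := Space d →L[ℝ] Space d →L[ℝ] Space d)).le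
  map_volume := by simp
  divFree φ _ h := by simpa using h

theorem IsPiola.nonneg (h : IsPiola κ Ψ M) : 0 ≤ κ := (norm_nonneg _).trans (h.map_sub 0)

theorem norm_le_one_add {E : Type*} [NormedAddCommGroup E] [NormedSpace ℝ E] {A : E →L[ℝ] E}
    {κ : ℝ} (h : ‖A - ContinuousLinearMap.id ℝ _‖ ≤ κ) : ‖A‖ ≤ 1 + κ := by
  calc ‖A‖ = ‖(A - ContinuousLinearMap.id ℝ _) + ContinuousLinearMap.id ℝ _‖ := by simp
    _ ≤ κ + 1 := (norm_add_le _ _).trans (add_le_add h ContinuousLinearMap.norm_id_le)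
    _ = 1 + κ := add_comm _ _

/-- Uses `A B - 1 = (A - 1) B + (B - 1)` and `‖B‖ ≤ 2`. -/
theorem norm_comp_sub_id_le {E : Type*} [NormedAddCommGroup E] [NormedSpace ℝ E] {A B : E →L[ℝ] E}
    {κ κ' : ℝ} (hA : ‖A - ContinuousLinearMap.id ℝ _‖ ≤ κ)
    (hB : ‖B - ContinuousLinearMap.id ℝ _‖ ≤ κ') (hκ' : κ' ≤ 1) :
    ‖A.comp B - ContinuousLinearMap.id ℝ _‖ ≤ 2 * κ + κ' := by
  have hκ0 : 0 ≤ κ := (norm_nonneg _).trans hA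
  have e : A.comp B - ContinuousLinearMap.id ℝ _ =
      (A - ContinuousLinearMap.id ℝ _).comp B + (B - ContinuousLinearMap.id ℝ _) := by
    ext x
    simp
  rw [e]
  refine (norm_add_le _ _).trans (add_le_add ?_ hB)
  refine (ContinuousLinearMap.opNorm_comp_le _ _).trans ?_
  calc _ ≤ κ * (1 + κ') := mul_le_mul hA (norm_le_one_add hB) (norm_nonneg _) hκ0
    _ ≤ κ * 2 := by gcongr; linarith
    _ = 2 * κ := mul_comm _ _

theorem IsPiola.differentiable_map (h : IsPiola κ Ψ M) : Differentiable ℝ Ψ :=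
  h.contDiff_map.differentiable (by simp)

theorem IsPiola.differentiable_mat (h : IsPiola κ Ψ M) : Differentiable ℝ M :=
  h.contDiff_mat.differentiable (by simp)

theorem IsPiola.contDiff_transform (h : IsPiola κ Ψ M) {φ : Space d → Space d}
    (hφ : ContDiff ℝ ∞ φ) : ContDiff ℝ ∞ fun x => M x (φ (Ψ x)) :=
  h.contDiff_mat.clm_apply (hφ.comp h.contDiff_map)

/-- Transforming by `(Ψ₂, M₂)` and the result by `(Ψ, M)` is again a transform of this form, so
preservation of divergence free fields is inherited. The constant is dictated by the product rule
for the derivative of `M (M₂ ∘ Ψ)`; the other bounds need less. -/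
theorem IsPiola.comp {κ₂ : ℝ} {Ψ₂ : Space d → Space d} {M₂ : Space d → Space d →L[ℝ] Space d}
    (h : IsPiola κ Ψ M) (h₂ : IsPiola κ₂ Ψ₂ M₂) (hκ : κ ≤ 1) (hκ₂ : κ₂ ≤ 1) :
    IsPiola (2 * κ + 4 * κ₂) (fun x => Ψ₂ (Ψ x)) fun x => (M x).comp (M₂ (Ψ x)) where
  contDiff_map := h₂.contDiff_map.comp h.contDiff_map
  contDiff_mat := h.contDiff_mat.clm_comp (h₂.contDiff_mat.comp h.contDiff_map)
  map_sub x := by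
    have h1 := h.map_sub x
    have h2 := h₂.map_sub (Ψ x)
    have := norm_sub_le_norm_sub_add_norm_sub (Ψ₂ (Ψ x)) (Ψ x) x
    linarith [h.nonneg, h₂.nonneg]
  fderiv_map_sub x := by
    rw [fderiv_fun_comp x (h₂.differentiable_map _) (h.differentiable_map x)]
    refine (norm_comp_sub_id_le (h₂.fderiv_map_sub _) (h.fderiv_map_sub x) hκ).trans ?_
    linarith [h.nonneg, h₂.nonneg]
  mat_sub x := by
    refine (norm_comp_sub_id_le (h.mat_sub x) (h₂.mat_sub _) hκ₂).trans ?_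
    linarith [h.nonneg, h₂.nonneg]
  fderiv_mat x := by
    have d1 := (h.differentiable_mat x).hasFDerivAt
    have d2 := ((h₂.differentiable_mat (Ψ x)).hasFDerivAt).comp x
      (h.differentiable_map x).hasFDerivAt
    have e : fderiv ℝ (fun x => (M x).comp (M₂ (Ψ x))) x = _ := (d1.clm_comp d2).fderiv
    rw [e]
    refine ContinuousLinearMap.opNorm_le_bound _ (by linarith [h.nonneg, h₂.nonneg]) fun v => ?_
    simp only [add_apply, ContinuousLinearMap.comp_apply,
      ContinuousLinearMap.compL_apply, ContinuousLinearMap.flip_apply]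
    have b1 : ‖fderiv ℝ M₂ (Ψ x) (fderiv ℝ Ψ x v)‖ ≤ κ₂ * (2 * ‖v‖) := by
      refine (ContinuousLinearMap.le_opNorm _ _).trans (mul_le_mul (h₂.fderiv_mat _) ?_
        (norm_nonneg _) h₂.nonneg)
      refine (ContinuousLinearMap.le_opNorm _ _).trans ?_
      gcongr
      linarith [norm_le_one_add (h.fderiv_map_sub x)]
    have b2 : ‖fderiv ℝ M x v‖ ≤ κ * ‖v‖ :=
      (ContinuousLinearMap.le_opNorm _ _).trans (by gcongr; exact h.fderiv_mat x)
    have b3 : ‖M x‖ ≤ 2 := by linarith [norm_le_one_add (h.mat_sub x)]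
    have b4 : ‖M₂ (Ψ x)‖ ≤ 2 := by linarith [norm_le_one_add (h₂.mat_sub (Ψ x))]
    refine (norm_add_le _ _).trans ?_
    calc _ ≤ 2 * (κ₂ * (2 * ‖v‖)) + (κ * ‖v‖) * 2 := by
          refine add_le_add ((ContinuousLinearMap.opNorm_comp_le _ _).trans ?_)
            ((ContinuousLinearMap.opNorm_comp_le _ _).trans ?_)
          · exact mul_le_mul b3 b1 (norm_nonneg _) (by norm_num)
          · exact mul_le_mul b2 b4 (norm_nonneg _) (mul_nonneg h.nonneg (norm_nonneg _))
      _ = _ := by ring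
  map_volume := by
    have e : Measure.map (fun x => Ψ₂ (Ψ x)) volume = Measure.map Ψ₂ (Measure.map Ψ volume) :=
      (Measure.map_map h₂.contDiff_map.continuous.measurable
        h.contDiff_map.continuous.measurable).symm
    rw [e]
    calc Measure.map Ψ₂ (Measure.map Ψ volume)
        ≤ Measure.map Ψ₂ (ENNReal.ofReal (1 + κ) • volume) :=
          Measure.map_mono h.map_volume h₂.contDiff_map.continuous.measurable
      _ = ENNReal.ofReal (1 + κ) • Measure.map Ψ₂ volume := Measure.map_smul ..
      _ ≤ ENNReal.ofReal (1 + κ) • ENNReal.ofReal (1 + κ₂) • volume := by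
          gcongr
          exact h₂.map_volume
      _ = ENNReal.ofReal ((1 + κ) * (1 + κ₂)) • volume := by
          rw [smul_smul, ENNReal.ofReal_mul (by linarith [h.nonneg])]
      _ ≤ _ := by
          gcongr
          nlinarith [h.nonneg, h₂.nonneg]
  divFree φ hφ hd x :=
    h.divFree _ (h₂.contDiff_transform hφ) (h₂.divFree φ hφ hd) x

theorem IsPiola.hasFDerivAt_transform (h : IsPiola κ Ψ M) {φ : Space d → Space d}
    (hφ : Differentiable ℝ φ) (x : Space d) :
    HasFDerivAt (fun x => M x (φ (Ψ x)))
      ((M x).comp ((fderiv ℝ φ (Ψ x)).comp (fderiv ℝ Ψ x)) +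
        (fderiv ℝ M x).flip (φ (Ψ x))) x :=
  (h.differentiable_mat x).hasFDerivAt.clm_apply
    ((hφ (Ψ x)).hasFDerivAt.comp x (h.differentiable_map x).hasFDerivAt)

/-! ### The elementary transform -/

/-- `a ↦ a ⊗ n - a(n) id`. -/
noncomputable def cofL (n : Space d) : (Space d →L[ℝ] ℝ) →L[ℝ] (Space d →L[ℝ] Space d) :=
  (ContinuousLinearMap.smulRightL ℝ (Space d) (Space d)).flip n -
    (ContinuousLinearMap.apply ℝ ℝ n).smulRight (ContinuousLinearMap.id ℝ (Space d))

theorem cofL_apply (n : Space d) (a : Space d →L[ℝ] ℝ) :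
    cofL n a = a.smulRight n - a n • ContinuousLinearMap.id ℝ (Space d) := by
  simp [cofL]

theorem norm_cofL_apply_le {n : Space d} (hn : ‖n‖ = 1) (a : Space d →L[ℝ] ℝ) :
    ‖cofL n a‖ ≤ 2 * ‖a‖ := by
  rw [cofL_apply]
  refine (norm_sub_le _ _).trans ?_
  rw [ContinuousLinearMap.norm_smulRight_apply, hn, norm_smul]
  have h1 : ‖a n‖ ≤ ‖a‖ := by simpa [hn] using a.le_opNorm n
  have h2 : ‖ContinuousLinearMap.id ℝ (Space d)‖ ≤ 1 := ContinuousLinearMap.norm_id_le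
  nlinarith [norm_nonneg (a n), norm_nonneg (ContinuousLinearMap.id ℝ (Space d)), norm_nonneg a]

theorem hasFDerivAt_displacement {n : Space d} {η : Space d → ℝ} (hη : ContDiff ℝ ∞ η) (ε : ℝ)
    (x : Space d) : HasFDerivAt (fun x => x - (ε * η x) • n)
      (ContinuousLinearMap.id ℝ (Space d) - ε • (fderiv ℝ η x).smulRight n) x := by
  have hη1 : HasFDerivAt η (fderiv ℝ η x) x := (hη.differentiable (by simp) x).hasFDerivAt
  have := (hasFDerivAt_id x).sub ((hη1.const_mul ε).smul_const n)
  convert! this using 1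
  ext v
  simp [mul_smul]

/-- For `DΨ = 1 - ε a ⊗ n` with `a = Dη`, the matrix `1 + ε (a ⊗ n - a(n))` is the adjugate of `DΨ`,
so this is the classical Piola transform. For this special displacement the Piola identity is a
short computation with traces, in which the terms with second derivatives of `η` cancel by symmetry.
-/
theorem divg_elementary {n : Space d} {η : Space d → ℝ} (hη : ContDiff ℝ ∞ η) (ε : ℝ)
    {φ : Space d → Space d} (hφ : ContDiff ℝ ∞ φ) (hd : ∀ x, divg (fderiv ℝ φ x) = 0)
    (x : Space d) :
    divg (fderiv ℝ (fun x => (ContinuousLinearMap.id ℝ (Space d) + ε • cofL n (fderiv ℝ η x))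
      (φ (x - (ε * η x) • n))) x) = 0 := by
  have hη1 : HasFDerivAt η (fderiv ℝ η x) x :=
    (hη.differentiable (by simp) x).hasFDerivAt
  have hη2 : HasFDerivAt (fderiv ℝ η) (fderiv ℝ (fderiv ℝ η) x) x :=
    (((hη.fderiv_right (m := ∞) (by simp)).differentiable (by simp)) x).hasFDerivAt
  set a := fderiv ℝ η x
  set H := fderiv ℝ (fderiv ℝ η) x
  set Dm := ContinuousLinearMap.id ℝ (Space d) - ε • a.smulRight n with hDm
  have hΨ : HasFDerivAt (fun x => x - (ε * η x) • n) Dm x := hasFDerivAt_displacement hη ε x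
  set y := x - (ε * η x) • n
  have hφ1 : HasFDerivAt φ (fderiv ℝ φ y) y := (hφ.differentiable (by simp) y).hasFDerivAt
  set D := fderiv ℝ φ y
  have hM : HasFDerivAt (fun x => ContinuousLinearMap.id ℝ (Space d) + ε • cofL n (fderiv ℝ η x))
      (ε • (cofL n).comp H) x :=
    (((cofL n).hasFDerivAt.comp x hη2).const_smul ε).const_add _
  have hsymm : ∀ v w, H v w = H w v := by
    intro v w
    have : IsSymmSndFDerivAt ℝ η x :=
      (hη.contDiffAt).isSymmSndFDerivAt (by
        rw [minSmoothness_of_isRCLikeNormedField]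
        exact WithTop.coe_le_coe.2 (le_top : (2 : ℕ∞) ≤ ⊤))
    exact this v w
  have hP : fderiv ℝ (fun x => (ContinuousLinearMap.id ℝ (Space d) + ε • cofL n (fderiv ℝ η x))
      (φ (x - (ε * η x) • n))) x = _ := (hM.clm_apply (hφ1.comp x hΨ)).fderiv
  rw [hP]
  set z := φ y
  -- The derivative split into a multiple of `D`, which has trace zero, and rank-one maps. The
  -- traces of the latter sum to zero: the first bracket by algebra, the second by `hsymm`.
  have e : (ContinuousLinearMap.id ℝ (Space d) + ε • cofL n a).comp (D.comp Dm) +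
      (ε • (cofL n).comp H).flip z =
      ((1 - ε * a n) • D + (-(ε * (1 - ε * a n))) • a.smulRight (D n)
        + ε • (a.comp D).smulRight n + (-(ε ^ 2 * a (D n))) • a.smulRight n)
      + (ε • (H.flip z).smulRight n + (-ε) • (H.flip n).smulRight z) := by
    ext v i
    simp [cofL_apply, hDm]
    ring
  have e2 : (Function.comp φ fun x => x - (ε * η x) • n) x = z := rfl
  rw [e2, e]
  simp only [divg_add, divg_smul, divg_smulRight, ContinuousLinearMap.comp_apply,
    ContinuousLinearMap.flip_apply]
  have : divg D = 0 := hd y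
  rw [this, hsymm n z]
  ring

/-- The displacement is a contraction up to the identity, since `ε L ≤ 1/2`, so `Ψ` is injective;
its Jacobian determinant `1 - ε ∂_n η` is at least `1 - ε L`. By the area formula preimages grow by
at most `1 / (1 - ε L) ≤ 1 + 2 ε L`. -/
theorem map_volume_elementary {n : Space d} (hn : ‖n‖ = 1) {η : Space d → ℝ}
    (hη : ContDiff ℝ ∞ η) {L ε : ℝ} (hL : ∀ x, ‖fderiv ℝ η x‖ ≤ L) (hε : 0 ≤ ε)
    (hεL : ε * L ≤ 1 / 2) :
    Measure.map (fun x => x - (ε * η x) • n) (volume : Measure (Space d)) ≤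
      ENNReal.ofReal (1 + 2 * (ε * L)) • volume := by
  have hL0 : 0 ≤ L := (norm_nonneg _).trans (hL 0)
  set Ψ : Space d → Space d := fun x => x - (ε * η x) • n
  have hΨc : Continuous Ψ := by
    have := hη.continuous
    fun_prop
  have hlip : ∀ x y, ‖η x - η y‖ ≤ L * ‖x - y‖ := fun x y =>
    Convex.norm_image_sub_le_of_norm_fderiv_le (s := univ)
      (fun z _ => hη.differentiable (by simp) z) (fun z _ => hL z) convex_univ trivial trivial
  have hinj : Function.Injective Ψ := by
    intro x y hxy
    have h1 : x - y = (ε * (η x - η y)) • n := by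
      have : x - (ε * η x) • n = y - (ε * η y) • n := hxy
      rw [mul_sub, sub_smul]
      rw [← sub_eq_zero] at this ⊢
      rw [← this]
      abel
    have h2 : ‖x - y‖ ≤ 1 / 2 * ‖x - y‖ := by
      calc ‖x - y‖ = ε * ‖η x - η y‖ := by
            rw [h1, norm_smul, hn, mul_one, norm_mul, Real.norm_of_nonneg hε]
        _ ≤ ε * (L * ‖x - y‖) := by gcongr; exact hlip x y
        _ = (ε * L) * ‖x - y‖ := by ring
        _ ≤ _ := by gcongr
    have h3 : ‖x - y‖ = 0 := by linarith [norm_nonneg (x - y)]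
    exact sub_eq_zero.1 (norm_eq_zero.1 h3)
  have hder : ∀ x, HasFDerivAt Ψ
      (ContinuousLinearMap.id ℝ (Space d) - ε • (fderiv ℝ η x).smulRight n) x :=
    hasFDerivAt_displacement hη ε
  have hdet : ∀ x, (ContinuousLinearMap.id ℝ (Space d) - ε • (fderiv ℝ η x).smulRight n).det
      = 1 - ε * fderiv ℝ η x n := by
    intro x
    -- The derivative is a transvection, whose determinant is one plus the functional evaluated at
    -- the direction.
    have := LinearMap.transvection.det (-(ε • (fderiv ℝ η x : Space d →ₗ[ℝ] ℝ))) n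
    rw [ContinuousLinearMap.det]
    convert this using 2
    · ext v
      simp [LinearMap.transvection.apply, sub_eq_add_neg, mul_smul]
    · simp [sub_eq_add_neg]
  refine Measure.le_iff.2 fun s hs => ?_
  rw [Measure.map_apply hΨc.measurable hs, Measure.smul_apply, smul_eq_mul]
  have hpre : MeasurableSet (Ψ ⁻¹' s) := hΨc.measurable hs
  have hcv := lintegral_image_eq_lintegral_abs_det_fderiv_mul volume hpre
    (fun x _ => (hder x).hasFDerivWithinAt) hinj.injOn (fun _ => 1)
  simp only [lintegral_one, Measure.restrict_apply_univ, mul_one, hdet] at hcv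
  have hlow : ENNReal.ofReal (1 - ε * L) * volume (Ψ ⁻¹' s) ≤ volume s := by
    calc ENNReal.ofReal (1 - ε * L) * volume (Ψ ⁻¹' s)
        = ∫⁻ _ in Ψ ⁻¹' s, ENNReal.ofReal (1 - ε * L) := by simp
      _ ≤ ∫⁻ x in Ψ ⁻¹' s, ENNReal.ofReal |1 - ε * fderiv ℝ η x n| := by
          refine lintegral_mono fun x => ENNReal.ofReal_le_ofReal ?_
          refine le_trans ?_ (le_abs_self _)
          have : fderiv ℝ η x n ≤ L := by
            refine (Real.le_norm_self _).trans ((ContinuousLinearMap.le_opNorm _ _).trans ?_)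
            rw [hn, mul_one]
            exact hL x
          nlinarith
      _ = volume (Ψ '' (Ψ ⁻¹' s)) := hcv.symm
      _ ≤ volume s := measure_mono (image_preimage_subset _ _)
  have h1 : 1 ≤ (1 + 2 * (ε * L)) * (1 - ε * L) := by nlinarith [mul_nonneg hε hL0]
  calc volume (Ψ ⁻¹' s) = ENNReal.ofReal 1 * volume (Ψ ⁻¹' s) := by simp
    _ ≤ ENNReal.ofReal ((1 + 2 * (ε * L)) * (1 - ε * L)) * volume (Ψ ⁻¹' s) := by gcongr
    _ = ENNReal.ofReal (1 + 2 * (ε * L)) * (ENNReal.ofReal (1 - ε * L) * volume (Ψ ⁻¹' s)) := by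
        rw [ENNReal.ofReal_mul (by nlinarith [mul_nonneg hε hL0]), mul_assoc]
    _ ≤ _ := by gcongr

theorem isPiola_elementary {n : Space d} (hn : ‖n‖ = 1) {η : Space d → ℝ}
    (hη : ContDiff ℝ ∞ η) {L₀ L₁ L₂ ε κ : ℝ} (hL₀ : ∀ x, ‖η x‖ ≤ L₀)
    (hL₁ : ∀ x, ‖fderiv ℝ η x‖ ≤ L₁) (hL₂ : ∀ x, ‖fderiv ℝ (fderiv ℝ η) x‖ ≤ L₂)
    (hε : 0 ≤ ε) (hκ : κ ≤ 1)
    (hsum : ε * L₀ + 2 * (ε * L₁) + 2 * (ε * L₂) ≤ κ) :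
    IsPiola κ (fun x => x - (ε * η x) • n)
      (fun x => ContinuousLinearMap.id ℝ (Space d) + ε • cofL n (fderiv ℝ η x)) := by
  have hη1 : ContDiff ℝ ∞ (fderiv ℝ η) := hη.fderiv_right (by simp)
  have q0 : 0 ≤ ε * L₀ := mul_nonneg hε ((norm_nonneg _).trans (hL₀ 0))
  have q1 : 0 ≤ ε * L₁ := mul_nonneg hε ((norm_nonneg _).trans (hL₁ 0))
  have q2 : 0 ≤ ε * L₂ := mul_nonneg hε ((norm_nonneg (fderiv ℝ (fderiv ℝ η) 0)).trans (hL₂ 0))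
  refine ⟨?_, ?_, ?_, ?_, ?_, ?_, ?_, ?_⟩
  · exact contDiff_id.sub ((contDiff_const.mul hη).smul contDiff_const)
  · exact contDiff_const.add ((((cofL n).contDiff).comp hη1).const_smul ε)
  · intro x
    rw [show x - (ε * η x) • n - x = -((ε * η x) • n) by abel, norm_neg, norm_smul, hn, mul_one,
      norm_mul, Real.norm_of_nonneg hε]
    have := mul_le_mul_of_nonneg_left (hL₀ x) hε
    linarith
  · intro x
    rw [(hasFDerivAt_displacement hη ε x).fderiv, sub_sub_cancel_left, norm_neg, norm_smul,
      Real.norm_of_nonneg hε, ContinuousLinearMap.norm_smulRight_apply, hn, mul_one]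
    have := mul_le_mul_of_nonneg_left (hL₁ x) hε
    linarith
  · intro x
    rw [add_sub_cancel_left, norm_smul, Real.norm_of_nonneg hε]
    have h1 := norm_cofL_apply_le hn (fderiv ℝ η x)
    have h2 : ε * ‖cofL n (fderiv ℝ η x)‖ ≤ ε * (2 * L₁) :=
      mul_le_mul_of_nonneg_left (h1.trans (by linarith [hL₁ x])) hε
    linarith
  · intro x
    have hM : HasFDerivAt (fun x => ContinuousLinearMap.id ℝ (Space d) + ε • cofL n (fderiv ℝ η x))
        (ε • (cofL n).comp (fderiv ℝ (fderiv ℝ η) x)) x :=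
      (((cofL n).hasFDerivAt.comp x (hη1.differentiable (by simp) x).hasFDerivAt).const_smul
        ε).const_add _
    rw [hM.fderiv]
    refine ContinuousLinearMap.opNorm_le_bound _ (by linarith) fun v => ?_
    have h1 : ‖fderiv ℝ (fderiv ℝ η) x v‖ ≤ L₂ * ‖v‖ :=
      ContinuousLinearMap.le_of_opNorm_le _ (hL₂ x) v
    have h2 : ‖cofL n (fderiv ℝ (fderiv ℝ η) x v)‖ ≤ 2 * (L₂ * ‖v‖) :=
      (norm_cofL_apply_le hn _).trans (by linarith)
    have h3 : ‖(ε • (cofL n).comp (fderiv ℝ (fderiv ℝ η) x)) v‖ =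
        ε * ‖cofL n (fderiv ℝ (fderiv ℝ η) x v)‖ := by
      rw [smul_apply, ContinuousLinearMap.comp_apply, norm_smul, Real.norm_of_nonneg hε]
    rw [h3]
    calc ε * ‖cofL n (fderiv ℝ (fderiv ℝ η) x v)‖ ≤ ε * (2 * (L₂ * ‖v‖)) :=
          mul_le_mul_of_nonneg_left h2 hε
      _ = 2 * (ε * L₂) * ‖v‖ := by ring
      _ ≤ κ * ‖v‖ := mul_le_mul_of_nonneg_right (by linarith) (norm_nonneg v)
  · refine (map_volume_elementary hn hη hL₁ hε (by linarith)).trans ?_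
    gcongr
    linarith
  · intro φ hφ hd x
    exact divg_elementary hη ε hφ hd x

theorem exists_norm_fderiv_le {E F : Type*} [NormedAddCommGroup E] [NormedSpace ℝ E]
    [NormedAddCommGroup F] [NormedSpace ℝ F] {η : E → F}
    (hη : ContDiff ℝ ∞ η) (hηs : HasCompactSupport η) : ∃ L, ∀ x, ‖fderiv ℝ η x‖ ≤ L :=
  (hηs.fderiv (𝕜 := ℝ)).exists_bound_of_continuous (hη.continuous_fderiv (by simp))

/-- Small displacements along a fixed direction, with a compactly supported smooth amplitude,
induce Piola transforms close to the identity. -/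
theorem exists_isPiola_elementary {n : Space d} (hn : ‖n‖ = 1) {η : Space d → ℝ}
    (hη : ContDiff ℝ ∞ η) (hηs : HasCompactSupport η) {κ : ℝ} (hκ : 0 < κ) :
    ∃ ε₀ > 0, ∀ ε, 0 ≤ ε → ε ≤ ε₀ → ∃ M, IsPiola κ (fun x => x - (ε * η x) • n) M := by
  obtain ⟨L₀, hL₀⟩ := hηs.exists_bound_of_continuous hη.continuous
  obtain ⟨L₁, hL₁⟩ := exists_norm_fderiv_le hη hηs
  obtain ⟨L₂, hL₂⟩ := exists_norm_fderiv_le (hη.fderiv_right (m := ∞) (by simp))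
    (hηs.fderiv (𝕜 := ℝ))
  have p0 : 0 ≤ L₀ := (norm_nonneg (η 0)).trans (hL₀ 0)
  have p1 : 0 ≤ L₁ := (norm_nonneg (fderiv ℝ η 0)).trans (hL₁ 0)
  have p2 : 0 ≤ L₂ := (norm_nonneg (fderiv ℝ (fderiv ℝ η) 0)).trans (hL₂ 0)
  have hK : 0 < 1 + L₀ + 2 * L₁ + 2 * L₂ := by linarith
  -- The weights are those of `isPiola_elementary`, which needs a parameter at most one; the extra
  -- summand `1` keeps the denominator positive when `η` vanishes.
  refine ⟨min κ 1 / (1 + L₀ + 2 * L₁ + 2 * L₂), div_pos (lt_min hκ one_pos) hK,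
    fun ε hε hε' =>
      ⟨fun x => ContinuousLinearMap.id ℝ (Space d) + ε • cofL n (fderiv ℝ η x), ?_⟩⟩
  rw [le_div_iff₀ hK] at hε'
  have hsum : ε * L₀ + 2 * (ε * L₁) + 2 * (ε * L₂) ≤ min κ 1 := by linarith
  exact (isPiola_elementary hn hη hL₀ hL₁ hL₂ hε (min_le_right κ 1) hsum).mono (min_le_left κ 1)

end Piola

/-! ### Pushing the complement of a Lipschitz domain outwards -/

section Geometry

variable {d : ℕ} {Ω : Set (Space d)}

/-- A point of `U` outside `Ω` lies on or below the graph, and moving by `-τ n` leaves its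
projection unchanged and puts it strictly below. The part of `U` strictly below the graph is open
and disjoint from `Ω`, hence from the closure of `Ω`. -/
theorem notMem_closure_of_chart {U : Set (Space d)} (hU : IsOpen U) {n : Space d} (hn : ‖n‖ = 1)
    {L : NNReal} {g : (ℝ ∙ n)ᗮ → ℝ} (hg : LipschitzWith L g)
    (hc : ∀ y ∈ U, y ∈ Ω ↔ g ((ℝ ∙ n)ᗮ.orthogonalProjectionOnto y) < inner ℝ n y)
    {y : Space d} (hy : y ∈ U) (hyΩ : y ∉ Ω) {τ : ℝ} (hτ : 0 < τ) (hy' : y - τ • n ∈ U) :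
    y - τ • n ∉ closure Ω := by
  set V := U ∩ {z | inner ℝ n z < g ((ℝ ∙ n)ᗮ.orthogonalProjectionOnto z)}
  have hV : IsOpen V := by
    refine hU.inter (isOpen_lt ?_ ?_)
    · fun_prop
    · exact hg.continuous.comp ((ℝ ∙ n)ᗮ.orthogonalProjectionOnto).continuous
  have hdisj : Disjoint V Ω := by
    rw [Set.disjoint_left]
    rintro z ⟨hzU, hz⟩ hzΩ
    exact absurd ((hc z hzU).1 hzΩ) (not_lt.2 (le_of_lt hz))
  have hmem : y - τ • n ∈ V := by
    refine ⟨hy', ?_⟩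
    have h1 : inner ℝ n y ≤ g ((ℝ ∙ n)ᗮ.orthogonalProjectionOnto y) :=
      not_lt.1 fun h => hyΩ ((hc y hy).2 h)
    have h2 : (ℝ ∙ n)ᗮ.orthogonalProjectionOnto n = 0 :=
      Submodule.orthogonalProjectionOnto_orthogonal_apply_eq_zero
        (Submodule.mem_span_singleton_self n)
    simp only [mem_ofPred_eq, map_sub, map_smul, h2, smul_zero, sub_zero, inner_sub_right,
      inner_smul_right, real_inner_self_eq_norm_sq, hn]
    linarith
  intro h
  exact (hdisj.closure_right hV).le_bot ⟨hmem, h⟩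

/-- A bump function times the chart direction displaces outwards near `x`. The radius `r` is chosen
before `κ`: a finite cover of the boundary by these balls can then be fixed while the accuracy is
still free. -/
theorem exists_isPiola_chart (hΩ : IsLipschitzDomain Ω) {x : Space d} (hx : x ∈ frontier Ω) :
    ∃ r > 0, ∀ κ > 0, ∃ Ψ M, IsPiola κ Ψ M ∧ (∀ y ∉ Ω, Ψ y = y ∨ Ψ y ∉ closure Ω) ∧
      ∀ y ∈ ball x r, y ∉ Ω → Ψ y ∉ closure Ω := by
  obtain ⟨U, hU, hxU, n, hn, L, g, hg, hc⟩ := hΩ.lipschitz_boundary x hx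
  obtain ⟨R, hR, hRU⟩ := Metric.isOpen_iff.1 hU x hxU
  let η : ContDiffBump x := ⟨R / 3, 2 * R / 3, by positivity, by linarith⟩
  refine ⟨R / 3, by positivity, fun κ hκ => ?_⟩
  obtain ⟨ε₀, hε₀, h⟩ := exists_isPiola_elementary hn (η := η) η.contDiff η.hasCompactSupport hκ
  -- The amplitude is supported in the ball of radius `2R/3` and the displacement is at most `R/3`,
  -- so displaced points remain in the chart.
  set ε := min ε₀ (R / 3)
  have hε : 0 < ε := lt_min hε₀ (by positivity)
  obtain ⟨M, hM⟩ := h ε hε.le (min_le_left _ _)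
  have key : ∀ y, y ∉ Ω → η y ≠ 0 → y - (ε * η y) • n ∉ closure Ω := by
    intro y hy hη
    have hball : y ∈ ball x (2 * R / 3) := by
      have : y ∈ Function.support η := hη
      rwa [η.support_eq] at this
    have hpos : 0 < ε * η y := mul_pos hε (lt_of_le_of_ne η.nonneg hη.symm)
    have hle : ε * η y ≤ R / 3 := by
      calc ε * η y ≤ ε * 1 := by gcongr; exact η.le_one
        _ ≤ R / 3 := by rw [mul_one]; exact min_le_right _ _
    refine notMem_closure_of_chart hU hn hg hc (hRU ?_) hy hpos (hRU ?_)
    · exact ball_subset_ball (by linarith) hball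
    · rw [mem_ball, dist_eq_norm] at hball ⊢
      calc ‖y - (ε * η y) • n - x‖ = ‖(y - x) - (ε * η y) • n‖ := by congr 1; abel
        _ ≤ ‖y - x‖ + ‖(ε * η y) • n‖ := norm_sub_le _ _
        _ = ‖y - x‖ + ε * η y := by rw [norm_smul, hn, mul_one, Real.norm_of_nonneg hpos.le]
        _ < R := by linarith
  refine ⟨_, M, hM, fun y hy => ?_, fun y hyx hy => key y hy ?_⟩
  · by_cases h0 : η y = 0
    · left
      simp [h0]
    · exact Or.inr (key y hy h0)
  · have : η y = 1 := η.one_of_mem_closedBall (ball_subset_closedBall hyx)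
    simp [this]

/-- For a bounded Lipschitz domain there are Piola transforms arbitrarily close to the identity
whose displacement moves every point of the complement away from the closure of the domain. -/
theorem exists_isPiola_outward (hΩ : IsLipschitzDomain Ω) {κ : ℝ} (hκ : 0 < κ) :
    ∃ Ψ M, IsPiola κ Ψ M ∧ ∀ y ∉ Ω, Ψ y ∉ closure Ω := by
  have hcomp : IsCompact (frontier Ω) :=
    hΩ.isBounded.isCompact_closure.of_isClosed_subset isClosed_frontier frontier_subset_closure
  choose! r hr hstep using fun x (hx : x ∈ frontier Ω) => exists_isPiola_chart hΩ hx
  obtain ⟨t, hcover⟩ := hcomp.elim_nhds_subcover' (fun x _ => ball x (r x))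
    (fun x hx => ball_mem_nhds x (hr x hx))
  -- Induction over the finitely many charts. The alternative `Ψ y = y ∨ Ψ y ∉ closure Ω` on the
  -- whole complement is carried along, so that a point once expelled is not brought back by the
  -- next transform.
  have main : ∀ s : Finset (frontier Ω), ∀ κ > 0, ∃ Ψ M, IsPiola κ Ψ M ∧
      (∀ y ∉ Ω, Ψ y = y ∨ Ψ y ∉ closure Ω) ∧
      (∀ y ∉ Ω, (∃ x ∈ s, y ∈ ball (x : Space d) (r x)) → Ψ y ∉ closure Ω) := by
    intro s
    induction s using Finset.induction_on with
    | empty =>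
      intro κ hκ
      exact ⟨_, _, isPiola_id.mono hκ.le, fun y _ => Or.inl rfl, by simp⟩
    | insert x s hxs ih =>
      intro κ hκ
      -- `IsPiola.comp` needs parameters at most one and returns `2 (κ/6) + 4 (κ/6) = κ`.
      have hκ' : 0 < min (κ / 6) 1 := lt_min (by positivity) one_pos
      obtain ⟨Ψ₁, M₁, h₁, h₁a, h₁b⟩ := hstep x x.2 _ hκ'
      obtain ⟨Ψ₂, M₂, h₂, h₂a, h₂b⟩ := ih _ hκ'
      have hout : ∀ y ∉ closure Ω, Ψ₂ y ∉ closure Ω := by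
        intro y hy
        rcases h₂a y (fun h => hy (subset_closure h)) with h | h
        · rwa [h]
        · exact h
      refine ⟨_, _, (h₁.comp h₂ (min_le_right _ _) (min_le_right _ _)).mono ?_, fun y hy => ?_,
        fun y hy hyx => ?_⟩
      · have := min_le_left (κ / 6) 1
        linarith
      · rcases h₁a y hy with h | h
        · simp only [h]
          exact h₂a y hy
        · exact Or.inr (hout _ h)
      · obtain ⟨z, hz, hyz⟩ := hyx
        rcases h₁a y hy with h | h
        · rcases Finset.mem_insert.1 hz with rfl | hz
          · exact hout _ (h₁b y hyz hy)
          · simp only [h]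
            exact h₂b y hy ⟨z, hz, hyz⟩
        · exact hout _ h
  obtain ⟨Ψ, M, h, ha, hb⟩ := main t κ hκ
  refine ⟨Ψ, M, h, fun y hy => ?_⟩
  by_cases hyc : y ∈ closure Ω
  · have hyf : y ∈ frontier Ω := ⟨hyc, by rwa [hΩ.isOpen.interior_eq]⟩
    obtain ⟨z, hz, hyz⟩ := mem_iUnion₂.1 (hcover hyf)
    exact hb y hy ⟨z, hz, hyz⟩
  · rcases ha y hy with h | h
    · rwa [h]
    · exact h

theorem isCompact_preimage_cthickening (hΩ : Bornology.IsBounded Ω) {κ : ℝ}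
    {Ψ : Space d → Space d} (hc : Continuous Ψ) (h : ∀ y, ‖Ψ y - y‖ ≤ κ) (δ : ℝ) :
    IsCompact (Ψ ⁻¹' cthickening δ Ω) := by
  have hb : Bornology.IsBounded (cthickening κ (cthickening δ Ω)) :=
    Bornology.IsBounded.cthickening (Bornology.IsBounded.cthickening hΩ)
  refine Metric.isCompact_of_isClosed_isBounded (isClosed_cthickening.preimage hc)
    (hb.subset fun y hy => ?_)
  refine mem_cthickening_of_dist_le y (Ψ y) κ _ hy ?_
  rw [dist_comm, dist_eq_norm]
  exact h y

/-- The preimage of a neighbourhood of the domain under an outward displacement lies in the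
domain. -/
theorem exists_preimage_cthickening_subset (hΩ : IsLipschitzDomain Ω) {κ : ℝ}
    {Ψ : Space d → Space d} (hc : Continuous Ψ) (h : ∀ y, ‖Ψ y - y‖ ≤ κ)
    (ho : ∀ y ∉ Ω, Ψ y ∉ closure Ω) :
    ∃ δ₀ > 0, ∀ δ ≤ δ₀, Ψ ⁻¹' cthickening δ Ω ⊆ Ω := by
  -- The part of the preimage that is not yet in `Ω`. It is compact and its image misses the closure
  -- of `Ω`, hence keeps a positive distance from it.
  set K : Set (Space d) := (Ψ ⁻¹' cthickening 1 Ω) \ Ω with hKdef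
  have hK : IsCompact K := (isCompact_preimage_cthickening hΩ.isBounded hc h 1).diff hΩ.isOpen
  have hdisj : Disjoint (Ψ '' K) (closure Ω) := by
    rw [Set.disjoint_left]
    rintro _ ⟨y, hy, rfl⟩
    exact ho y hy.2
  obtain ⟨δ, hδ, hδ'⟩ := hdisj.exists_cthickenings (hK.image hc) isClosed_closure
  refine ⟨min δ 1, lt_min hδ one_pos, fun δ' hδ'' y hy => ?_⟩
  by_contra hyΩ
  have hy1 : Ψ y ∈ cthickening δ' Ω := hy
  have hy2 : Ψ y ∈ cthickening 1 Ω := cthickening_mono (hδ''.trans (min_le_right δ 1)) Ω hy1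
  have hyK : y ∈ K := mem_sdiff_of_mem (mem_preimage.2 hy2) hyΩ
  have h1 : Ψ y ∈ Ψ '' K := mem_image_of_mem Ψ hyK
  have h2 : Ψ y ∈ cthickening δ (closure Ω) := by
    rw [cthickening_closure]
    exact cthickening_mono (hδ''.trans (min_le_left δ 1)) Ω hy1
  exact Set.disjoint_left.1 hδ' (self_subset_cthickening _ h1) h2

end Geometry

/-! ### Elementary facts on the function spaces -/

section Spaces

variable {d : ℕ} {Ω : Set (Space d)}

/-- `val` as a continuous linear map. -/
noncomputable def valL (Ω : Set (Space d)) : H10sol Ω →L[ℝ] L2 Ω (Space d) :=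
  (WithLp.fstL 2 ℝ (L2 Ω (Space d)) (L2 Ω (Mat d))).comp (H10sol Ω).subtypeL

/-- `wgrad` as a continuous linear map. -/
noncomputable def wgradL (Ω : Set (Space d)) : H10sol Ω →L[ℝ] L2 Ω (Mat d) :=
  (WithLp.sndL 2 ℝ (L2 Ω (Space d)) (L2 Ω (Mat d))).comp (H10sol Ω).subtypeL

theorem valL_apply (u : H10sol Ω) : valL Ω u = val u := rfl

theorem val_sub (u v : H10sol Ω) : val (u - v) = val u - val v := map_sub (valL Ω) u v

theorem wgrad_sub (u v : H10sol Ω) : wgrad (u - v) = wgrad u - wgrad v := map_sub (wgradL Ω) u v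

theorem norm_sq_H10sol (u : H10sol Ω) : ‖u‖ ^ 2 = ‖val u‖ ^ 2 + ‖wgrad u‖ ^ 2 :=
  WithLp.prod_norm_sq_eq_of_L2 u.1

theorem norm_val_le (u : H10sol Ω) : ‖val u‖ ≤ ‖u‖ := by
  have := norm_sq_H10sol u
  exact le_of_sq_le_sq (by nlinarith [sq_nonneg ‖wgrad u‖]) (norm_nonneg _)

theorem norm_wgrad_le (u : H10sol Ω) : ‖wgrad u‖ ≤ ‖u‖ := by
  have := norm_sq_H10sol u
  exact le_of_sq_le_sq (by nlinarith [sq_nonneg ‖val u‖]) (norm_nonneg _)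

theorem norm_le_val_add_wgrad (u : H10sol Ω) : ‖u‖ ≤ ‖val u‖ + ‖wgrad u‖ := by
  have := norm_sq_H10sol u
  refine le_of_sq_le_sq ?_ (by positivity)
  nlinarith [norm_nonneg (val u), norm_nonneg (wgrad u)]

/-- `solToH` as a linear map. -/
noncomputable def solToHₗ (Ω : Set (Space d)) : SolTestField Ω →ₗ[ℝ] H10sol Ω where
  toFun := solToH
  map_add' φ ψ := Subtype.ext (map_add (toGraph (Ω := Ω)) φ.1 ψ.1)
  map_smul' c φ := Subtype.ext (map_smul (toGraph (Ω := Ω)) c φ.1)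

theorem denseRange_solToH : DenseRange (solToH (Ω := Ω)) := by
  intro u
  rw [closure_subtype]
  have hu : (u : GraphSpace Ω) ∈ closure (((SolTestField Ω).map toGraph : Submodule ℝ _) :
    Set (GraphSpace Ω)) := u.2
  refine closure_mono ?_ hu
  rintro _ ⟨φ, hφ, rfl⟩
  exact ⟨solToH ⟨φ, hφ⟩, ⟨_, rfl⟩, rfl⟩

/-- A closed property of the divergence free test fields holds on all of `H¹_{0,σ}`. -/
theorem H10sol_induction {P : H10sol Ω → Prop} (hP : IsClosed {u | P u})
    (h : ∀ φ : SolTestField Ω, P (solToH φ)) (u : H10sol Ω) : P u :=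
  denseRange_solToH.induction_on u hP h

theorem coeFn_val_solToH (φ : SolTestField Ω) :
    val (solToH φ) =ᵐ[volume.restrict Ω] φ.1.1 := (memLp_testField φ.1).coeFn_toLp

theorem coeFn_wgrad_solToH (φ : SolTestField Ω) :
    wgrad (solToH φ) =ᵐ[volume.restrict Ω] grad φ.1.1 := (memLp_grad φ.1).coeFn_toLp

theorem val_solToH (φ : SolTestField Ω) : val (solToH φ) = toL2 φ.1 := rfl

/-- The matrix of an endomorphism. -/
noncomputable def gradL (d : ℕ) : (Space d →L[ℝ] Space d) →L[ℝ] Mat d :=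
  LinearMap.toContinuousLinearMap
    { toFun := fun L => WithLp.toLp 2 fun p => L (basisVec p.2) p.1
      map_add' := fun L K => by ext p; simp
      map_smul' := fun c L => by ext p; simp }

theorem grad_eq_gradL (φ : Space d → Space d) (x : Space d) :
    grad φ x = gradL d (fderiv ℝ φ x) := rfl

/-- The operator norm and the Frobenius norm are equivalent because the spaces have finite
dimension; one constant serves both directions. -/
theorem exists_norm_le_gradL (d : ℕ) :
    ∃ K > 0, ∀ L : Space d →L[ℝ] Space d, ‖L‖ ≤ K * ‖gradL d L‖ ∧ ‖gradL d L‖ ≤ K * ‖L‖ := by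
  have hker : LinearMap.ker (gradL d : (Space d →L[ℝ] Space d) →ₗ[ℝ] Mat d) = ⊥ := by
    rw [LinearMap.ker_eq_bot']
    intro L hL
    ext v i
    have h1 : ∀ j, L (basisVec j) i = 0 := fun j => by
      have := congrArg (fun G : Mat d => G (i, j)) hL
      exact this
    rw [← sum_smul_basisVec v]
    simp [map_sum, h1]
  obtain ⟨K, hK, hanti⟩ := LinearMap.exists_antilipschitzWith _ hker
  refine ⟨K + ‖gradL d‖, by positivity, fun L => ⟨?_, ?_⟩⟩
  · have := hanti.le_mul_norm_sub (x := 0) (y := L)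
    rw [map_zero, neg_add_eq_sub, neg_add_eq_sub, sub_zero, sub_zero] at this
    refine this.trans ?_
    rw [ContinuousLinearMap.coe_coe]
    gcongr
    exact le_add_of_nonneg_right (gradL d).opNorm_nonneg
  · refine ((gradL d).le_opNorm L).trans ?_
    gcongr
    simp

section Extension

variable {F : Type} [NormedAddCommGroup F] [NormedSpace ℝ F]

/-- Extension by zero. -/
noncomputable def ext0 (u : L2 Ω F) : Space d → F := Ω.indicator u

theorem memLp_ext0 (hΩ : MeasurableSet Ω) (u : L2 Ω F) : MemLp (ext0 u) 2 volume :=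
  (memLp_indicator_iff_restrict hΩ).2 (Lp.memLp u)

theorem locallyIntegrable_ext0 (hΩ : MeasurableSet Ω) (u : L2 Ω F) :
    LocallyIntegrable (ext0 u) volume := (memLp_ext0 hΩ u).locallyIntegrable (by norm_num)

theorem eLpNorm_ext0 (hΩ : MeasurableSet Ω) (u : L2 Ω F) (p : ℝ≥0∞) :
    eLpNorm (ext0 u) p volume = eLpNorm u p (volume.restrict Ω) :=
  eLpNorm_indicator_eq_eLpNorm_restrict hΩ

theorem ext0_ae_eq (hΩ : MeasurableSet Ω) {u : L2 Ω F} {g : Space d → F}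
    (h : u =ᵐ[volume.restrict Ω] g) (hg : Function.support g ⊆ Ω) : ext0 u =ᵐ[volume] g := by
  rw [Filter.EventuallyEq, ae_restrict_iff' hΩ] at h
  filter_upwards [h] with x hx
  by_cases hxΩ : x ∈ Ω
  · rw [ext0, indicator_of_mem hxΩ, hx hxΩ]
  · rw [ext0, indicator_of_notMem hxΩ]
    by_contra hne
    exact hxΩ (hg (Ne.symm hne))

theorem ext0_add (hΩ : MeasurableSet Ω) (u v : L2 Ω F) :
    ext0 (u + v) =ᵐ[volume] ext0 u + ext0 v := by
  have h := Lp.coeFn_add u v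
  rw [Filter.EventuallyEq, ae_restrict_iff' hΩ] at h
  filter_upwards [h] with x hx
  by_cases hxΩ : x ∈ Ω
  · have := hx hxΩ
    simp only [ext0, indicator_of_mem hxΩ, Pi.add_apply] at this ⊢
    exact this
  · simp [ext0, hxΩ]

theorem ext0_smul (hΩ : MeasurableSet Ω) (c : ℝ) (u : L2 Ω F) :
    ext0 (c • u) =ᵐ[volume] c • ext0 u := by
  have h := Lp.coeFn_smul c u
  rw [Filter.EventuallyEq, ae_restrict_iff' hΩ] at h
  filter_upwards [h] with x hx
  by_cases hxΩ : x ∈ Ω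
  · simp [ext0, hxΩ, hx hxΩ]
  · simp [ext0, hxΩ]

/-- For fixed `x` the value of the convolution is an `L²` pairing of `u` with a fixed kernel.
Pointwise identities for mollifications thus extend by density from test fields to `H¹_{0,σ}`. -/
theorem continuous_convolution_ext0 {E₁ F₁ : Type} [NormedAddCommGroup E₁] [NormedSpace ℝ E₁]
    [NormedAddCommGroup F₁] [NormedSpace ℝ F₁] [CompleteSpace F₁]
    (hΩ : MeasurableSet Ω) (B : E₁ →L[ℝ] F →L[ℝ] F₁) {k : Space d → E₁} (hk : Continuous k)
    (hks : HasCompactSupport k) (x : Space d) :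
    Continuous fun u : L2 Ω F => convolution k (ext0 u) B volume x := by
  have hk2 : MemLp (fun t => k (x - t)) 2 (volume.restrict Ω) := by
    have hc : Continuous fun t => k (x - t) := by fun_prop
    exact hc.memLp_of_hasCompactSupport (hks.comp_homeomorph (Homeomorph.subLeft x))
  have e : (fun u : L2 Ω F => convolution k (ext0 u) B volume x) =
      fun u => B.lpPairing (volume.restrict Ω) 2 2 (hk2.toLp _) u := by
    funext u
    rw [ContinuousLinearMap.lpPairing_eq_integral, convolution_eq_swap]
    have h1 : ∀ t, B (k (x - t)) (ext0 u t) = Ω.indicator (fun t => B (k (x - t)) (u t)) t := by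
      intro t
      by_cases ht : t ∈ Ω
      · simp [ext0, ht]
      · simp [ext0, ht]
    simp only [h1]
    rw [integral_indicator hΩ]
    refine integral_congr_ae ?_
    filter_upwards [hk2.coeFn_toLp] with t ht
    rw [ht]
  rw [e]
  exact ContinuousLinearMap.continuous _

end Extension

end Spaces

/-! ### Mollification of fields in `H¹_{0,σ}` -/

section SpaceMollify

variable {d : ℕ} {Ω : Set (Space d)} {δ : ℝ} {ρ : Space d → ℝ}

theorem grad_mollify_of_contDiff (h : IsKernel δ ρ) {φ : Space d → Space d}
    (hφ : ContDiff ℝ ∞ φ) (hs : HasCompactSupport φ) (x : Space d) :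
    fderiv ℝ (mollify ρ φ) x = mollify ρ (fderiv ℝ φ) x ∧
      grad (mollify ρ φ) x = mollify ρ (grad φ) x := by
  have hd := hs.hasFDerivAt_convolution_right (ContinuousLinearMap.lsmul ℝ ℝ)
    (h.contDiff.continuous.locallyIntegrable (μ := volume)) (hφ.of_le (by simp)) x
  have hc1 : Continuous (fderiv ℝ φ) := hφ.continuous_fderiv (by simp)
  have hs1 : HasCompactSupport (fderiv ℝ φ) := hs.fderiv (𝕜 := ℝ)
  have hli : LocallyIntegrable (fderiv ℝ φ) volume := hc1.locallyIntegrable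
  have e1 : fderiv ℝ (mollify ρ φ) x = mollify ρ (fderiv ℝ φ) x := by
    change fderiv ℝ (convolution ρ φ (ContinuousLinearMap.lsmul ℝ ℝ) volume) x = _
    rw [hd.fderiv]
    rfl
  refine ⟨e1, ?_⟩
  rw [grad_eq_gradL, e1, mollify_apply, mollify_apply]
  rw [← ContinuousLinearMap.integral_comp_comm _ (h.exists_mollify hli x)]
  simp only [map_smul]
  rfl

/-- Fields in `H¹_{0,σ}` extend by zero without creating a surface term in the gradient. The proof
is by density: both sides are continuous in `u` for fixed `x`, and for test fields the derivative
passes to the field. -/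
theorem grad_mollify (hΩ : MeasurableSet Ω) (h : IsKernel δ ρ) (u : H10sol Ω) (x : Space d) :
    grad (mollify ρ (ext0 (val u))) x = mollify ρ (ext0 (wgrad u)) x := by
  refine H10sol_induction (P := fun u => grad (mollify ρ (ext0 (val u))) x =
    mollify ρ (ext0 (wgrad u)) x) ?_ (fun φ => ?_) u
  · refine isClosed_eq ?_ ?_
    -- With the derivative on the kernel, the left-hand side depends on `u` only through its `L²`
    -- class.
    · have e : ∀ u : H10sol Ω, grad (mollify ρ (ext0 (val u))) x =
          gradL d (convolution (fderiv ℝ ρ) (ext0 (val u))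
            ((ContinuousLinearMap.lsmul ℝ ℝ).precompL (Space d)) volume x) := by
        intro u
        rw [grad_eq_gradL]
        congr 1
        exact (h.hasCompactSupport.hasFDerivAt_convolution_left (ContinuousLinearMap.lsmul ℝ ℝ)
          (h.contDiff.of_le (by simp)) (locallyIntegrable_ext0 hΩ (val u)) x).fderiv
      simp only [e]
      exact (gradL d).continuous.comp ((continuous_convolution_ext0 hΩ _
        (h.contDiff.continuous_fderiv (by simp)) (h.hasCompactSupport.fderiv (𝕜 := ℝ)) x).comp
        (valL Ω).continuous)
    · exact (continuous_convolution_ext0 hΩ _ h.contDiff.continuous h.hasCompactSupport x).comp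
        (wgradL Ω).continuous
  · have hsupp : Function.support φ.1.1 ⊆ Ω := (subset_tsupport _).trans φ.1.2.2.2
    have hsupp' : Function.support (grad φ.1.1) ⊆ Ω := by
      refine subset_trans ?_ φ.1.2.2.2
      intro y hy
      by_contra hy'
      refine hy ?_
      rw [grad_eq_gradL]
      have : fderiv ℝ φ.1.1 y = 0 := by
        by_contra hne
        exact hy' (support_fderiv_subset ℝ hne)
      rw [this, map_zero]
    rw [mollify_congr (ext0_ae_eq hΩ (coeFn_val_solToH φ) hsupp),
      mollify_congr (ext0_ae_eq hΩ (coeFn_wgrad_solToH φ) hsupp')]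
    exact (grad_mollify_of_contDiff h φ.1.2.1 φ.1.2.2.1 x).2

/-- The trace of the weak gradient is zero on test fields, and its mollified values depend
continuously on the field. -/
theorem divg_mollify (hΩ : MeasurableSet Ω) (h : IsKernel δ ρ) (u : H10sol Ω) (x : Space d) :
    divg (fderiv ℝ (mollify ρ (ext0 (val u))) x) = 0 := by
  rw [← sum_grad_diag, grad_mollify hΩ h]
  refine H10sol_induction (P := fun u => ∑ i, mollify ρ (ext0 (wgrad u)) x (i, i) = 0) ?_
    (fun φ => ?_) u
  · refine isClosed_eq ?_ continuous_const
    have hc := (continuous_convolution_ext0 hΩ (ContinuousLinearMap.lsmul ℝ ℝ)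
      h.contDiff.continuous h.hasCompactSupport x).comp (wgradL Ω).continuous
    refine continuous_finsetSum _ fun i _ => ?_
    exact (EuclideanSpace.proj (𝕜 := ℝ) (i, i)).continuous.comp hc
  · let tr : Mat d →L[ℝ] ℝ := ∑ i, EuclideanSpace.proj (𝕜 := ℝ) (i, i)
    have htr : ∀ G : Mat d, tr G = ∑ i, G (i, i) := fun G => by simp [tr]
    have hli : LocallyIntegrable (ext0 (wgrad (solToH φ))) volume := locallyIntegrable_ext0 hΩ _
    rw [← htr, mollify_apply_swap,
      ← ContinuousLinearMap.integral_comp_comm]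
    · refine integral_eq_zero_of_ae ?_
      have h1 := coeFn_wgrad_solToH φ
      rw [Filter.EventuallyEq, ae_restrict_iff' hΩ] at h1
      filter_upwards [h1] with y hy
      by_cases hyΩ : y ∈ Ω
      · rw [map_smul, ext0, indicator_of_mem hyΩ, hy hyΩ, htr, φ.2 y]
        simp
      · rw [ext0, indicator_of_notMem hyΩ]
        simp
    · have := convolutionExistsAt_iff_integrable_swap.1
        (h.hasCompactSupport.convolutionExists_left (ContinuousLinearMap.lsmul ℝ ℝ)
        h.contDiff.continuous hli x)
      exact this

end SpaceMollify

/-! ### Smoothing operators on `H¹_{0,σ}` -/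

section Smoothing

variable {d : ℕ} {Ω : Set (Space d)} {δ κ : ℝ} {ρ : Space d → ℝ} {Ψ : Space d → Space d}
  {M : Space d → Space d →L[ℝ] Space d}

theorem IsLipschitzDomain.measurableSet (hΩ : IsLipschitzDomain Ω) : MeasurableSet Ω :=
  hΩ.isOpen.measurableSet

theorem mollify_ext0_eq_zero {F : Type} [NormedAddCommGroup F] [NormedSpace ℝ F]
    (h : IsKernel δ ρ) (u : L2 Ω F) {y : Space d} (hy : y ∉ cthickening δ Ω) :
    mollify ρ (ext0 u) y = 0 := by
  refine h.mollify_eq_zero fun z hz => indicator_of_notMem (fun hzΩ => hy ?_) _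
  exact mem_cthickening_of_dist_le y z δ Ω hzΩ (by rw [dist_comm]; exact (mem_ball.1 hz).le)

theorem support_transform_subset (h : IsKernel δ ρ) (u : L2 Ω (Space d)) :
    Function.support (fun x => M x (mollify ρ (ext0 u) (Ψ x))) ⊆ Ψ ⁻¹' cthickening δ Ω := by
  intro x hx
  by_contra hx'
  exact hx (by simp [mollify_ext0_eq_zero h u hx'])

/-- The smoothing operator `u ↦ M (ρ ⋆ u)(Ψ)` on `H¹_{0,σ}`, with values in the divergence free
test fields. -/
noncomputable def smoothTest (hΩ : IsLipschitzDomain Ω) (h : IsKernel δ ρ) (hP : IsPiola κ Ψ M)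
    (hs : Ψ ⁻¹' cthickening δ Ω ⊆ Ω) : H10sol Ω →ₗ[ℝ] SolTestField Ω where
  toFun u := ⟨⟨fun x => M x (mollify ρ (ext0 (val u)) (Ψ x)), by
      have hK := isCompact_preimage_cthickening hΩ.isBounded hP.contDiff_map.continuous
        hP.map_sub δ
      have hsub : tsupport (fun x => M x (mollify ρ (ext0 (val u)) (Ψ x))) ⊆
          Ψ ⁻¹' cthickening δ Ω :=
        closure_minimal (support_transform_subset h (val u)) hK.isClosed
      exact ⟨hP.contDiff_transform
        (h.contDiff_mollify (locallyIntegrable_ext0 hΩ.measurableSet (val u))),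
        hK.of_isClosed_subset (isClosed_tsupport _) hsub, hsub.trans hs⟩⟩,
    fun x => hP.divFree _ (h.contDiff_mollify (locallyIntegrable_ext0 hΩ.measurableSet (val u)))
      (divg_mollify hΩ.measurableSet h u) x⟩
  map_add' u v := by
    refine Subtype.ext (Subtype.ext (funext fun x => ?_))
    have e : mollify ρ (ext0 (val (u + v))) =
        mollify ρ (ext0 (val u)) + mollify ρ (ext0 (val v)) := by
      rw [← h.mollify_add (locallyIntegrable_ext0 hΩ.measurableSet _)
        (locallyIntegrable_ext0 hΩ.measurableSet _)]
      exact mollify_congr (ext0_add hΩ.measurableSet (val u) (val v))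
    change M x (mollify ρ (ext0 (val (u + v))) (Ψ x)) =
      M x (mollify ρ (ext0 (val u)) (Ψ x)) + M x (mollify ρ (ext0 (val v)) (Ψ x))
    rw [e, Pi.add_apply, map_add]
  map_smul' c u := by
    refine Subtype.ext (Subtype.ext (funext fun x => ?_))
    have e : mollify ρ (ext0 (val (c • u))) = c • mollify ρ (ext0 (val u)) := by
      rw [← mollify_const_smul]
      exact mollify_congr (ext0_smul hΩ.measurableSet c (val u))
    change M x (mollify ρ (ext0 (val (c • u))) (Ψ x)) =
      c • M x (mollify ρ (ext0 (val u)) (Ψ x))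
    rw [e, Pi.smul_apply, map_smul]

theorem smoothTest_apply (hΩ : IsLipschitzDomain Ω) (h : IsKernel δ ρ) (hP : IsPiola κ Ψ M)
    (hs : Ψ ⁻¹' cthickening δ Ω ⊆ Ω) (u : H10sol Ω) (x : Space d) :
    (smoothTest hΩ h hP hs u).1.1 x = M x (mollify ρ (ext0 (val u)) (Ψ x)) := rfl

/-- The bound on the pushforward of Lebesgue measure gives the factor `(1 + κ)^(1/p)`, which is at
most `1 + κ` uniformly in `p`, also for `p = ∞`. -/
theorem IsPiola.eLpNorm_comp_le (hP : IsPiola κ Ψ M) {F : Type} [NormedAddCommGroup F]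
    {g : Space d → F} (hg : Continuous g) {p : ℝ≥0∞} (hp : 1 ≤ p) :
    eLpNorm (fun x => g (Ψ x)) p volume ≤ ENNReal.ofReal (1 + κ) * eLpNorm g p volume := by
  have hc1 : 1 ≤ ENNReal.ofReal (1 + κ) := by
    rw [← ENNReal.ofReal_one]
    exact ENNReal.ofReal_le_ofReal (by linarith [hP.nonneg])
  have e : eLpNorm (fun x => g (Ψ x)) p volume = eLpNorm g p (Measure.map Ψ volume) :=
    (eLpNorm_map_measure hg.stronglyMeasurable.aestronglyMeasurable
      hP.contDiff_map.continuous.measurable.aemeasurable).symm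
  rw [e]
  refine (eLpNorm_mono_measure g hP.map_volume).trans ?_
  rw [eLpNorm_smul_measure_of_ne_zero (zero_lt_one.trans_le hc1).ne', smul_eq_mul]
  gcongr
  calc ENNReal.ofReal (1 + κ) ^ (1 / p).toReal ≤ ENNReal.ofReal (1 + κ) ^ (1 : ℝ) := by
        refine ENNReal.rpow_le_rpow_of_exponent_le hc1 ?_
        refine ENNReal.toReal_le_of_le_ofReal zero_le_one ?_
        rw [ENNReal.ofReal_one, one_div]
        exact ENNReal.inv_le_one.2 hp
    _ = _ := ENNReal.rpow_one _

/-- One factor `1 + κ` comes from the matrix and one from the change of variables; mollification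
costs nothing. That the constant tends to one, rather than being merely bounded, is essential for
the Radon-Riesz argument. -/
theorem eLpNorm_smoothTest_le (hΩ : IsLipschitzDomain Ω) (h : IsKernel δ ρ) (hP : IsPiola κ Ψ M)
    (hs : Ψ ⁻¹' cthickening δ Ω ⊆ Ω) (u : H10sol Ω) {p : ℝ≥0∞} (hp : 1 ≤ p) :
    eLpNorm (val (solToH (smoothTest hΩ h hP hs u))) p (volume.restrict Ω) ≤
      ENNReal.ofReal ((1 + κ) ^ 2) * eLpNorm (val u) p (volume.restrict Ω) := by
  have hm := h.contDiff_mollify (locallyIntegrable_ext0 hΩ.measurableSet (val u))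
  have hκ := hP.nonneg
  rw [eLpNorm_congr_ae (coeFn_val_solToH _)]
  calc eLpNorm (smoothTest hΩ h hP hs u).1.1 p (volume.restrict Ω)
      ≤ eLpNorm (smoothTest hΩ h hP hs u).1.1 p volume :=
        eLpNorm_mono_measure _ Measure.restrict_le_self
    _ ≤ ENNReal.ofReal (1 + κ) *
        eLpNorm (fun x => mollify ρ (ext0 (val u)) (Ψ x)) p volume := by
        refine eLpNorm_le_mul_eLpNorm_of_ae_le_mul (Eventually.of_forall fun x => ?_) p
        exact ContinuousLinearMap.le_of_opNorm_le _ (norm_le_one_add (hP.mat_sub x)) _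
    _ ≤ ENNReal.ofReal (1 + κ) * (ENNReal.ofReal (1 + κ) * eLpNorm (ext0 (val u)) p volume) := by
        gcongr
        refine (hP.eLpNorm_comp_le hm.continuous hp).trans ?_
        gcongr
        exact h.eLpNorm_mollify_le (memLp_ext0 hΩ.measurableSet _).1 hp
    _ = _ := by
        rw [eLpNorm_ext0 hΩ.measurableSet, ← mul_assoc, ← ENNReal.ofReal_mul (by positivity), sq]

theorem fderiv_smoothTest (hΩ : IsLipschitzDomain Ω) (h : IsKernel δ ρ) (hP : IsPiola κ Ψ M)
    (hs : Ψ ⁻¹' cthickening δ Ω ⊆ Ω) (u : H10sol Ω) (x : Space d) :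
    fderiv ℝ (smoothTest hΩ h hP hs u).1.1 x =
      (M x).comp ((fderiv ℝ (mollify ρ (ext0 (val u))) (Ψ x)).comp (fderiv ℝ Ψ x)) +
        (fderiv ℝ M x).flip (mollify ρ (ext0 (val u)) (Ψ x)) :=
  (hP.hasFDerivAt_transform ((h.contDiff_mollify
    (locallyIntegrable_ext0 hΩ.measurableSet (val u))).differentiable (by simp)) x).fderiv

theorem norm_comp_comp_add_flip_le {E : Type*} [NormedAddCommGroup E] [NormedSpace ℝ E]
    {A B D : E →L[ℝ] E} {N : E →L[ℝ] E →L[ℝ] E} {z : E} (hA : ‖A‖ ≤ 2) (hB : ‖B‖ ≤ 2)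
    (hN : ‖N‖ ≤ 1) : ‖A.comp (D.comp B) + N.flip z‖ ≤ 4 * ‖D‖ + ‖z‖ := by
  refine ContinuousLinearMap.opNorm_le_bound _ (by positivity) fun v => ?_
  simp only [add_apply, ContinuousLinearMap.comp_apply, ContinuousLinearMap.flip_apply]
  have h1 : ‖B v‖ ≤ 2 * ‖v‖ := ContinuousLinearMap.le_of_opNorm_le _ hB v
  have h2 : ‖D (B v)‖ ≤ ‖D‖ * (2 * ‖v‖) :=
    (D.le_opNorm _).trans (mul_le_mul_of_nonneg_left h1 (norm_nonneg _))
  have h3 : ‖A (D (B v))‖ ≤ 2 * ‖D (B v)‖ := ContinuousLinearMap.le_of_opNorm_le _ hA _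
  have h4 : ‖N v z‖ ≤ ‖v‖ * ‖z‖ := by
    refine ((N v).le_opNorm z).trans (mul_le_mul_of_nonneg_right ?_ (norm_nonneg _))
    simpa using ContinuousLinearMap.le_of_opNorm_le _ hN v
  refine (norm_add_le _ _).trans ?_
  linarith

theorem norm_fderiv_smoothTest_le (hΩ : IsLipschitzDomain Ω) (h : IsKernel δ ρ)
    (hP : IsPiola κ Ψ M) (hκ : κ ≤ 1) (hs : Ψ ⁻¹' cthickening δ Ω ⊆ Ω) (u : H10sol Ω)
    (x : Space d) :
    ‖fderiv ℝ (smoothTest hΩ h hP hs u).1.1 x‖ ≤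
      4 * ‖fderiv ℝ (mollify ρ (ext0 (val u))) (Ψ x)‖ + ‖mollify ρ (ext0 (val u)) (Ψ x)‖ := by
  rw [fderiv_smoothTest]
  refine norm_comp_comp_add_flip_le ?_ ?_ ((hP.fderiv_mat x).trans hκ)
  · linarith [norm_le_one_add (hP.mat_sub x)]
  · linarith [norm_le_one_add (hP.fderiv_map_sub x)]

/-- The smoothing operators are bounded on `H¹_{0,σ}`, uniformly in the parameters. -/
theorem exists_norm_smoothTest_le (hΩ : IsLipschitzDomain Ω) :
    ∃ C : ℝ, 0 < C ∧ ∀ (δ κ : ℝ) (ρ : Space d → ℝ) (Ψ : Space d → Space d)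
      (M : Space d → Space d →L[ℝ] Space d) (h : IsKernel δ ρ) (hP : IsPiola κ Ψ M)
      (hs : Ψ ⁻¹' cthickening δ Ω ⊆ Ω), κ ≤ 1 → ∀ u : H10sol Ω,
        ‖solToH (smoothTest hΩ h hP hs u)‖ ≤ C * ‖u‖ := by
  obtain ⟨K, hK, hKb⟩ := exists_norm_le_gradL d
  -- `4` bounds `(1 + κ)²` for the field. For the gradient, `4` and `1` are the constants of
  -- `norm_fderiv_smoothTest_le`, `K` changes between the matrix norms, and `2` bounds the
  -- distortion `1 + κ`.
  refine ⟨4 + K * (4 * K + 1) * 2, by positivity, ?_⟩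
  intro δ κ ρ Ψ M h hP hs hκ u
  have hκ0 := hP.nonneg
  have hmeas := hΩ.measurableSet
  set m := mollify ρ (ext0 (val u)) with hm
  set G := mollify ρ (ext0 (wgrad u)) with hG
  have hmc : Continuous m := (h.contDiff_mollify (locallyIntegrable_ext0 hmeas _)).continuous
  have hGc : Continuous G := (h.contDiff_mollify (locallyIntegrable_ext0 hmeas _)).continuous
  have b1 : ‖val (solToH (smoothTest hΩ h hP hs u))‖ ≤ 4 * ‖u‖ := by
    have h1 := eLpNorm_smoothTest_le hΩ h hP hs u (p := 2) (by norm_num)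
    have h2 : ‖val (solToH (smoothTest hΩ h hP hs u))‖ ≤ (1 + κ) ^ 2 * ‖val u‖ := by
      rw [Lp.norm_def, Lp.norm_def, ← ENNReal.toReal_ofReal (show 0 ≤ (1 + κ) ^ 2 by positivity),
        ← ENNReal.toReal_mul]
      exact ENNReal.toReal_mono (ENNReal.mul_ne_top ENNReal.ofReal_ne_top (Lp.eLpNorm_ne_top _)) h1
    refine h2.trans ?_
    have h3 : (1 + κ) ^ 2 ≤ 4 := by nlinarith
    exact mul_le_mul h3 (norm_val_le u) (norm_nonneg _) (by norm_num)
  have b2 : ‖wgrad (solToH (smoothTest hΩ h hP hs u))‖ ≤ K * (4 * K + 1) * 2 * ‖u‖ := by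
    have p1 : ∀ x, ‖grad (smoothTest hΩ h hP hs u).1.1 x‖ ≤
        ‖(fun x => (K * (4 * K)) * ‖G (Ψ x)‖ + K * ‖m (Ψ x)‖) x‖ := by
      intro x
      rw [grad_eq_gradL, Real.norm_of_nonneg (by positivity)]
      refine (hKb _).2.trans ?_
      have h1 := norm_fderiv_smoothTest_le hΩ h hP hκ hs u x
      have h2 : ‖fderiv ℝ m (Ψ x)‖ ≤ K * ‖G (Ψ x)‖ := by
        have := (hKb (fderiv ℝ m (Ψ x))).1
        rwa [← grad_eq_gradL, hm, grad_mollify hmeas h] at this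
      have h3 := mul_le_mul_of_nonneg_left h1 hK.le
      have h4 := mul_le_mul_of_nonneg_left h2 hK.le
      rw [← hm] at h3
      linarith
    have q : ∀ {F : Type} [NormedAddCommGroup F] [NormedSpace ℝ F] (w : L2 Ω F),
        eLpNorm (fun x => mollify ρ (ext0 w) (Ψ x)) 2 volume ≤
          ENNReal.ofReal 2 * ENNReal.ofReal ‖w‖ := by
      intro F _ _ w
      have hc : Continuous (mollify ρ (ext0 w)) :=
        (h.contDiff_mollify (locallyIntegrable_ext0 hmeas w)).continuous
      refine (hP.eLpNorm_comp_le hc (p := 2) (by norm_num)).trans ?_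
      refine mul_le_mul' (ENNReal.ofReal_le_ofReal (by linarith)) ?_
      refine (h.eLpNorm_mollify_le (memLp_ext0 hmeas w).1 (by norm_num)).trans ?_
      rw [eLpNorm_ext0 hmeas, Lp.norm_def, ENNReal.ofReal_toReal (Lp.eLpNorm_ne_top _)]
    have e1 : eLpNorm (fun x => (K * (4 * K)) * ‖G (Ψ x)‖) 2 volume ≤
        ENNReal.ofReal (K * (4 * K) * (2 * ‖u‖)) := by
      refine (eLpNorm_le_mul_eLpNorm_of_ae_le_mul (g := fun x => G (Ψ x)) (c := K * (4 * K))
        (Eventually.of_forall fun x => ?_) 2).trans ?_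
      · simp [abs_of_pos hK]
      · rw [ENNReal.ofReal_mul (p := K * (4 * K)) (by positivity)]
        refine mul_le_mul' le_rfl ?_
        refine (q (wgrad u)).trans ?_
        rw [← ENNReal.ofReal_mul (by norm_num)]
        exact ENNReal.ofReal_le_ofReal (by linarith [norm_wgrad_le u])
    have e2 : eLpNorm (fun x => K * ‖m (Ψ x)‖) 2 volume ≤
        ENNReal.ofReal (K * (2 * ‖u‖)) := by
      refine (eLpNorm_le_mul_eLpNorm_of_ae_le_mul (g := fun x => m (Ψ x)) (c := K)
        (Eventually.of_forall fun x => ?_) 2).trans ?_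
      · simp [abs_of_pos hK]
      · rw [ENNReal.ofReal_mul hK.le]
        refine mul_le_mul' le_rfl ?_
        refine (q (val u)).trans ?_
        rw [← ENNReal.ofReal_mul (by norm_num)]
        exact ENNReal.ofReal_le_ofReal (by linarith [norm_val_le u])
    have hΨc := hP.contDiff_map.continuous
    have e3 : eLpNorm (grad (smoothTest hΩ h hP hs u).1.1) 2 (volume.restrict Ω) ≤
        ENNReal.ofReal (K * (4 * K + 1) * 2 * ‖u‖) := by
      calc _ ≤ eLpNorm (grad (smoothTest hΩ h hP hs u).1.1) 2 volume :=
            eLpNorm_mono_measure _ Measure.restrict_le_self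
        _ ≤ eLpNorm (fun x => (K * (4 * K)) * ‖G (Ψ x)‖ + K * ‖m (Ψ x)‖) 2 volume :=
            eLpNorm_mono p1
        _ ≤ eLpNorm (fun x => (K * (4 * K)) * ‖G (Ψ x)‖) 2 volume +
              eLpNorm (fun x => K * ‖m (Ψ x)‖) 2 volume := by
            refine eLpNorm_add_le ?_ ?_ (by norm_num)
            · exact (continuous_const.mul (hGc.comp hΨc).norm).aestronglyMeasurable
            · exact (continuous_const.mul (hmc.comp hΨc).norm).aestronglyMeasurable
        _ ≤ ENNReal.ofReal (K * (4 * K) * (2 * ‖u‖)) + ENNReal.ofReal (K * (2 * ‖u‖)) :=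
            add_le_add e1 e2
        _ = _ := by
            rw [← ENNReal.ofReal_add (by positivity) (by positivity)]
            congr 1
            ring
    rw [Lp.norm_def, eLpNorm_congr_ae (coeFn_wgrad_solToH _)]
    exact ENNReal.toReal_le_of_le_ofReal (by positivity) e3
  refine (norm_le_val_add_wgrad _).trans ?_
  linarith

end Smoothing

/-! ### Strong convergence of the smoothing operators to the identity. -/

section SmoothingConvergence

variable {d : ℕ} {Ω : Set (Space d)} {δ κ : ℝ} {ρ : Space d → ℝ} {Ψ : Space d → Space d}
  {M : Space d → Space d →L[ℝ] Space d}

theorem norm_sub_le_of_norm_fderiv_le {E F : Type*} [NormedAddCommGroup E] [NormedSpace ℝ E]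
    [NormedAddCommGroup F] [NormedSpace ℝ F] {f : E → F} (hf : ContDiff ℝ ∞ f) {B : ℝ}
    (hB : ∀ x, ‖fderiv ℝ f x‖ ≤ B) (x y : E) : ‖f x - f y‖ ≤ B * ‖x - y‖ :=
  Convex.norm_image_sub_le_of_norm_fderiv_le (s := univ)
    (fun z _ => hf.differentiable (by simp) z) (fun z _ => hB z) convex_univ trivial trivial

theorem norm_mollify_sub_le {F : Type} [NormedAddCommGroup F] [NormedSpace ℝ F] [CompleteSpace F]
    (h : IsKernel δ ρ) {f : Space d → F} (hf : Continuous f) {B : ℝ} (hB0 : 0 ≤ B) (hδ : 0 ≤ δ)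
    (hB : ∀ x y, ‖f x - f y‖ ≤ B * ‖x - y‖) (x : Space d) : ‖mollify ρ f x - f x‖ ≤ B * δ := by
  rw [← dist_eq_norm]
  refine h.dist_mollify_le (mul_nonneg hB0 hδ) hf.stronglyMeasurable.aestronglyMeasurable
    fun y hy => ?_
  rw [dist_eq_norm]
  refine (hB y x).trans (mul_le_mul_of_nonneg_left ?_ hB0)
  rw [← dist_eq_norm]
  exact (mem_ball.1 hy).le

theorem norm_mollify_le {F : Type} [NormedAddCommGroup F] [NormedSpace ℝ F] [CompleteSpace F]
    (h : IsKernel δ ρ) {f : Space d → F} (hf : Continuous f) {B : ℝ} (hB0 : 0 ≤ B)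
    (hB : ∀ x, ‖f x‖ ≤ B) (x : Space d) : ‖mollify ρ f x‖ ≤ B := by
  rw [← dist_zero_right]
  refine h.dist_mollify_le hB0 hf.stronglyMeasurable.aestronglyMeasurable fun y _ => ?_
  rw [dist_zero_right]
  exact hB y

theorem norm_comp_comp_sub_le {E : Type*} [NormedAddCommGroup E] [NormedSpace ℝ E]
    {A D D' N : E →L[ℝ] E} {κ B : ℝ}
    (hA : ‖A - ContinuousLinearMap.id ℝ _‖ ≤ κ) (hD : ‖D - ContinuousLinearMap.id ℝ _‖ ≤ κ)
    (hκ : κ ≤ 1) (hN : ‖N‖ ≤ B) (hNN : ‖N - D'‖ ≤ 2 * B * κ) :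
    ‖A.comp (N.comp D) - D'‖ ≤ 5 * B * κ := by
  have hκ0 : 0 ≤ κ := (norm_nonneg _).trans hA
  have hB0 : 0 ≤ B := (norm_nonneg _).trans hN
  have e : A.comp (N.comp D) - D' = (A - ContinuousLinearMap.id ℝ _).comp (N.comp D) +
      N.comp (D - ContinuousLinearMap.id ℝ _) + (N - D') := by
    ext v
    simp
  rw [e]
  have hD2 : ‖D‖ ≤ 2 := by linarith [norm_le_one_add hD]
  have h1 : ‖N.comp D‖ ≤ B * 2 := (ContinuousLinearMap.opNorm_comp_le _ _).trans
    (mul_le_mul hN hD2 (norm_nonneg _) hB0)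
  have h2 : ‖(A - ContinuousLinearMap.id ℝ _).comp (N.comp D)‖ ≤ κ * (B * 2) :=
    (ContinuousLinearMap.opNorm_comp_le _ _).trans (mul_le_mul hA h1 (norm_nonneg _) hκ0)
  have h3 : ‖N.comp (D - ContinuousLinearMap.id ℝ _)‖ ≤ B * κ :=
    (ContinuousLinearMap.opNorm_comp_le _ _).trans (mul_le_mul hN hD (norm_nonneg _) hB0)
  refine (norm_add_le _ _).trans ((add_le_add (norm_add_le _ _) le_rfl).trans ?_)
  linarith

theorem mollify_ext0_solToH (hΩ : MeasurableSet Ω) (φ : SolTestField Ω) :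
    mollify ρ (ext0 (val (solToH φ))) = mollify ρ φ.1.1 :=
  mollify_congr (ext0_ae_eq hΩ (coeFn_val_solToH φ) ((subset_tsupport _).trans φ.1.2.2.2))

/-- Each ingredient (matrix, mollification, displacement) is within order `κ` of the identity on
Lipschitz functions. The gradient is compared in the same way, which is why second derivatives of
`φ` are bounded too. -/
theorem smoothTest_sub_le (hΩ : IsLipschitzDomain Ω) (h : IsKernel δ ρ)
    (hP : IsPiola κ Ψ M) (hκ : κ ≤ 1) (hδ : 0 ≤ δ) (hδκ : δ ≤ κ)
    (hs : Ψ ⁻¹' cthickening δ Ω ⊆ Ω) (φ : SolTestField Ω) {B : ℝ}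
    (hB0 : ∀ x, ‖φ.1.1 x‖ ≤ B) (hB1 : ∀ x, ‖fderiv ℝ φ.1.1 x‖ ≤ B)
    (hB2 : ∀ x, ‖fderiv ℝ (fderiv ℝ φ.1.1) x‖ ≤ B) (x : Space d) :
    ‖(smoothTest hΩ h hP hs (solToH φ)).1.1 x - φ.1.1 x‖ ≤ 3 * B * κ ∧
      ‖fderiv ℝ (smoothTest hΩ h hP hs (solToH φ)).1.1 x - fderiv ℝ φ.1.1 x‖ ≤ 6 * B * κ := by
  have hB : 0 ≤ B := (norm_nonneg _).trans (hB0 0)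
  have hκ0 : 0 ≤ κ := hP.nonneg
  have hφ : ContDiff ℝ ∞ φ.1.1 := φ.1.2.1
  have hφ' : ContDiff ℝ ∞ (fderiv ℝ φ.1.1) := hφ.fderiv_right (by simp)
  have hm := mollify_ext0_solToH (ρ := ρ) hΩ.measurableSet φ
  have hBδ : B * δ ≤ B * κ := mul_le_mul_of_nonneg_left hδκ hB
  have lip0 := norm_sub_le_of_norm_fderiv_le hφ hB1
  have lip1 := norm_sub_le_of_norm_fderiv_le hφ' hB2
  have m0 : ‖mollify ρ φ.1.1 (Ψ x)‖ ≤ B := norm_mollify_le h hφ.continuous hB hB0 _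
  have hBΨ : B * ‖Ψ x - x‖ ≤ B * κ := mul_le_mul_of_nonneg_left (hP.map_sub x) hB
  constructor
  · rw [smoothTest_apply, hm]
    have e : M x (mollify ρ φ.1.1 (Ψ x)) - φ.1.1 x =
        (M x - ContinuousLinearMap.id ℝ (Space d)) (mollify ρ φ.1.1 (Ψ x)) +
          (mollify ρ φ.1.1 (Ψ x) - φ.1.1 (Ψ x)) + (φ.1.1 (Ψ x) - φ.1.1 x) := by
      simp
    rw [e]
    have h1 : ‖(M x - ContinuousLinearMap.id ℝ (Space d)) (mollify ρ φ.1.1 (Ψ x))‖ ≤ κ * B :=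
      (ContinuousLinearMap.le_opNorm _ _).trans
        (mul_le_mul (hP.mat_sub x) m0 (norm_nonneg _) hκ0)
    have h2 := norm_mollify_sub_le h hφ.continuous hB hδ lip0 (Ψ x)
    have h3 := lip0 (Ψ x) x
    refine (norm_add_le _ _).trans ((add_le_add (norm_add_le _ _) le_rfl).trans ?_)
    linarith
  · rw [fderiv_smoothTest, hm, (grad_mollify_of_contDiff h hφ φ.1.2.2.1 (Ψ x)).1]
    have h1 : ‖mollify ρ (fderiv ℝ φ.1.1) (Ψ x)‖ ≤ B :=
      norm_mollify_le h hφ'.continuous hB hB1 _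
    have h2 := norm_mollify_sub_le h hφ'.continuous hB hδ lip1 (Ψ x)
    have h3 := lip1 (Ψ x) x
    have h4 : ‖mollify ρ (fderiv ℝ φ.1.1) (Ψ x) - fderiv ℝ φ.1.1 x‖ ≤ 2 * B * κ := by
      refine (norm_sub_le_norm_sub_add_norm_sub _ (fderiv ℝ φ.1.1 (Ψ x)) _).trans ?_
      linarith
    have h5 := norm_comp_comp_sub_le (hP.mat_sub x) (hP.fderiv_map_sub x) hκ h1 h4
    have h6 : ‖(fderiv ℝ M x).flip (mollify ρ φ.1.1 (Ψ x))‖ ≤ κ * B := by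
      refine ContinuousLinearMap.opNorm_le_bound _ (by positivity) fun v => ?_
      rw [ContinuousLinearMap.flip_apply]
      have a1 : ‖fderiv ℝ M x v‖ ≤ κ * ‖v‖ :=
        ContinuousLinearMap.le_of_opNorm_le _ (hP.fderiv_mat x) v
      calc _ ≤ ‖fderiv ℝ M x v‖ * ‖mollify ρ φ.1.1 (Ψ x)‖ := ContinuousLinearMap.le_opNorm _ _
        _ ≤ (κ * ‖v‖) * B := mul_le_mul a1 m0 (norm_nonneg _) (by positivity)
        _ = _ := by ring
    rw [add_sub_right_comm]
    refine (norm_add_le _ _).trans ?_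
    linarith

theorem exists_bound_testField (φ : TestField Ω) : ∃ B, (∀ x, ‖φ.1 x‖ ≤ B) ∧
    (∀ x, ‖fderiv ℝ φ.1 x‖ ≤ B) ∧ ∀ x, ‖fderiv ℝ (fderiv ℝ φ.1) x‖ ≤ B := by
  obtain ⟨B₀, h0⟩ := φ.2.2.1.exists_bound_of_continuous φ.2.1.continuous
  obtain ⟨B₁, h1⟩ := exists_norm_fderiv_le φ.2.1 φ.2.2.1
  obtain ⟨B₂, h2⟩ := exists_norm_fderiv_le (φ.2.1.fderiv_right (m := ∞) (by simp))
    (φ.2.2.1.fderiv (𝕜 := ℝ))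
  exact ⟨max B₀ (max B₁ B₂), fun x => (h0 x).trans (le_max_left _ _),
    fun x => (h1 x).trans ((le_max_left _ _).trans (le_max_right _ _)),
    fun x => (h2 x).trans ((le_max_right _ _).trans (le_max_right _ _))⟩

theorem IsLipschitzDomain.isFiniteMeasure (hΩ : IsLipschitzDomain Ω) :
    IsFiniteMeasure (volume.restrict Ω) :=
  ⟨by rw [Measure.restrict_apply_univ]; exact hΩ.isBounded.measure_lt_top⟩

/-- Uniform errors become `H¹` errors because `Ω` has finite measure. The constant depends on `φ`
but not on kernel or transform. -/
theorem exists_norm_smoothTest_sub_le (hΩ : IsLipschitzDomain Ω) (φ : SolTestField Ω) :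
    ∃ C : ℝ, ∀ (δ κ : ℝ) (ρ : Space d → ℝ) (Ψ : Space d → Space d)
      (M : Space d → Space d →L[ℝ] Space d) (h : IsKernel δ ρ) (hP : IsPiola κ Ψ M)
      (hs : Ψ ⁻¹' cthickening δ Ω ⊆ Ω), κ ≤ 1 → 0 ≤ δ → δ ≤ κ →
        ‖solToH (smoothTest hΩ h hP hs (solToH φ)) - solToH φ‖ ≤ C * κ := by
  obtain ⟨K, hK, hKb⟩ := exists_norm_le_gradL d
  obtain ⟨B, hB0, hB1, hB2⟩ := exists_bound_testField φ.1
  have := hΩ.isFiniteMeasure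
  set V : ℝ := measureUnivNNReal (volume.restrict Ω) ^ (2 : ℝ≥0∞).toReal⁻¹ with hV
  have hV0 : 0 ≤ V := by positivity
  refine ⟨V * (3 * B) + V * (K * (6 * B)), ?_⟩
  intro δ κ ρ Ψ M h hP hs hκ hδ hδκ
  have hκ0 := hP.nonneg
  have hB : 0 ≤ B := (norm_nonneg _).trans (hB0 0)
  have key := smoothTest_sub_le hΩ h hP hκ hδ hδκ hs φ hB0 hB1 hB2
  set ψ := smoothTest hΩ h hP hs (solToH φ)
  refine (norm_le_val_add_wgrad _).trans ?_
  rw [val_sub, wgrad_sub]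
  have b1 : ‖val (solToH ψ) - val (solToH φ)‖ ≤ V * (3 * B * κ) := by
    refine Lp.norm_le_of_ae_bound (by positivity) ?_
    filter_upwards [Lp.coeFn_sub (val (solToH ψ)) (val (solToH φ)), coeFn_val_solToH ψ,
      coeFn_val_solToH φ] with x h1 h2 h3
    rw [h1, Pi.sub_apply, h2, h3]
    exact (key x).1
  have b2 : ‖wgrad (solToH ψ) - wgrad (solToH φ)‖ ≤ V * (K * (6 * B * κ)) := by
    refine Lp.norm_le_of_ae_bound (by positivity) ?_
    filter_upwards [Lp.coeFn_sub (wgrad (solToH ψ)) (wgrad (solToH φ)), coeFn_wgrad_solToH ψ,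
      coeFn_wgrad_solToH φ] with x h1 h2 h3
    rw [h1, Pi.sub_apply, h2, h3, grad_eq_gradL, grad_eq_gradL, ← map_sub]
    exact (hKb _).2.trans (mul_le_mul_of_nonneg_left (key x).2 hK.le)
  calc _ ≤ V * (3 * B * κ) + V * (K * (6 * B * κ)) := add_le_add b1 b2
    _ = _ := by ring

theorem solToH_sub (φ ψ : SolTestField Ω) : solToH (φ - ψ) = solToH φ - solToH ψ :=
  map_sub (solToHₗ Ω) φ ψ

/-- Smoothing operators on `H¹_{0,σ}` with values in the divergence free test fields, converging
strongly to the identity, that increase no `L^p` norm in the limit. -/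
theorem exists_smoothing (hΩ : IsLipschitzDomain Ω) :
    ∃ S : ℕ → H10sol Ω →ₗ[ℝ] SolTestField Ω,
      (∃ C : ℝ, 0 < C ∧ ∀ n u, ‖solToH (S n u)‖ ≤ C * ‖u‖) ∧
      (∀ u, Tendsto (fun n => solToH (S n u)) atTop (𝓝 u)) ∧
      ∀ n u p, 1 ≤ p → eLpNorm (val (solToH (S n u))) p (volume.restrict Ω) ≤
        ENNReal.ofReal ((1 + 1 / ((n : ℝ) + 1)) ^ 2) * eLpNorm (val u) p (volume.restrict Ω) := by
  -- `δ` is chosen after `Ψ`, small enough that the preimage of the `δ`-neighbourhood stays in `Ω`;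
  -- `δ ≤ κ` lets the single rate `1/(n+1)` govern all errors.
  have hpar : ∀ n : ℕ, ∃ (δ : ℝ) (ρ : Space d → ℝ) (Ψ : Space d → Space d)
      (M : Space d → Space d →L[ℝ] Space d), IsKernel δ ρ ∧ IsPiola (1 / ((n : ℝ) + 1)) Ψ M ∧
      Ψ ⁻¹' cthickening δ Ω ⊆ Ω ∧ 0 ≤ δ ∧ δ ≤ 1 / ((n : ℝ) + 1) := by
    intro n
    have hn : (0 : ℝ) < 1 / ((n : ℝ) + 1) := by positivity
    obtain ⟨Ψ, M, hP, ho⟩ := exists_isPiola_outward hΩ hn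
    obtain ⟨δ₀, hδ₀, hs⟩ := exists_preimage_cthickening_subset hΩ hP.contDiff_map.continuous
      hP.map_sub ho
    have hδ : 0 < min δ₀ (1 / ((n : ℝ) + 1)) := lt_min hδ₀ hn
    obtain ⟨ρ, hρ⟩ := exists_isKernel (G := Space d) hδ
    exact ⟨_, ρ, Ψ, M, hρ, hP, hs _ (min_le_left _ _), hδ.le, min_le_right _ _⟩
  choose δ ρ Ψ M h hP hs hδ hδκ using hpar
  have hκ1 : ∀ n : ℕ, 1 / ((n : ℝ) + 1) ≤ 1 := fun n => by
    rw [div_le_one (by positivity)]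
    linarith [(Nat.cast_nonneg n : (0 : ℝ) ≤ n)]
  obtain ⟨C, hC, hCb⟩ := exists_norm_smoothTest_le hΩ
  refine ⟨fun n => smoothTest hΩ (h n) (hP n) (hs n), ⟨C, hC, fun n u => hCb _ _ _ _ _ _ _ _
    (hκ1 n) u⟩, fun u => ?_, fun n u p hp => eLpNorm_smoothTest_le hΩ (h n) (hP n) (hs n) u hp⟩
  rw [Metric.tendsto_atTop]
  intro ε hε
  have hε' : 0 < ε / (2 * (C + 1)) := by positivity
  obtain ⟨φ, hφ⟩ := (denseRange_solToH (Ω := Ω)).exists_dist_lt u hε'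
  obtain ⟨D, hD⟩ := exists_norm_smoothTest_sub_le hΩ φ
  have hlim : Tendsto (fun n : ℕ => D * (1 / ((n : ℝ) + 1))) atTop (𝓝 (D * 0)) :=
    tendsto_one_div_add_atTop_nhds_zero_nat.const_mul D
  rw [mul_zero] at hlim
  obtain ⟨N, hN⟩ := (hlim.eventually (gt_mem_nhds (show 0 < ε / 2 by positivity))).exists_forall_of_atTop
  refine ⟨N, fun n hn => ?_⟩
  have h1 := hN n hn
  have h2 := hD _ _ _ _ _ (h n) (hP n) (hs n) (hκ1 n) (hδ n) (hδκ n)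
  have h3 := hCb _ _ _ _ _ (h n) (hP n) (hs n) (hκ1 n) (u - solToH φ)
  -- Uniform boundedness together with convergence on the dense set of test fields gives strong
  -- convergence.
  have e : solToH (smoothTest hΩ (h n) (hP n) (hs n) u) - u =
      solToH (smoothTest hΩ (h n) (hP n) (hs n) (u - solToH φ)) +
      (solToH (smoothTest hΩ (h n) (hP n) (hs n) (solToH φ)) - solToH φ) + (solToH φ - u) := by
    rw [map_sub, solToH_sub]
    abel
  rw [dist_eq_norm] at hφ ⊢
  rw [e]
  have h4 : ‖solToH φ - u‖ = ‖u - solToH φ‖ := norm_sub_rev _ _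
  have h5 : (C + 1) * ‖u - solToH φ‖ < ε / 2 := by
    calc (C + 1) * ‖u - solToH φ‖ < (C + 1) * (ε / (2 * (C + 1))) := by gcongr
      _ = ε / 2 := by field_simp
  refine (norm_add_le _ _).trans_lt ((add_le_add (norm_add_le _ _) le_rfl).trans_lt ?_)
  linarith

end SmoothingConvergence

/-! ### The space `H² ∩ H¹_{0,σ}` -/

section SecondOrder

variable {d : ℕ} {Ω : Set (Space d)}

noncomputable instance completeSpace_H10sol : CompleteSpace (H10sol Ω) :=
  (Submodule.isClosed_topologicalClosure _).completeSpace_coe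

theorem continuous_integral_coord_mul {ι : Type} [Fintype ι] (a : ι) {h : Space d → ℝ}
    (hh : MemLp h 2 (volume.restrict Ω)) :
    Continuous fun G : L2 Ω (EuclideanSpace ℝ ι) => ∫ x in Ω, G x a * h x := by
  let B : EuclideanSpace ℝ ι →L[ℝ] ℝ →L[ℝ] ℝ :=
    (ContinuousLinearMap.mul ℝ ℝ).comp (EuclideanSpace.proj (𝕜 := ℝ) a)
  have e : (fun G : L2 Ω (EuclideanSpace ℝ ι) => ∫ x in Ω, G x a * h x) =
      fun G => (B.lpPairing (volume.restrict Ω) 2 2).flip (hh.toLp h) G := by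
    funext G
    rw [ContinuousLinearMap.flip_apply, ContinuousLinearMap.lpPairing_eq_integral]
    refine integral_congr_ae ?_
    filter_upwards [hh.coeFn_toLp] with x hx
    rw [hx]
    rfl
  rw [e]
  exact ContinuousLinearMap.continuous _

theorem memLp_two_of_contDiff {φ : Space d → ℝ} (h : ContDiff ℝ ∞ φ) (hs : HasCompactSupport φ) :
    MemLp φ 2 (volume.restrict Ω) := h.continuous.memLp_of_hasCompactSupport hs

theorem memLp_two_fderiv {φ : Space d → ℝ} (h : ContDiff ℝ ∞ φ) (hs : HasCompactSupport φ)
    (v : Space d) : MemLp (fun x => fderiv ℝ φ x v) 2 (volume.restrict Ω) := by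
  have hc : Continuous fun x => fderiv ℝ φ x v :=
    (h.continuous_fderiv (by simp)).clm_apply continuous_const
  exact hc.memLp_of_hasCompactSupport (hs.fderiv_apply (𝕜 := ℝ) v)

theorem isClosed_H2sol : IsClosed (H2sol Ω : Set (WithLp 2 (H10sol Ω × L2 Ω (Ten d)))) := by
  have e : (H2sol Ω : Set (WithLp 2 (H10sol Ω × L2 Ω (Ten d)))) =
      {w | ∀ φ : Space d → ℝ, ContDiff ℝ ∞ φ → HasCompactSupport φ → tsupport φ ⊆ Ω →
        ∀ i j k, ∫ x in Ω, wgrad w.fst x (i, j) * fderiv ℝ φ x (basisVec k) =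
          - ∫ x in Ω, w.snd x (i, j, k) * φ x} := rfl
  rw [e]
  simp only [ofPred_forall]
  refine isClosed_iInter fun φ => isClosed_iInter fun h1 => isClosed_iInter fun h2 =>
    isClosed_iInter fun _ => isClosed_iInter fun i => isClosed_iInter fun j =>
    isClosed_iInter fun k => isClosed_eq ?_ ?_
  · exact (continuous_integral_coord_mul (i, j) (memLp_two_fderiv h1 h2 (basisVec k))).comp
      ((wgradL Ω).continuous.comp (WithLp.fstL 2 ℝ (H10sol Ω) (L2 Ω (Ten d))).continuous)
  · exact ((continuous_integral_coord_mul (i, j, k) (memLp_two_of_contDiff h1 h2)).comp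
      (WithLp.sndL 2 ℝ (H10sol Ω) (L2 Ω (Ten d))).continuous).neg

noncomputable instance completeSpace_H2sol : CompleteSpace (H2sol Ω) :=
  isClosed_H2sol.completeSpace_coe

/-- `toH10sol` as a continuous linear map. -/
noncomputable def toH10solL (Ω : Set (Space d)) : H2sol Ω →L[ℝ] H10sol Ω :=
  (WithLp.fstL 2 ℝ (H10sol Ω) (L2 Ω (Ten d))).comp (H2sol Ω).subtypeL

theorem toH10solL_apply (w : H2sol Ω) : toH10solL Ω w = toH10sol w := rfl

/-- The weak second derivative is determined by the weak gradient, by the fundamental lemma of the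
calculus of variations. Injectivity is what the closed graph argument below requires. -/
theorem injective_toH10solL (hΩ : IsOpen Ω) : Function.Injective (toH10solL Ω) := by
  rw [injective_iff_map_eq_zero]
  intro w hw
  have hw1 : w.1.fst = 0 := hw
  have hw2 : w.1.snd = 0 := by
    have key : ∀ i j k, ∀ᵐ x, x ∈ Ω → w.1.snd x (i, j, k) = 0 := by
      intro i j k
      refine hΩ.ae_eq_zero_of_integral_contDiff_smul_eq_zero ?_ fun φ h1 h2 h3 => ?_
      · have hm : MemLp (fun x => w.1.snd x (i, j, k)) 2 (volume.restrict Ω) :=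
          (Lp.memLp w.1.snd).continuousLinearMap_comp (EuclideanSpace.proj (𝕜 := ℝ) (i, j, k))
        exact locallyIntegrableOn_of_locallyIntegrable_restrict
          (hm.locallyIntegrable (by norm_num))
      · have hwd := w.2 φ h1 h2 h3 i j k
        rw [hw1] at hwd
        have h0 : ∫ x in Ω, (wgrad (0 : H10sol Ω)) x (i, j) * fderiv ℝ φ x (basisVec k) = 0 := by
          refine integral_eq_zero_of_ae ?_
          have : (wgrad (0 : H10sol Ω)) = 0 := map_zero (wgradL Ω)
          rw [this]
          filter_upwards [Lp.coeFn_zero (Mat d) 2 (volume.restrict Ω)] with x hx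
          rw [hx]
          simp
        rw [h0] at hwd
        have h4 : ∫ x, φ x • w.1.snd x (i, j, k) = ∫ x in Ω, w.1.snd x (i, j, k) * φ x := by
          rw [setIntegral_eq_integral_of_forall_compl_eq_zero]
          · simp [mul_comm]
          · intro x hx
            rw [image_eq_zero_of_notMem_tsupport (fun h => hx (h3 h)), mul_zero]
        rw [h4]
        linarith
    refine Lp.ext ?_
    have hall : ∀ᵐ x, ∀ p : Fin d × Fin d × Fin d, x ∈ Ω → w.1.snd x p = 0 :=
      ae_all_iff.2 fun p => key p.1 p.2.1 p.2.2
    rw [Filter.EventuallyEq, ae_restrict_iff' hΩ.measurableSet]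
    have hz := Lp.coeFn_zero (Ten d) 2 (volume.restrict Ω)
    rw [Filter.EventuallyEq, ae_restrict_iff' hΩ.measurableSet] at hz
    filter_upwards [hall, hz] with x hx hzx hxΩ
    rw [hzx hxΩ]
    ext p
    exact hx p hxΩ
  have hn : ‖w‖ ^ 2 = ‖w.1.fst‖ ^ 2 + ‖w.1.snd‖ ^ 2 := WithLp.prod_norm_sq_eq_of_L2 w.1
  have hn1 : ‖w.1.fst‖ ^ 2 + ‖w.1.snd‖ ^ 2 = 0 := by
    rw [hw1, hw2, norm_zero, norm_zero]
    norm_num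
  exact norm_eq_zero.1 (pow_eq_zero_iff (two_ne_zero)|>.1 (hn.trans hn1))

/-- The classical second derivative of a field. -/
noncomputable def hess (φ : Space d → Space d) (x : Space d) : Ten d :=
  WithLp.toLp 2 fun p => fderiv ℝ (fun y => grad φ y (p.1, p.2.1)) x (basisVec p.2.2)

theorem contDiff_grad_coord (φ : TestField Ω) (i j : Fin d) :
    ContDiff ℝ ∞ fun x => grad φ.1 x (i, j) := by
  have h1 : ContDiff ℝ ∞ fun x => gradL d (fderiv ℝ φ.1 x) :=
    (gradL d).contDiff.comp (φ.2.1.fderiv_right (by simp))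
  have h2 : ContDiff ℝ ∞ fun G : Mat d => G (i, j) := contDiff_piLp_apply 2
  exact h2.comp h1

theorem hasCompactSupport_grad_coord (φ : TestField Ω) (i j : Fin d) :
    HasCompactSupport fun x => grad φ.1 x (i, j) :=
  (hasCompactSupport_grad φ).comp_left (g := fun G : Mat d => G (i, j)) rfl

theorem memLp_hess (φ : TestField Ω) : MemLp (hess φ.1) 2 (volume.restrict Ω) :=
  MemLp.of_eval_piLp fun p => memLp_two_fderiv (contDiff_grad_coord φ p.1 p.2.1)
    (hasCompactSupport_grad_coord φ p.1 p.2.1) (basisVec p.2.2)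

theorem isWeakDeriv_solToH (φ : SolTestField Ω) :
    IsWeakDeriv (wgrad (solToH φ)) ((memLp_hess φ.1).toLp (hess φ.1.1)) := by
  intro ψ h1 h2 h3 i j k
  have hgij := contDiff_grad_coord φ.1 i j
  have hsij := hasCompactSupport_grad_coord φ.1 i j
  have e1 : ∫ x in Ω, wgrad (solToH φ) x (i, j) * fderiv ℝ ψ x (basisVec k) =
      ∫ x, grad φ.1.1 x (i, j) * fderiv ℝ ψ x (basisVec k) := by
    have h0 : ∀ x, x ∉ Ω → grad φ.1.1 x (i, j) * fderiv ℝ ψ x (basisVec k) = 0 := by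
      intro x hx
      have : fderiv ℝ ψ x = 0 := by
        by_contra hne
        exact hx (h3 (support_fderiv_subset ℝ hne))
      rw [this]
      simp
    refine Eq.trans (integral_congr_ae ?_) (setIntegral_eq_integral_of_forall_compl_eq_zero h0)
    filter_upwards [coeFn_wgrad_solToH φ] with x hx
    rw [hx]
  have e2 : ∫ x in Ω, ((memLp_hess φ.1).toLp (hess φ.1.1)) x (i, j, k) * ψ x =
      ∫ x, fderiv ℝ (fun y => grad φ.1.1 y (i, j)) x (basisVec k) * ψ x := by
    have h0 : ∀ x, x ∉ Ω →
        fderiv ℝ (fun y => grad φ.1.1 y (i, j)) x (basisVec k) * ψ x = 0 := by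
      intro x hx
      rw [image_eq_zero_of_notMem_tsupport (fun h => hx (h3 h)), mul_zero]
    refine Eq.trans (integral_congr_ae ?_) (setIntegral_eq_integral_of_forall_compl_eq_zero h0)
    filter_upwards [(memLp_hess φ.1).coeFn_toLp] with x hx
    rw [hx]
    rfl
  rw [e1, e2]
  have hc1 := hgij.continuous
  have hc2 : Continuous fun x => fderiv ℝ (fun y => grad φ.1.1 y (i, j)) x (basisVec k) :=
    (hgij.continuous_fderiv (by simp)).clm_apply continuous_const
  have hc3 : Continuous fun x => fderiv ℝ ψ x (basisVec k) :=
    (h1.continuous_fderiv (by simp)).clm_apply continuous_const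
  refine integral_mul_fderiv_eq_neg_fderiv_mul_of_integrable ?_ ?_ ?_
    (fun x _ => hgij.differentiable (by simp) x)
    (fun x _ => h1.differentiable (by simp) x)
  · exact (hc2.mul h1.continuous).integrable_of_hasCompactSupport h2.mul_left
  · exact (hc1.mul hc3).integrable_of_hasCompactSupport hsij.mul_right
  · exact (hc1.mul h1.continuous).integrable_of_hasCompactSupport h2.mul_left

/-- A divergence free test field as an element of `H² ∩ H¹_{0,σ}`. -/
noncomputable def solToH2 (φ : SolTestField Ω) : H2sol Ω :=
  ⟨WithLp.toLp 2 (solToH φ, (memLp_hess φ.1).toLp (hess φ.1.1)), isWeakDeriv_solToH φ⟩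

/-- If a bounded operator factors through an injective one as a map of sets, then it does so as a
bounded operator, by the closed graph theorem. -/
theorem exists_lift_of_injective {V E Y : Type*} [NormedAddCommGroup V] [NormedSpace ℝ V]
    [CompleteSpace V] [NormedAddCommGroup E] [NormedSpace ℝ E] [NormedAddCommGroup Y]
    [NormedSpace ℝ Y] (X : Submodule ℝ E) [CompleteSpace X] (ι : X →L[ℝ] Y)
    (hι : Function.Injective ι) (S : V →L[ℝ] Y) (s : V → X) (hs : ∀ u, ι (s u) = S u) :
    ∃ T : V →L[ℝ] X, ∀ u, T u = s u := by
  let T₀ : V →ₗ[ℝ] X :=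
    { toFun := s
      map_add' := fun u v => hι (by rw [map_add, hs, hs, hs, map_add])
      map_smul' := fun c u => hι (by rw [map_smul, hs, hs, map_smul]; rfl) }
  refine ⟨ContinuousLinearMap.ofIsClosedGraph (g := T₀) ?_, fun u => rfl⟩
  -- By injectivity of `ι` the graph is where two continuous maps agree, so it is closed; no
  -- estimate of second derivatives is needed.
  have e : (T₀.graph : Set (V × X)) = {p | ι p.2 = S p.1} := by
    ext p
    rw [SetLike.mem_coe, LinearMap.mem_graph_iff, mem_ofPred_eq, ← hs]
    exact hι.eq_iff.symm
  rw [e]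
  exact isClosed_eq (ι.continuous.comp continuous_snd) (S.continuous.comp continuous_fst)

/-- The lift is linear and bounded, so it preserves `C¹` curves and commutes with the time
derivative. -/
theorem exists_contDiffOn_lift_of_injective {V E Y : Type*} [NormedAddCommGroup V]
    [NormedSpace ℝ V] [CompleteSpace V] [NormedAddCommGroup E] [NormedSpace ℝ E]
    [NormedAddCommGroup Y] [NormedSpace ℝ Y] (X : Submodule ℝ E) [CompleteSpace X] (ι : X →L[ℝ] Y)
    (hι : Function.Injective ι) (S : V →L[ℝ] Y) (s : V → X) (hs : ∀ u, ι (s u) = S u)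
    {u : ℝ → V} (hu : ContDiff ℝ 1 u) {b : ℝ} (hb : 0 < b) :
    ∃ w : ℝ → X, ContDiffOn ℝ 1 w (Icc 0 b) ∧ (∀ t, ι (w t) = S (u t)) ∧
      ∀ t ∈ Icc 0 b, ι (derivWithin w (Icc 0 b) t) = S (deriv u t) := by
  obtain ⟨L, hL⟩ := exists_lift_of_injective X ι hι S s hs
  refine ⟨fun t => L (u t), (L.contDiff.comp hu).contDiffOn, fun t => (congrArg ι (hL _)).trans (hs _), ?_⟩
  intro t ht
  have h : derivWithin (fun t => L (u t)) (Icc 0 b) t = L (deriv u t) :=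
    (L.hasFDerivAt.comp_hasDerivAt t
      (hu.differentiable one_ne_zero t).hasDerivAt).hasDerivWithinAt.derivWithin
      (uniqueDiffOn_Icc hb t ht)
  rw [h, hL, hs]

/-- A bounded operator on `H¹_{0,σ}` with values in the test fields maps `C¹` curves in `H¹_{0,σ}`
to `C¹` curves in `H² ∩ H¹_{0,σ}`. -/
theorem exists_contDiffOn_H2sol (hΩ : IsOpen Ω) (S : H10sol Ω →L[ℝ] H10sol Ω)
    (S' : H10sol Ω → SolTestField Ω) (hS : ∀ u, solToH (S' u) = S u) {u : ℝ → H10sol Ω}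
    (hu : ContDiff ℝ 1 u) {b : ℝ} (hb : 0 < b) :
    ∃ w : ℝ → H2sol Ω, ContDiffOn ℝ 1 w (Icc 0 b) ∧ (∀ t, toH10solL Ω (w t) = S (u t)) ∧
      ∀ t ∈ Icc 0 b, toH10solL Ω (derivWithin w (Icc 0 b) t) = S (deriv u t) :=
  exists_contDiffOn_lift_of_injective (V := H10sol Ω) (Y := H10sol Ω) (H2sol Ω) (toH10solL Ω)
    (injective_toH10solL hΩ) S (fun u => solToH2 (S' u)) hS hu hb

/-- The relative energy inequality against spatially smoothed `C¹` curves in `H¹_{0,σ}`. -/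
theorem IsDissipativeSolution.rel_energy_smoothing (hΩ : IsOpen Ω) {T ν κ s : ℝ} {r : ℝ≥0∞}
    {f : ℝ → Hneg1 Ω} {v₀ : L2 Ω (Space d)} {v : ℝ → H10sol Ω}
    (hv : IsDissipativeSolution T ν κ s r f v₀ v) (hT : 0 < T) (S : H10sol Ω →L[ℝ] H10sol Ω)
    (S' : H10sol Ω → SolTestField Ω) (hS : ∀ u, solToH (S' u) = S u) {u : ℝ → H10sol Ω}
    (hu : ContDiff ℝ 1 u) (hr : MemLsLr T s r fun t => S (u t)) :
    ∀ᵐ t ∂(timeMeasure T), relEnergy (val (v t)) (val (S (u t)))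
        + ∫ σ in (0 : ℝ)..t, (relDiss ν (v σ) (S (u σ))
              + solOp ν (f σ) (S (u σ)) (S (deriv u σ)) (v σ - S (u σ)))
            * Real.exp (∫ τ in σ..t, regMeasure κ s r (S (u τ)))
      ≤ relEnergy v₀ (val (S (u 0)))
          * Real.exp (∫ τ in (0 : ℝ)..t, regMeasure κ s r (S (u τ))) := by
  obtain ⟨w, h1, h2, h3⟩ := exists_contDiffOn_H2sol hΩ S S' hS hu hT
  simp only [toH10solL_apply] at h2 h3
  have hw := hv.rel_energy w h1 (by simpa only [MemLsLr, h2] using hr)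
  simp only [h2] at hw
  filter_upwards [hw, ae_restrict_mem measurableSet_Ioo] with t ht htT
  convert ht using 2
  refine intervalIntegral.integral_congr fun σ hσ => ?_
  rw [uIcc_of_le htT.1.le] at hσ
  have h4 := h3 σ ⟨hσ.1, hσ.2.trans htT.2.le⟩
  simp only [h4]

end SecondOrder

/-! ### Convergence of integrals -/

section Limits

variable {α : Type*} [MeasurableSpace α] {μ : Measure α}

theorem eLpNorm_two_sq {E : Type*} [NormedAddCommGroup E] (f : α → E) :
    eLpNorm f 2 μ ^ 2 = ∫⁻ x, ‖f x‖ₑ ^ 2 ∂μ := by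
  have h := eLpNorm_nnreal_pow_eq_lintegral (f := f) (μ := μ) (p := 2) two_ne_zero
  simpa using h

theorem enorm_sq_parallelogram {E : Type*} [NormedAddCommGroup E] [InnerProductSpace ℝ E]
    (a b : E) : ‖a - b‖ₑ ^ 2 + ‖a + b‖ₑ ^ 2 = 2 * ‖a‖ₑ ^ 2 + 2 * ‖b‖ₑ ^ 2 := by
  have e : ∀ x : E, ‖x‖ₑ ^ 2 = ENNReal.ofReal (‖x‖ ^ 2) := fun x => by
    rw [← ofReal_norm, ENNReal.ofReal_pow (norm_nonneg x)]
  have h2 : (2 : ℝ≥0∞) = ENNReal.ofReal 2 := by simp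
  rw [e, e, e, e, h2, ← ENNReal.ofReal_mul (by norm_num), ← ENNReal.ofReal_mul (by norm_num),
    ← ENNReal.ofReal_add (by positivity) (by positivity),
    ← ENNReal.ofReal_add (by positivity) (by positivity)]
  congr 1
  have := parallelogram_law_with_norm ℝ a b
  nlinarith

/-- A Radon-Riesz property of `L²`: the norm converges and the limit is attained in the sense of a
lower bound on the midpoints. -/
theorem tendsto_eLpNorm_sub_of_le_liminf {E : Type*} [NormedAddCommGroup E]
    [InnerProductSpace ℝ E] {q : α → E} {Q : ℕ → α → E} (hq : MemLp q 2 μ)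
    (hQ : ∀ k, AEStronglyMeasurable (Q k) μ)
    (h1 : ∀ᵐ x ∂μ, ‖q x + q x‖ₑ ^ 2 ≤ liminf (fun k => ‖Q k x + q x‖ₑ ^ 2) atTop)
    (h2 : ∀ ε : ℝ≥0∞, 0 < ε → ∀ᶠ k in atTop, ∫⁻ x, ‖Q k x‖ₑ ^ 2 ∂μ ≤ ∫⁻ x, ‖q x‖ₑ ^ 2 ∂μ + ε) :
    Tendsto (fun k => eLpNorm (Q k - q) 2 μ) atTop (𝓝 0) := by
  set I : ℝ≥0∞ := ∫⁻ x, ‖q x‖ₑ ^ 2 ∂μ with hI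
  have hItop : I ≠ ⊤ := by
    rw [hI, ← eLpNorm_two_sq]
    exact ENNReal.pow_ne_top hq.2.ne
  have hsum : ∀ k, ∫⁻ x, ‖Q k x - q x‖ₑ ^ 2 ∂μ + ∫⁻ x, ‖Q k x + q x‖ₑ ^ 2 ∂μ =
      2 * ∫⁻ x, ‖Q k x‖ₑ ^ 2 ∂μ + 2 * I := by
    intro k
    have m1 : AEMeasurable (fun x => ‖Q k x - q x‖ₑ ^ 2) μ :=
      ((hQ k).sub hq.1).enorm.pow_const 2
    have m2 : AEMeasurable (fun x => ‖Q k x‖ₑ ^ 2) μ := (hQ k).enorm.pow_const 2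
    rw [← lintegral_add_left' m1, hI, ← lintegral_const_mul'' _ m2,
      ← lintegral_const_mul' _ _ (by simp), ← lintegral_add_left' (m2.const_mul 2)]
    exact lintegral_congr fun x => enorm_sq_parallelogram _ _
  -- Fatou's lemma. With the parallelogram identity, `‖Q - q‖² = 2‖Q‖² + 2‖q‖² - ‖Q + q‖²` then has
  -- upper limit at most `4I - 4I`.
  have hlow : 4 * I ≤ liminf (fun k => ∫⁻ x, ‖Q k x + q x‖ₑ ^ 2 ∂μ) atTop := by
    have m : ∀ k, AEMeasurable (fun x => ‖Q k x + q x‖ₑ ^ 2) μ := fun k =>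
      ((hQ k).add hq.1).enorm.pow_const 2
    refine le_trans ?_ (lintegral_liminf_le' m)
    rw [hI, ← lintegral_const_mul' _ _ (by simp)]
    refine lintegral_mono_ae ?_
    filter_upwards [h1] with x hx
    refine le_trans (le_of_eq ?_) hx
    have := enorm_sq_parallelogram (q x) (q x)
    rw [sub_self, enorm_zero] at this
    rw [zero_pow two_ne_zero, zero_add] at this
    rw [this, ← two_mul, ← mul_assoc]
    norm_num
  have hX : Tendsto (fun k => ∫⁻ x, ‖Q k x - q x‖ₑ ^ 2 ∂μ) atTop (𝓝 0) := by
    rw [ENNReal.tendsto_nhds_zero]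
    intro ε hε
    -- The error `δ` appears twice through `2‖Q‖²` and once through the lower bound for `‖Q + q‖²`.
    obtain ⟨δ, hδ, hδε⟩ : ∃ δ : ℝ≥0∞, 0 < δ ∧ 3 * δ ≤ ε := by
      refine ⟨ε / 3, ENNReal.div_pos hε.ne' (by simp), ?_⟩
      rw [ENNReal.mul_div_cancel (by simp) (by simp)]
    by_cases hδt : δ = ⊤
    · filter_upwards with k
      rw [hδt] at hδε
      exact le_trans le_top (le_trans (by simp) hδε)
    have hev : ∀ᶠ k in atTop, 4 * I ≤ ∫⁻ x, ‖Q k x + q x‖ₑ ^ 2 ∂μ + δ := by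
      by_cases h0 : 4 * I = 0
      · filter_upwards with k
        rw [h0]
        exact zero_le
      · have hlt : 4 * I - δ < liminf (fun k => ∫⁻ x, ‖Q k x + q x‖ₑ ^ 2 ∂μ) atTop :=
          lt_of_lt_of_le (ENNReal.sub_lt_self (ENNReal.mul_ne_top (by simp) hItop) h0 hδ.ne') hlow
        filter_upwards [eventually_lt_of_lt_liminf hlt] with k hk
        exact tsub_le_iff_right.1 hk.le
    filter_upwards [hev, h2 δ hδ] with k hk1 hk2
    have h4 : ∫⁻ x, ‖Q k x - q x‖ₑ ^ 2 ∂μ + 4 * I ≤ 3 * δ + 4 * I := by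
      calc ∫⁻ x, ‖Q k x - q x‖ₑ ^ 2 ∂μ + 4 * I
          ≤ ∫⁻ x, ‖Q k x - q x‖ₑ ^ 2 ∂μ + (∫⁻ x, ‖Q k x + q x‖ₑ ^ 2 ∂μ + δ) := by gcongr
        _ = 2 * ∫⁻ x, ‖Q k x‖ₑ ^ 2 ∂μ + 2 * I + δ := by rw [← add_assoc, hsum]
        _ ≤ 2 * (I + δ) + 2 * I + δ := by gcongr
        _ = 3 * δ + 4 * I := by ring
    exact ((ENNReal.add_le_add_iff_right (ENNReal.mul_ne_top (by simp) hItop)).1 h4).trans hδε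
  have e : ∀ k, eLpNorm (Q k - q) 2 μ = (∫⁻ x, ‖Q k x - q x‖ₑ ^ 2 ∂μ) ^ (1 / 2 : ℝ) := by
    intro k
    have := eLpNorm_two_sq (μ := μ) (Q k - q)
    simp only [Pi.sub_apply] at this
    rw [← this, ← ENNReal.rpow_natCast, ← ENNReal.rpow_mul]
    norm_num
  simp only [e]
  have := hX.ennrpow_const (1 / 2 : ℝ)
  rwa [ENNReal.zero_rpow_of_pos (by norm_num)] at this

theorem eLpNorm_inner_le {E : Type*} [NormedAddCommGroup E] [InnerProductSpace ℝ E] {f g : α → E}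
    (hf : AEStronglyMeasurable f μ) (hg : AEStronglyMeasurable g μ) :
    eLpNorm (fun x => inner ℝ (f x) (g x)) 1 μ ≤ eLpNorm f 2 μ * eLpNorm g 2 μ := by
  have := eLpNorm_le_eLpNorm_mul_eLpNorm'_of_norm (p := 2) (q := 2) (r := 1) hf hg
    (fun a b => inner ℝ a b) 1 (ae_of_all _ fun x => by
      rw [NNReal.coe_one, one_mul]
      exact norm_inner_le_norm _ _)
  simpa using this

theorem tendsto_eLpNorm_inner_sub {E : Type*} [NormedAddCommGroup E] [InnerProductSpace ℝ E]
    {f g : α → E} {F G : ℕ → α → E} (hf : MemLp f 2 μ) (hg : MemLp g 2 μ)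
    (hF : ∀ k, AEStronglyMeasurable (F k) μ) (hG : ∀ k, AEStronglyMeasurable (G k) μ)
    (h1 : Tendsto (fun k => eLpNorm (F k - f) 2 μ) atTop (𝓝 0))
    (h2 : Tendsto (fun k => eLpNorm (G k - g) 2 μ) atTop (𝓝 0)) :
    Tendsto (fun k => eLpNorm ((fun x => inner ℝ (F k x) (G k x)) - fun x => inner ℝ (f x) (g x))
      1 μ) atTop (𝓝 0) := by
  have hb : ∀ k, eLpNorm ((fun x => inner ℝ (F k x) (G k x)) - fun x => inner ℝ (f x) (g x))
      1 μ ≤ eLpNorm (F k - f) 2 μ * (eLpNorm (G k - g) 2 μ + eLpNorm g 2 μ) +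
        eLpNorm f 2 μ * eLpNorm (G k - g) 2 μ := by
    intro k
    have e : ((fun x => inner ℝ (F k x) (G k x)) - fun x => inner ℝ (f x) (g x)) =
        (fun x => inner ℝ ((F k - f) x) (G k x)) + fun x => inner ℝ (f x) ((G k - g) x) := by
      funext x
      simp only [Pi.sub_apply, Pi.add_apply, inner_sub_left, inner_sub_right]
      ring
    rw [e]
    refine (eLpNorm_add_le (((hF k).sub hf.1).inner (hG k)) (hf.1.inner ((hG k).sub hg.1))
      le_rfl).trans ?_
    have hGk : eLpNorm (G k) 2 μ ≤ eLpNorm (G k - g) 2 μ + eLpNorm g 2 μ := by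
      have := eLpNorm_add_le ((hG k).sub hg.1) hg.1 (p := 2) (by norm_num)
      rwa [sub_add_cancel] at this
    refine add_le_add ((eLpNorm_inner_le ((hF k).sub hf.1) (hG k)).trans ?_)
      (eLpNorm_inner_le hf.1 ((hG k).sub hg.1))
    gcongr
  refine tendsto_of_tendsto_of_tendsto_of_le_of_le tendsto_const_nhds ?_
    (fun _ => zero_le) hb
  have h3 : Tendsto (fun k => eLpNorm (F k - f) 2 μ * (eLpNorm (G k - g) 2 μ + eLpNorm g 2 μ) +
        eLpNorm f 2 μ * eLpNorm (G k - g) 2 μ) atTop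
      (𝓝 (0 * (0 + eLpNorm g 2 μ) + eLpNorm f 2 μ * 0)) := by
    refine (ENNReal.Tendsto.mul h1 (Or.inr ?_) (h2.add_const _) (Or.inr ?_)).add
      (ENNReal.Tendsto.const_mul h2 (Or.inr hf.2.ne))
    · rw [zero_add]
      exact hg.2.ne
    · simp
  simpa using h3

/-- Convergence in `L^p` gives a subsequence converging almost everywhere, and Fatou's lemma closes
the sublevel sets. No growth condition on `Ψ` is needed, so it applies to quadratic maps as well. -/
theorem lowerSemicontinuous_eLpNorm_comp {E F : Type*} [NormedAddCommGroup E]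
    [NormedAddCommGroup F] {p : ℝ≥0∞} [Fact (1 ≤ p)] (q : ℝ≥0∞) (Ψ : α → E → F)
    (hc : ∀ x, Continuous (Ψ x))
    (hm : ∀ u : Lp E p μ, AEStronglyMeasurable (fun x => Ψ x (u x)) μ) :
    LowerSemicontinuous fun u : Lp E p μ => eLpNorm (fun x => Ψ x (u x)) q μ := by
  rw [lowerSemicontinuous_iff_isClosed_preimage]
  intro C
  refine IsSeqClosed.isClosed fun u u₀ hu hlim => ?_
  have h1 : TendstoInMeasure μ (fun n => (u n : α → E)) atTop u₀ := tendstoInMeasure_of_tendsto_Lp hlim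
  obtain ⟨ns, -, hns⟩ := h1.exists_seq_tendsto_ae
  refine (Lp.eLpNorm_lim_le_liminf_eLpNorm (f := fun n x => Ψ x (u (ns n) x))
    (fun n => hm (u (ns n))) _ ?_).trans ?_
  · filter_upwards [hns] with x hx
    exact ((hc x).tendsto _).comp hx
  · refine liminf_le_of_frequently_le' (Frequently.of_forall fun n => ?_)
    exact hu (ns n)

/-- Convergence of exponentially weighted time integrals. -/
theorem tendsto_integral_mul_exp {b : ℝ} {a A : ℝ → ℝ} {aₙ Aₙ : ℕ → ℝ → ℝ}
    (ha : Integrable a (timeMeasure b)) (hA : Integrable A (timeMeasure b))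
    (han : ∀ n, Integrable (aₙ n) (timeMeasure b)) (hAn : ∀ n, Integrable (Aₙ n) (timeMeasure b))
    (hla : Tendsto (fun n => eLpNorm (aₙ n - a) 1 (timeMeasure b)) atTop (𝓝 0))
    (hlA : Tendsto (fun n => eLpNorm (Aₙ n - A) 1 (timeMeasure b)) atTop (𝓝 0))
    {t : ℝ} (ht : t ∈ Ioo 0 b) :
    Tendsto (fun n => ∫ σ in (0 : ℝ)..t, aₙ n σ * Real.exp (∫ τ in σ..t, Aₙ n τ)) atTop
      (𝓝 (∫ σ in (0 : ℝ)..t, a σ * Real.exp (∫ τ in σ..t, A τ))) ∧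
    Tendsto (fun n => ∫ τ in (0 : ℝ)..t, Aₙ n τ) atTop (𝓝 (∫ τ in (0 : ℝ)..t, A τ)) := by
  have hsub : Ioc 0 t ⊆ Ioo 0 b := fun x hx => ⟨hx.1, hx.2.trans_lt ht.2⟩
  have hμ : volume.restrict (Ioc 0 t) ≤ timeMeasure b := Measure.restrict_mono hsub le_rfl
  have hII : ∀ {h : ℝ → ℝ}, Integrable h (timeMeasure b) → ∀ σ ∈ Icc 0 t,
      IntervalIntegrable h volume σ t := by
    intro h hh σ hσ
    rw [intervalIntegrable_iff_integrableOn_Ioc_of_le hσ.2]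
    exact hh.mono_measure (Measure.restrict_mono ((Ioc_subset_Ioc_left hσ.1).trans hsub) le_rfl)
  -- The `L¹` distance of the rates controls the exponents uniformly in the lower limit `σ`.
  set δ : ℕ → ℝ := fun n => ∫ τ in Ioo 0 b, |Aₙ n τ - A τ| with hδ
  have hδ0 : Tendsto δ atTop (𝓝 0) := by
    have h1 : ∀ n, δ n = (eLpNorm (Aₙ n - A) 1 (timeMeasure b)).toReal := by
      intro n
      rw [eLpNorm_one_eq_lintegral_enorm, ← integral_toReal]
      · simp [hδ]
      · exact ((hAn n).1.sub hA.1).enorm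
      · exact ae_of_all _ fun x => by simp
    rw [funext h1]
    have h2 := (ENNReal.tendsto_toReal ENNReal.zero_ne_top).comp hlA
    rw [ENNReal.toReal_zero] at h2
    exact h2
  have hdiff : ∀ n, ∀ σ ∈ Icc 0 t, |(∫ τ in σ..t, Aₙ n τ) - ∫ τ in σ..t, A τ| ≤ δ n := by
    intro n σ hσ
    rw [← intervalIntegral.integral_sub (hII (hAn n) σ hσ) (hII hA σ hσ)]
    refine (intervalIntegral.abs_integral_le_integral_abs hσ.2).trans ?_
    rw [intervalIntegral.integral_of_le hσ.2]
    exact setIntegral_mono_set ((hAn n).sub hA).abs (ae_of_all _ fun x => abs_nonneg _)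
      (LE.le.eventuallyLE ((Ioc_subset_Ioc_left hσ.1).trans hsub))
  refine ⟨?_, ?_⟩
  swap
  · rw [tendsto_iff_norm_sub_tendsto_zero]
    exact squeeze_zero (fun _ => norm_nonneg _)
      (fun n => hdiff n 0 ⟨le_rfl, ht.1.le⟩) hδ0
  set M : ℝ := ∫ τ in Ioo 0 b, |A τ| with hM
  have hbd : ∀ σ ∈ Icc 0 t, |∫ τ in σ..t, A τ| ≤ M := by
    intro σ hσ
    refine (intervalIntegral.abs_integral_le_integral_abs hσ.2).trans ?_
    rw [intervalIntegral.integral_of_le hσ.2]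
    exact setIntegral_mono_set hA.abs (ae_of_all _ fun x => abs_nonneg _)
      (LE.le.eventuallyLE ((Ioc_subset_Ioc_left hσ.1).trans hsub))
  have hmeas : ∀ {h : ℝ → ℝ}, Integrable h (timeMeasure b) →
      AEStronglyMeasurable (fun σ => Real.exp (∫ τ in σ..t, h τ)) (volume.restrict (Ioc 0 t)) := by
    intro h hh
    have h1 : ContinuousOn (fun σ => ∫ τ in σ..t, h τ) (uIcc 0 t) := by
      refine intervalIntegral.continuousOn_primitive_interval_left ?_
      rw [uIcc_of_le ht.1.le, integrableOn_Icc_iff_integrableOn_Ioc]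
      exact hh.mono_measure hμ
    have h2 : ContinuousOn (fun σ => Real.exp (∫ τ in σ..t, h τ)) (Ioc 0 t) := by
      refine (Real.continuous_exp.comp_continuousOn h1).mono ?_
      rw [uIcc_of_le ht.1.le]
      exact Ioc_subset_Icc_self
    exact h2.aestronglyMeasurable measurableSet_Ioc
  have hexp : ∀ n, δ n ≤ 1 → ∀ σ ∈ Ioc 0 t,
      Real.exp (∫ τ in σ..t, Aₙ n τ) ≤ Real.exp (M + 1) := by
    intro n hn σ hσ
    have h1 := abs_le.1 (hdiff n σ ⟨hσ.1.le, hσ.2⟩)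
    have h2 := abs_le.1 (hbd σ ⟨hσ.1.le, hσ.2⟩)
    exact Real.exp_le_exp.2 (by linarith)
  have hexp0 : ∀ σ ∈ Ioc 0 t, Real.exp (∫ τ in σ..t, A τ) ≤ Real.exp M := by
    intro σ hσ
    exact Real.exp_le_exp.2 (abs_le.1 (hbd σ ⟨hσ.1.le, hσ.2⟩)).2
  have hexpd : ∀ n, δ n ≤ 1 → ∀ σ ∈ Ioc 0 t,
      |Real.exp (∫ τ in σ..t, Aₙ n τ) - Real.exp (∫ τ in σ..t, A τ)| ≤
        Real.exp M * (2 * δ n) := by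
    intro n hn σ hσ
    have h1 := hdiff n σ ⟨hσ.1.le, hσ.2⟩
    have e : Real.exp (∫ τ in σ..t, Aₙ n τ) - Real.exp (∫ τ in σ..t, A τ) =
        Real.exp (∫ τ in σ..t, A τ) *
          (Real.exp ((∫ τ in σ..t, Aₙ n τ) - ∫ τ in σ..t, A τ) - 1) := by
      rw [mul_sub, ← Real.exp_add]
      congr 2
      · ring
      · ring
    rw [e, abs_mul, abs_of_pos (Real.exp_pos _)]
    refine mul_le_mul (hexp0 σ hσ) ?_ (abs_nonneg _) (Real.exp_pos _).le
    exact (Real.abs_exp_sub_one_le (h1.trans hn)).trans (by linarith)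
  have hev : ∀ᶠ n in atTop, δ n ≤ 1 := hδ0.eventually_le_const (by norm_num)
  simp only [intervalIntegral.integral_of_le ht.1.le]
  have hprodmeas : ∀ {g h : ℝ → ℝ}, Integrable g (timeMeasure b) → Integrable h (timeMeasure b) →
      AEStronglyMeasurable (fun σ => g σ * Real.exp (∫ τ in σ..t, h τ))
        (volume.restrict (Ioc 0 t)) := fun hg hh => (hg.1.mono_measure hμ).mul (hmeas hh)
  refine tendsto_integral_of_L1' _ (hprodmeas ha hA) ?_ ?_
  · filter_upwards [hev] with n hn
    refine Integrable.mono' (((han n).mono_measure hμ).norm.mul_const (Real.exp (M + 1)))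
      (hprodmeas (han n) (hAn n)) ?_
    filter_upwards [ae_restrict_mem measurableSet_Ioc] with σ hσ
    rw [norm_mul, Real.norm_of_nonneg (Real.exp_pos _).le]
    exact mul_le_mul_of_nonneg_left (hexp n hn σ hσ) (norm_nonneg _)
  · have hb : ∀ᶠ n in atTop, eLpNorm ((fun σ => aₙ n σ * Real.exp (∫ τ in σ..t, Aₙ n τ)) -
        fun σ => a σ * Real.exp (∫ τ in σ..t, A τ)) 1 (volume.restrict (Ioc 0 t)) ≤
        ENNReal.ofReal (Real.exp (M + 1)) * eLpNorm (aₙ n - a) 1 (timeMeasure b) +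
        ENNReal.ofReal (Real.exp M * (2 * δ n)) * eLpNorm a 1 (timeMeasure b) := by
      filter_upwards [hev] with n hn
      -- Change the integrand under the perturbed weight, which is bounded by `exp (M + 1)` once `δ
      -- n ≤ 1`, and the weight under the limit integrand, where `|exp x - 1| ≤ 2|x|` applies.
      have e : ((fun σ => aₙ n σ * Real.exp (∫ τ in σ..t, Aₙ n τ)) -
          fun σ => a σ * Real.exp (∫ τ in σ..t, A τ)) =
          (fun σ => (aₙ n - a) σ * Real.exp (∫ τ in σ..t, Aₙ n τ)) +
          fun σ => a σ * (Real.exp (∫ τ in σ..t, Aₙ n τ) - Real.exp (∫ τ in σ..t, A τ)) := by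
        funext σ
        simp only [Pi.sub_apply, Pi.add_apply]
        ring
      rw [e]
      refine (eLpNorm_add_le (hprodmeas ((han n).sub ha) (hAn n))
        ((ha.1.mono_measure hμ).mul ((hmeas (hAn n)).sub (hmeas hA))) le_rfl).trans ?_
      refine add_le_add ((eLpNorm_le_mul_eLpNorm_of_ae_le_mul (c := Real.exp (M + 1)) (g := aₙ n - a)
        ?_ 1).trans ?_) ((eLpNorm_le_mul_eLpNorm_of_ae_le_mul (c := Real.exp M * (2 * δ n)) (g := a)
        ?_ 1).trans ?_)
      · filter_upwards [ae_restrict_mem measurableSet_Ioc] with σ hσ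
        rw [norm_mul, Real.norm_of_nonneg (Real.exp_pos _).le, mul_comm]
        exact mul_le_mul_of_nonneg_right (hexp n hn σ hσ) (norm_nonneg _)
      · gcongr
      · filter_upwards [ae_restrict_mem measurableSet_Ioc] with σ hσ
        rw [Pi.mul_apply, norm_mul, mul_comm]
        exact mul_le_mul_of_nonneg_right (hexpd n hn σ hσ) (norm_nonneg _)
      · gcongr
    refine tendsto_of_tendsto_of_tendsto_of_le_of_le' tendsto_const_nhds ?_
      (Eventually.of_forall fun _ => zero_le) hb
    have ha1 : eLpNorm a 1 (timeMeasure b) ≠ ⊤ := (memLp_one_iff_integrable.2 ha).2.ne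
    have h5 : Tendsto (fun n => ENNReal.ofReal (Real.exp M * (2 * δ n))) atTop (𝓝 0) := by
      have : Tendsto (fun n => Real.exp M * (2 * δ n)) atTop (𝓝 (Real.exp M * (2 * 0))) :=
        (hδ0.const_mul 2).const_mul _
      have := ENNReal.tendsto_ofReal this
      simpa using this
    have h6 := (ENNReal.Tendsto.const_mul (a := ENNReal.ofReal (Real.exp (M + 1))) hla
      (Or.inr ENNReal.ofReal_ne_top)).add (ENNReal.Tendsto.mul_const h5 (Or.inr ha1))
    simpa using h6

end Limits

/-! ### The tensor `u ⊗ u` and the convective form -/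

section Tensor

variable {d : ℕ} {Ω : Set (Space d)}

/-- The tensor product `b ⊗ a`. -/
def outer (b a : Space d) : Mat d := WithLp.toLp 2 fun p => b p.1 * a p.2

theorem outer_apply (b a : Space d) (i j : Fin d) : outer b a (i, j) = b i * a j := rfl

theorem norm_outer (b a : Space d) : ‖outer b a‖ = ‖b‖ * ‖a‖ := by
  have h : ‖outer b a‖ ^ 2 = (‖b‖ * ‖a‖) ^ 2 := by
    rw [mul_pow, EuclideanSpace.norm_sq_eq, EuclideanSpace.norm_sq_eq, EuclideanSpace.norm_sq_eq,
      Fintype.sum_prod_type, Finset.sum_mul_sum]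
    refine Finset.sum_congr rfl fun i _ => Finset.sum_congr rfl fun j _ => ?_
    rw [outer_apply, norm_mul, mul_pow]
  exact (pow_left_inj₀ (norm_nonneg _) (by positivity) two_ne_zero).1 h

theorem inner_outer (G : Mat d) (b a : Space d) :
    inner ℝ G (outer b a) = ∑ i, ∑ j, a j * G (i, j) * b i := by
  rw [PiLp.inner_apply, Fintype.sum_prod_type]
  refine Finset.sum_congr rfl fun i _ => Finset.sum_congr rfl fun j _ => ?_
  rw [outer_apply]
  simp only [RCLike.inner_apply, conj_trivial]
  ring

/-- The tensor product as a bounded bilinear map. -/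
noncomputable def outerL (d : ℕ) : Space d →L[ℝ] Space d →L[ℝ] Mat d :=
  LinearMap.mkContinuous₂
    (LinearMap.mk₂ ℝ outer
      (fun a b c => by ext p; simp [outer, add_mul])
      (fun r a b => by ext p; simp [outer, mul_assoc])
      (fun a b c => by ext p; simp [outer, mul_add])
      (fun r a b => by ext p; simp [outer, mul_left_comm])) 1
    (fun b a => by rw [one_mul]; exact (norm_outer b a).le)

theorem outerL_apply (b a : Space d) : outerL d b a = outer b a := rfl

theorem continuous_outer_self : Continuous fun x : Space d => outer x x := by
  simp only [← outerL_apply]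
  fun_prop

theorem conv_eq_integral_inner (a b : L2 Ω (Space d)) (G : L2 Ω (Mat d)) :
    conv a G b = ∫ x in Ω, inner ℝ (G x) (outer (b x) (a x)) := by
  simp only [inner_outer]
  rfl

theorem memLp_top_of_continuous {F : Type} [NormedAddCommGroup F] {g : Space d → F}
    (hg : Continuous g) (hs : HasCompactSupport g) : MemLp g ⊤ (volume.restrict Ω) :=
  hg.memLp_of_hasCompactSupport hs

/-- For a bounded test field, `outer (φ x) (a x)` is a Hölder product of `L^∞` and `L²` with values
in `L²`, so the trilinear form is continuous in the two remaining arguments. -/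
theorem conv_eq_inner_right (a : L2 Ω (Space d)) (G : L2 Ω (Mat d)) (φ : TestField Ω) :
    conv a G (toL2 φ) = inner ℝ G ((outerL d).holder 2
      ((memLp_top_of_continuous φ.2.1.continuous φ.2.2.1).toLp (μ := volume.restrict Ω)) a) := by
  rw [conv_eq_integral_inner, L2.inner_def]
  refine integral_congr_ae ?_
  filter_upwards [(outerL d).coeFn_holder (r := 2) ((memLp_top_of_continuous φ.2.1.continuous
    φ.2.2.1).toLp (μ := volume.restrict Ω)) a, (memLp_testField φ).coeFn_toLp,
    (memLp_top_of_continuous φ.2.1.continuous φ.2.2.1).coeFn_toLp (μ := volume.restrict Ω)]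
    with x h1 h2 h3
  rw [h1, h3, outerL_apply]
  change inner ℝ (G x) (outer (((memLp_testField φ).toLp φ.1) x) (a x)) = _
  rw [h2]

theorem conv_eq_inner_left (φ : TestField Ω) (G : L2 Ω (Mat d)) (b : L2 Ω (Space d)) :
    conv (toL2 φ) G b = inner ℝ G ((outerL d).flip.holder 2
      ((memLp_top_of_continuous φ.2.1.continuous φ.2.2.1).toLp (μ := volume.restrict Ω)) b) := by
  rw [conv_eq_integral_inner, L2.inner_def]
  refine integral_congr_ae ?_
  filter_upwards [(outerL d).flip.coeFn_holder (r := 2) ((memLp_top_of_continuous φ.2.1.continuous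
    φ.2.2.1).toLp (μ := volume.restrict Ω)) b, (memLp_testField φ).coeFn_toLp,
    (memLp_top_of_continuous φ.2.1.continuous φ.2.2.1).coeFn_toLp (μ := volume.restrict Ω)]
    with x h1 h2 h3
  rw [h1, h3, ContinuousLinearMap.flip_apply, outerL_apply]
  change inner ℝ (G x) (outer (b x) (((memLp_testField φ).toLp φ.1) x)) = _
  rw [h2]

/-- Contraction of `b ⊗ a` with a bounded matrix field is continuous on `L² × L²`. -/
theorem continuous_integral_inner_outer {M : Space d → Mat d} (hM : Continuous M)
    (hs : HasCompactSupport M) :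
    Continuous fun u : L2 Ω (Space d) => ∫ x in Ω, inner ℝ (M x) (outer (u x) (u x)) := by
  -- Matrix times vector: `M : (u ⊗ u) = u · M u` exhibits the integral as an `L²` inner product of
  -- `u` with a bounded operator applied to `u`.
  let B : Mat d →L[ℝ] Space d →L[ℝ] Space d :=
    LinearMap.mkContinuous₂
    (LinearMap.mk₂ ℝ (fun (G : Mat d) (a : Space d) =>
        (WithLp.toLp 2 fun i => ∑ j, G (i, j) * a j : Space d))
      (fun a b c => by ext p; simp [add_mul, Finset.sum_add_distrib])
      (fun r a b => by ext p; simp [mul_assoc, Finset.mul_sum])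
      (fun a b c => by ext p; simp [mul_add, Finset.sum_add_distrib])
      (fun r a b => by ext p; simp [mul_left_comm, Finset.mul_sum])) 1
    (fun G a => by
      rw [one_mul]
      refine le_of_sq_le_sq ?_ (by positivity)
      rw [mul_pow, EuclideanSpace.norm_sq_eq, EuclideanSpace.norm_sq_eq G, Fintype.sum_prod_type,
        Finset.sum_mul]
      refine Finset.sum_le_sum fun i _ => ?_
      rw [EuclideanSpace.norm_sq_eq a]
      simp only [LinearMap.mk₂_apply, Real.norm_eq_abs, sq_abs]
      exact Finset.sum_mul_sq_le_sq_mul_sq _ _ _)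
  have hB : ∀ (G : Mat d) (a : Space d), inner ℝ a (B G a) = inner ℝ G (outer a a) := by
    intro G a
    rw [inner_outer, PiLp.inner_apply]
    refine Finset.sum_congr rfl fun i _ => ?_
    change inner ℝ (a i) (∑ j, G (i, j) * a j) = _
    simp only [RCLike.inner_apply, conj_trivial, Finset.sum_mul]
    exact Finset.sum_congr rfl fun j _ => by ring
  have e : (fun u : L2 Ω (Space d) => ∫ x in Ω, inner ℝ (M x) (outer (u x) (u x))) =
      fun u => inner ℝ u (B.holderL (volume.restrict Ω) ⊤ 2 2
        ((memLp_top_of_continuous hM hs).toLp (μ := volume.restrict Ω)) u) := by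
    funext u
    rw [L2.inner_def]
    refine integral_congr_ae ?_
    filter_upwards [B.coeFn_holder (r := 2)
      ((memLp_top_of_continuous hM hs).toLp (μ := volume.restrict Ω)) u,
      (memLp_top_of_continuous hM hs).coeFn_toLp (μ := volume.restrict Ω)] with x h1 h2
    rw [ContinuousLinearMap.holderL_apply_apply, h1, h2, hB]
  rw [e]
  exact continuous_id.inner (ContinuousLinearMap.continuous _)

theorem contDiff_coord (φ : TestField Ω) (i : Fin d) : ContDiff ℝ ∞ fun x => φ.1 x i := by
  have h2 : ContDiff ℝ ∞ fun G : Space d => G i := contDiff_piLp_apply 2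
  exact h2.comp φ.2.1

theorem hasCompactSupport_coord (φ : TestField Ω) (i : Fin d) :
    HasCompactSupport fun x => φ.1 x i :=
  φ.2.2.1.comp_left (g := fun G : Space d => G i) rfl

theorem fderiv_coord (φ : TestField Ω) (i j : Fin d) (x : Space d) :
    fderiv ℝ (fun y => φ.1 y i) x (basisVec j) = grad φ.1 x (i, j) := by
  have h := ((EuclideanSpace.proj (𝕜 := ℝ) i : Space d →L[ℝ] ℝ).hasFDerivAt
    (x := φ.1 x)).comp x (differentiable_testField φ x).hasFDerivAt
  have e : fderiv ℝ (fun y => φ.1 y i) x = _ := h.fderiv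
  rw [e]
  rfl

/-- `∫ (φ · ∇)φ · ψ = - ∫ (φ · ∇)ψ · φ` for test fields with `div φ = 0`. -/
theorem integral_inner_outer_testField (φ ψ : SolTestField Ω) :
    ∫ x, inner ℝ (grad φ.1.1 x) (outer (ψ.1.1 x) (φ.1.1 x)) =
      - ∫ x, inner ℝ (grad ψ.1.1 x) (outer (φ.1.1 x) (φ.1.1 x)) := by
  have c := contDiff_coord φ.1
  have s := hasCompactSupport_coord φ.1
  have c' := contDiff_coord ψ.1
  have cg : ∀ i j, Continuous fun x => grad φ.1.1 x (i, j) := fun i j =>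
    (contDiff_grad_coord φ.1 i j).continuous
  have cg' : ∀ i j, Continuous fun x => grad ψ.1.1 x (i, j) := fun i j =>
    (contDiff_grad_coord ψ.1 i j).continuous
  -- Integration by parts entry by entry. The last term contains `∂_j φ_j`, which disappears only
  -- after summation over `j`.
  have key : ∀ i j, ∫ x, φ.1.1 x j * grad ψ.1.1 x (i, j) * φ.1.1 x i =
      - ∫ x, (φ.1.1 x j * grad φ.1.1 x (i, j) * ψ.1.1 x i +
        grad φ.1.1 x (j, j) * (φ.1.1 x i * ψ.1.1 x i)) := by
    intro i j
    have h := integral_mul_fderiv_eq_neg_fderiv_mul_of_integrable (μ := volume) (𝕜 := ℝ)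
      (f := fun x => φ.1.1 x j * φ.1.1 x i) (g := fun x => ψ.1.1 x i) (v := basisVec j)
      ?_ ?_ ?_ (fun x _ => ((c j).mul (c i)).differentiable (by simp) x)
      (fun x _ => (c' i).differentiable (by simp) x)
    · have e : ∀ x, fderiv ℝ (fun x => φ.1.1 x j * φ.1.1 x i) x (basisVec j) =
          φ.1.1 x j * grad φ.1.1 x (i, j) + φ.1.1 x i * grad φ.1.1 x (j, j) := by
        intro x
        rw [fderiv_fun_mul ((c j).differentiable (by simp) x) ((c i).differentiable (by simp) x)]
        rw [add_apply, smul_apply, smul_apply, fderiv_coord, fderiv_coord, smul_eq_mul,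
          smul_eq_mul]
      simp only [e, fderiv_coord] at h
      calc _ = ∫ x, φ.1.1 x j * φ.1.1 x i * grad ψ.1.1 x (i, j) := by
            refine integral_congr_ae (ae_of_all _ fun x => ?_)
            dsimp only
            ring
        _ = _ := h
        _ = _ := by
            congr 1
            refine integral_congr_ae (ae_of_all _ fun x => ?_)
            dsimp only
            ring
    · have hc : Continuous fun x => fderiv ℝ (fun x => φ.1.1 x j * φ.1.1 x i) x (basisVec j) :=
        (((c j).mul (c i)).continuous_fderiv (by simp)).clm_apply continuous_const
      exact (hc.mul (c' i).continuous).integrable_of_hasCompactSupport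
        (hasCompactSupport_coord ψ.1 i).mul_left
    · simp only [fderiv_coord]
      exact (((c j).continuous.mul (c i).continuous).mul (cg' i j)).integrable_of_hasCompactSupport
        ((s j).mul_right).mul_right
    · exact (((c j).continuous.mul (c i).continuous).mul
        (c' i).continuous).integrable_of_hasCompactSupport ((s j).mul_right).mul_right
  have i1 : ∀ i j, Integrable fun x => φ.1.1 x j * grad ψ.1.1 x (i, j) * φ.1.1 x i := fun i j =>
    (((c j).continuous.mul (cg' i j)).mul (c i).continuous).integrable_of_hasCompactSupport
      ((s j).mul_right).mul_right
  have i2 : ∀ i j, Integrable fun x => φ.1.1 x j * grad φ.1.1 x (i, j) * ψ.1.1 x i := fun i j =>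
    (((c j).continuous.mul (cg i j)).mul (c' i).continuous).integrable_of_hasCompactSupport
      ((s j).mul_right).mul_right
  have i3 : ∀ i j, Integrable fun x => grad φ.1.1 x (j, j) * (φ.1.1 x i * ψ.1.1 x i) := fun i j =>
    ((cg j j).mul ((c i).continuous.mul (c' i).continuous)).integrable_of_hasCompactSupport
      ((s i).mul_right).mul_left
  simp only [inner_outer]
  rw [integral_finsetSum _ fun i _ => integrable_finsetSum _ fun j _ => i2 i j,
    integral_finsetSum _ fun i _ => integrable_finsetSum _ fun j _ => i1 i j,
    ← Finset.sum_neg_distrib]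
  refine Finset.sum_congr rfl fun i _ => ?_
  rw [integral_finsetSum _ fun j _ => i2 i j, integral_finsetSum _ fun j _ => i1 i j]
  simp only [key, integral_add (i2 i _) (i3 i _), Finset.sum_neg_distrib, neg_neg,
    Finset.sum_add_distrib]
  have h0 : ∑ j, ∫ x, grad φ.1.1 x (j, j) * (φ.1.1 x i * ψ.1.1 x i) = 0 := by
    rw [← integral_finsetSum _ fun j _ => i3 i j]
    refine integral_eq_zero_of_ae (ae_of_all _ fun x => ?_)
    change ∑ j, grad φ.1.1 x (j, j) * (φ.1.1 x i * ψ.1.1 x i) = 0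
    rw [← Finset.sum_mul, φ.2 x, zero_mul]
  rw [h0, add_zero]

theorem grad_eq_zero_of_notMem (φ : TestField Ω) {x : Space d} (hx : x ∉ Ω) :
    grad φ.1 x = 0 := by
  have : fderiv ℝ φ.1 x = 0 := by
    by_contra hne
    exact hx (φ.2.2.2 (support_fderiv_subset ℝ hne))
  rw [grad_eq_gradL, this, map_zero]

theorem setIntegral_inner_grad (φ : TestField Ω) (g : Space d → Mat d) :
    ∫ x in Ω, inner ℝ (grad φ.1 x) (g x) = ∫ x, inner ℝ (grad φ.1 x) (g x) :=
  setIntegral_eq_integral_of_forall_compl_eq_zero fun x hx => by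
    rw [grad_eq_zero_of_notMem φ hx, inner_zero_left]

theorem conv_testField (φ ψ : SolTestField Ω) :
    conv (val (solToH φ)) (wgrad (solToH φ)) (toL2 ψ.1) =
      - ∫ x in Ω, inner ℝ (grad ψ.1.1 x) (outer (φ.1.1 x) (φ.1.1 x)) := by
  rw [setIntegral_inner_grad, ← integral_inner_outer_testField, conv_eq_integral_inner,
    ← setIntegral_inner_grad]
  refine integral_congr_ae ?_
  filter_upwards [coeFn_val_solToH φ, coeFn_wgrad_solToH φ, (memLp_testField ψ.1).coeFn_toLp]
    with x h1 h2 h3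
  rw [h1, h2]
  change inner ℝ _ (outer (((memLp_testField ψ.1).toLp ψ.1.1) x) _) = _
  rw [h3]

/-- Against a test field, the convective form is `- ∫ ∇ψ : v ⊗ v`. -/
theorem conv_toL2 (v : H10sol Ω) (ψ : SolTestField Ω) :
    conv (val v) (wgrad v) (toL2 ψ.1) =
      - ∫ x in Ω, inner ℝ (grad ψ.1.1 x) (outer (val v x) (val v x)) := by
  refine H10sol_induction (P := fun v => conv (val v) (wgrad v) (toL2 ψ.1) =
      - ∫ x in Ω, inner ℝ (grad ψ.1.1 x) (outer (val v x) (val v x))) ?_ (fun φ => ?_) v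
  · refine isClosed_eq ?_ ?_
    · simp only [conv_eq_inner_right]
      exact (wgradL Ω).continuous.inner (((outerL d).holderL (volume.restrict Ω) ⊤ 2 2
        _).continuous.comp (valL Ω).continuous)
    · exact ((continuous_integral_inner_outer (continuous_grad ψ.1)
        (hasCompactSupport_grad ψ.1)).comp (valL Ω).continuous).neg
  · rw [conv_testField]
    congr 1
    refine integral_congr_ae ?_
    filter_upwards [coeFn_val_solToH φ] with x h1
    rw [h1]

open Classical in
/-- The class of `u ⊗ u` in `L²`, for `u ∈ L⁴`. -/
noncomputable def tens (u : L2 Ω (Space d)) : L2 Ω (Mat d) :=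
  if h : MemLp (fun x => outer (u x) (u x)) 2 (volume.restrict Ω) then h.toLp else 0

theorem eLpNorm_outer_sq (u : Space d → Space d) :
    eLpNorm (fun x => outer (u x) (u x)) 2 (volume.restrict Ω) ^ 2 =
      eLpNorm u 4 (volume.restrict Ω) ^ 4 := by
  have h := eLpNorm_nnreal_pow_eq_lintegral (f := u) (μ := volume.restrict Ω) (p := 4) (by simp)
  have h' : eLpNorm u 4 (volume.restrict Ω) ^ 4 = ∫⁻ x in Ω, ‖u x‖ₑ ^ 4 := by simpa using h
  rw [eLpNorm_two_sq, h']
  refine lintegral_congr fun x => ?_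
  have : ‖outer (u x) (u x)‖ₑ = ‖u x‖ₑ * ‖u x‖ₑ := by
    rw [← ofReal_norm, norm_outer, ENNReal.ofReal_mul (norm_nonneg _), ofReal_norm]
  rw [this]
  ring

theorem memLp_outer {u : L2 Ω (Space d)} (hu : eLpNorm u 4 (volume.restrict Ω) < ⊤) :
    MemLp (fun x => outer (u x) (u x)) 2 (volume.restrict Ω) := by
  refine ⟨continuous_outer_self.comp_aestronglyMeasurable (Lp.aestronglyMeasurable u), ?_⟩
  have h := eLpNorm_outer_sq (Ω := Ω) u
  by_contra hne
  rw [not_lt, top_le_iff] at hne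
  rw [hne] at h
  have h2 : eLpNorm u 4 (volume.restrict Ω) ^ 4 < ⊤ := ENNReal.pow_lt_top hu
  rw [← h] at h2
  simp at h2

theorem coeFn_tens {u : L2 Ω (Space d)} (hu : eLpNorm u 4 (volume.restrict Ω) < ⊤) :
    tens u =ᵐ[volume.restrict Ω] fun x => outer (u x) (u x) := by
  rw [tens, dif_pos (memLp_outer hu)]
  exact MemLp.coeFn_toLp _

theorem enorm_tens_sq {u : L2 Ω (Space d)} (hu : eLpNorm u 4 (volume.restrict Ω) < ⊤) :
    ‖tens u‖ₑ ^ 2 = eLpNorm u 4 (volume.restrict Ω) ^ 4 := by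
  rw [← eLpNorm_outer_sq, Lp.enorm_def, eLpNorm_congr_ae (coeFn_tens hu)]

theorem conv_toL2_eq_inner_tens {v : H10sol Ω} (hv : eLpNorm (val v) 4 (volume.restrict Ω) < ⊤)
    (ψ : SolTestField Ω) :
    conv (val v) (wgrad v) (toL2 ψ.1) = - inner ℝ (tens (val v)) (wgrad (solToH ψ)) := by
  rw [conv_toL2, real_inner_comm, L2.inner_def]
  congr 1
  refine integral_congr_ae ?_
  filter_upwards [coeFn_tens hv, coeFn_wgrad_solToH ψ] with x h1 h2
  rw [h1, h2]

theorem eLpNorm_val_solToH_lt_top (φ : SolTestField Ω) (p : ℝ≥0∞) :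
    eLpNorm (val (solToH φ)) p (volume.restrict Ω) < ⊤ := by
  rw [eLpNorm_congr_ae (coeFn_val_solToH φ)]
  exact (φ.1.2.1.continuous.memLp_of_hasCompactSupport φ.1.2.2.1).2

/-- With a test field as transporting and transported field both sides are continuous in `z`, so the
identity extends from test fields `z`. This rewrites the convective term as the pairing of `∇z` with
an `L²` tensor. -/
theorem conv_solToH (φ : SolTestField Ω) (z : H10sol Ω) :
    conv (val (solToH φ)) (wgrad (solToH φ)) (val z) =
      - inner ℝ (tens (val (solToH φ))) (wgrad z) := by
  refine H10sol_induction (P := fun z => conv (val (solToH φ)) (wgrad (solToH φ)) (val z) =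
      - inner ℝ (tens (val (solToH φ))) (wgrad z)) ?_ (fun ψ => ?_) z
  · refine isClosed_eq ?_ ?_
    · simp only [val_solToH φ, conv_eq_inner_left]
      exact continuous_const.inner (((outerL d).flip.holderL (volume.restrict Ω) ⊤ 2 2
        _).continuous.comp (valL Ω).continuous)
    · exact (continuous_const.inner (wgradL Ω).continuous).neg
  · rw [val_solToH ψ]
    exact conv_toL2_eq_inner_tens (eLpNorm_val_solToH_lt_top φ 4) ψ

/-! ### Measurability in time -/

theorem lowerSemicontinuous_eLpNorm {F : Type} [NormedAddCommGroup F] (p : ℝ≥0∞) :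
    LowerSemicontinuous fun u : L2 Ω F => eLpNorm u p (volume.restrict Ω) :=
  lowerSemicontinuous_eLpNorm_comp p (fun _ x => x) (fun _ => continuous_id)
    fun u => Lp.aestronglyMeasurable u

theorem aemeasurable_eLpNorm {α : Type*} [MeasurableSpace α] {μ : Measure α} {F : Type}
    [NormedAddCommGroup F] (p : ℝ≥0∞) {v : α → L2 Ω F} (hv : AEStronglyMeasurable v μ) :
    AEMeasurable (fun t => eLpNorm (v t) p (volume.restrict Ω)) μ := by
  borelize ↥(L2 Ω F)
  exact (lowerSemicontinuous_eLpNorm p).measurable.comp_aemeasurable hv.aemeasurable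

/-- Smooth truncations of `x ↦ x ⊗ x`. -/
theorem exists_truncated_outer (d : ℕ) : ∃ g : ℕ → Space d → Mat d,
    (∀ n, ∃ C, LipschitzWith C (g n)) ∧ (∀ n, g n 0 = 0) ∧
    (∀ n x, ‖g n x‖ ≤ ‖outer x x‖) ∧ ∀ x, ∀ᶠ n in atTop, g n x = outer x x := by
  let η : ℕ → ContDiffBump (0 : Space d) := fun n =>
    ⟨(n : ℝ) + 1, (n : ℝ) + 2, by positivity, by linarith⟩
  have hc : ContDiff ℝ 1 fun x : Space d => outer x x := by
    simp only [← outerL_apply]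
    exact (outerL d).contDiff.clm_apply contDiff_id
  refine ⟨fun n x => η n x • outer x x, fun n => ?_, fun n => ?_, fun n x => ?_, fun x => ?_⟩
  · exact ContDiff.lipschitzWith_of_hasCompactSupport ((η n).hasCompactSupport.smul_right)
      ((η n).contDiff.smul hc) one_ne_zero
  · have : outer (0 : Space d) 0 = 0 := by
      rw [← norm_eq_zero, norm_outer, norm_zero, zero_mul]
    simp only [this, smul_zero]
  · rw [norm_smul, Real.norm_of_nonneg (η n).nonneg]
    exact mul_le_of_le_one_left (norm_nonneg _) (η n).le_one
  · filter_upwards [eventually_ge_atTop ⌈‖x‖⌉₊] with n hn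
    have h1 : ‖x‖ ≤ n := (Nat.le_ceil _).trans (by exact_mod_cast hn)
    have : η n x = 1 := (η n).one_of_mem_closedBall (by
      rw [mem_closedBall_zero_iff]
      change ‖x‖ ≤ (n : ℝ) + 1
      linarith)
    rw [this, one_smul]

/-- The map `u ↦ u ⊗ u` is not continuous from `L²` to `L²`. It is the limit, for each `u` in `L⁴`,
of compositions with Lipschitz truncations, which are continuous on `L²`. -/
theorem aestronglyMeasurable_tens {α : Type*} [MeasurableSpace α] {μ : Measure α}
    {v : α → L2 Ω (Space d)} (hv : AEStronglyMeasurable v μ)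
    (h4 : ∀ᵐ t ∂μ, eLpNorm (v t) 4 (volume.restrict Ω) < ⊤) :
    AEStronglyMeasurable (fun t => tens (v t)) μ := by
  obtain ⟨g, hg1, hg2, hg3, hg4⟩ := exists_truncated_outer d
  choose C hC using hg1
  refine aestronglyMeasurable_of_tendsto_ae atTop
    (f := fun n t => (hC n).compLp (hg2 n) (v t)) (fun n => ?_) ?_
  · exact ((hC n).continuous_compLp (hg2 n)).comp_aestronglyMeasurable hv
  · filter_upwards [h4] with t ht
    rw [Lp.tendsto_Lp_iff_tendsto_eLpNorm']
    have hae : ∀ n, (((hC n).compLp (hg2 n) (v t) : L2 Ω (Mat d)) : Space d → Mat d) - ⇑(tens (v t))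
        =ᵐ[volume.restrict Ω] fun x => g n (v t x) - outer (v t x) (v t x) := by
      intro n
      filter_upwards [(hC n).coeFn_compLp (hg2 n) (v t), coeFn_tens ht] with x h1 h2
      rw [Pi.sub_apply, h1, h2]
      rfl
    have hm := memLp_outer ht
    have h0 : Tendsto (fun n => ∫⁻ x in Ω, ‖g n (v t x) - outer (v t x) (v t x)‖ₑ ^ 2) atTop
        (𝓝 (∫⁻ x in Ω, 0)) := by
      refine tendsto_lintegral_of_dominated_convergence'
        (fun x => (2 * ‖outer (v t x) (v t x)‖ₑ) ^ 2) (fun n => ?_) (fun n => ?_) ?_ ?_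
      · exact (((hC n).continuous.comp_aestronglyMeasurable
          (Lp.aestronglyMeasurable _)).sub hm.1).enorm.pow_const 2
      · refine ae_of_all _ fun x => ?_
        have h1 : ‖g n (v t x)‖ₑ ≤ ‖outer (v t x) (v t x)‖ₑ := by
          rw [← ofReal_norm, ← ofReal_norm]
          exact ENNReal.ofReal_le_ofReal (hg3 n _)
        have : ‖g n (v t x) - outer (v t x) (v t x)‖ₑ ≤ 2 * ‖outer (v t x) (v t x)‖ₑ := by
          refine (enorm_sub_le).trans ?_
          rw [two_mul]
          gcongr
        exact pow_le_pow_left' this 2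
      · simp only [mul_pow]
        rw [lintegral_const_mul' _ _ (by simp), ← eLpNorm_two_sq]
        exact ENNReal.mul_ne_top (by simp) (ENNReal.pow_ne_top hm.2.ne)
      · refine ae_of_all _ fun x => ?_
        refine tendsto_const_nhds.congr' ?_
        filter_upwards [hg4 (v t x)] with n hn
        rw [hn, sub_self, enorm_zero]
        simp
    rw [lintegral_zero] at h0
    have e : ∀ n, eLpNorm ((((hC n).compLp (hg2 n) (v t) : L2 Ω (Mat d)) : Space d → Mat d) -
        ⇑(tens (v t))) 2 (volume.restrict Ω) =
        (∫⁻ x in Ω, ‖g n (v t x) - outer (v t x) (v t x)‖ₑ ^ 2) ^ (1 / 2 : ℝ) := by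
      intro n
      rw [eLpNorm_congr_ae (hae n), ← eLpNorm_two_sq, ← ENNReal.rpow_natCast, ← ENNReal.rpow_mul]
      norm_num
    simp only [e]
    have := h0.ennrpow_const (1 / 2 : ℝ)
    rwa [ENNReal.zero_rpow_of_pos (by norm_num)] at this

end Tensor

/-! ### Sobolev, Poincaré and Ladyzhenskaya inequalities -/

section Sobolev

variable {d : ℕ} {Ω : Set (Space d)}

theorem eLpNorm_testField (φ : SolTestField Ω) (p : ℝ≥0∞) :
    eLpNorm φ.1.1 p volume = eLpNorm (val (solToH φ)) p (volume.restrict Ω) := by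
  rw [eLpNorm_congr_ae (coeFn_val_solToH φ)]
  exact (eLpNorm_restrict_eq_of_support_subset ((subset_tsupport _).trans φ.1.2.2.2)).symm

theorem exists_eLpNorm_fderiv_testField_le (Ω : Set (Space d)) :
    ∃ K : ℝ≥0∞, K ≠ ⊤ ∧ ∀ (φ : SolTestField Ω) (p : ℝ≥0∞),
      eLpNorm (fderiv ℝ φ.1.1) p volume ≤
        K * eLpNorm (wgrad (solToH φ)) p (volume.restrict Ω) := by
  obtain ⟨K, -, hK⟩ := exists_norm_le_gradL d
  refine ⟨ENNReal.ofReal K, ENNReal.ofReal_ne_top, fun φ p => ?_⟩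
  have hsupp : Function.support (grad φ.1.1) ⊆ Ω := fun x hx => by
    by_contra hne
    exact hx (grad_eq_zero_of_notMem φ.1 hne)
  rw [eLpNorm_congr_ae (coeFn_wgrad_solToH φ), eLpNorm_restrict_eq_of_support_subset hsupp]
  exact eLpNorm_le_mul_eLpNorm_of_ae_le_mul (ae_of_all _ fun x => (hK _).1) p

/-- A lower semicontinuous function bounded by a continuous one on test fields is so everywhere. -/
theorem le_of_forall_solToH {f g : H10sol Ω → ℝ≥0∞} (hf : LowerSemicontinuous f)
    (hg : Continuous g) (h : ∀ φ : SolTestField Ω, f (solToH φ) ≤ g (solToH φ)) (u : H10sol Ω) :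
    f u ≤ g u := by
  refine H10sol_induction (P := fun u => f u ≤ g u) ?_ h u
  exact (lowerSemicontinuous_iff_isClosed_epigraph.1 hf).preimage (continuous_id.prodMk hg)

theorem lowerSemicontinuous_eLpNorm_val (p : ℝ≥0∞) :
    LowerSemicontinuous fun u : H10sol Ω => eLpNorm (val u) p (volume.restrict Ω) :=
  (lowerSemicontinuous_eLpNorm (Ω := Ω) (F := Space d) p).comp (valL Ω).continuous

theorem continuous_enorm_wgrad : Continuous fun u : H10sol Ω => ‖wgrad u‖ₑ :=
  (wgradL Ω).continuous.enorm

theorem finrank_space : Module.finrank ℝ (Space d) = d := by simp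

/-- Sobolev's inequality for test fields, extended by lower semicontinuity of the left side. The
bound `p ≤ 2` lets the finite measure of `Ω` convert the `L^p` norm of the gradient to its `L²`
norm. -/
theorem exists_eLpNorm_val_le (hΩ : Bornology.IsBounded Ω) {p q : NNReal}
    (hp : 1 ≤ p) (hp2 : p ≤ 2) (hpd : p < d) (hpq : (p : ℝ)⁻¹ - (d : ℝ)⁻¹ ≤ (q : ℝ)⁻¹) :
    ∃ C : ℝ≥0∞, C ≠ ⊤ ∧ ∀ u : H10sol Ω,
      eLpNorm (val u) q (volume.restrict Ω) ≤ C * ‖wgrad u‖ₑ := by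
  obtain ⟨K, hK, hK'⟩ := exists_eLpNorm_fderiv_testField_le Ω
  set C₁ : ℝ≥0∞ := volume.restrict Ω univ ^ (1 / (p : ℝ) - 1 / 2) with hC₁
  have hfin : volume.restrict Ω univ ≠ ⊤ := by
    rw [Measure.restrict_apply_univ]
    exact hΩ.measure_lt_top.ne
  have hp0 : (0 : ℝ) < p := by
    have : (1 : ℝ) ≤ p := by exact_mod_cast hp
    linarith
  have hC₁t : C₁ ≠ ⊤ := by
    refine ENNReal.rpow_ne_top_of_nonneg ?_ hfin
    have : (p : ℝ) ≤ 2 := by exact_mod_cast hp2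
    rw [sub_nonneg]
    exact one_div_le_one_div_of_le hp0 this
  refine ⟨eLpNormLESNormFDerivOfLeConst (Space d) volume Ω p q * (K * C₁),
    ENNReal.mul_ne_top ENNReal.coe_ne_top (ENNReal.mul_ne_top hK hC₁t), fun u => ?_⟩
  refine le_of_forall_solToH (lowerSemicontinuous_eLpNorm_val q)
    (ENNReal.continuous_const_mul (ENNReal.mul_ne_top ENNReal.coe_ne_top
      (ENNReal.mul_ne_top hK hC₁t)) |>.comp continuous_enorm_wgrad) (fun φ => ?_) u
  rw [← eLpNorm_testField]
  refine (eLpNorm_le_eLpNorm_fderiv_of_le (μ := volume) (F := Space d) (s := Ω)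
    (φ.1.2.1.of_le (by simp)) ((subset_tsupport _).trans φ.1.2.2.2) hp
    (by rw [finrank_space]; exact hpd) (by rw [finrank_space]; exact hpq) hΩ).trans ?_
  change _ ≤ _ * _ * ‖wgrad (solToH φ)‖ₑ
  rw [mul_assoc, mul_assoc]
  gcongr
  refine (hK' φ p).trans ?_
  gcongr
  rw [mul_comm, Lp.enorm_def]
  have h2 : (p : ℝ≥0∞) ≤ 2 := by exact_mod_cast hp2
  have := eLpNorm_le_eLpNorm_mul_rpow_measure_univ h2
    (Lp.aestronglyMeasurable (wgrad (solToH φ)))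
  refine this.trans (le_of_eq ?_)
  rw [hC₁]
  norm_num

/-- Poincaré's inequality. -/
theorem exists_norm_le_wgrad (hΩ : Bornology.IsBounded Ω) (hd : 2 ≤ d) :
    ∃ C : ℝ, 0 < C ∧ ∀ u : H10sol Ω, ‖u‖ ≤ C * ‖wgrad u‖ := by
  have hd0 : (2 : ℝ) ≤ d := by exact_mod_cast hd
  -- The exponent whose Sobolev conjugate is `2`, that is `1/p - 1/d = 1/2`. Unlike `p = 2` it stays
  -- below `d` when `d = 2`, and it is at least one exactly when `d ≥ 2`.
  set p : NNReal := 2 * d / (d + 2) with hp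
  have hpr : (p : ℝ) = 2 * d / (d + 2) := by simp [hp]
  have h1 : 1 ≤ p := by
    rw [← NNReal.coe_le_coe, hpr, NNReal.coe_one, le_div_iff₀ (by linarith)]
    linarith
  have h2 : p ≤ 2 := by
    rw [← NNReal.coe_le_coe, hpr, div_le_iff₀ (by linarith)]
    push_cast
    nlinarith
  have h3 : p < d := by
    rw [← NNReal.coe_lt_coe, hpr, NNReal.coe_natCast, div_lt_iff₀ (by linarith)]
    nlinarith
  obtain ⟨C, hC, hC'⟩ := exists_eLpNorm_val_le (Ω := Ω) (q := 2) hΩ h1 h2 h3 (by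
    rw [hpr, inv_div]
    push_cast
    refine le_of_eq ?_
    field_simp
    ring)
  refine ⟨C.toReal + 1, by positivity, fun u => (norm_le_val_add_wgrad u).trans ?_⟩
  have h4 := hC' u
  have h5 : ‖val u‖ ≤ C.toReal * ‖wgrad u‖ := by
    have h6 : ‖val u‖ₑ ≤ C * ‖wgrad u‖ₑ := by
      rw [Lp.enorm_def (val u)]
      exact_mod_cast h4
    have := ENNReal.toReal_mono (ENNReal.mul_ne_top hC (by simp)) h6
    rwa [ENNReal.toReal_mul, toReal_enorm, toReal_enorm] at this
  linarith

/-- Ladyzhenskaya's inequality in two space dimensions. -/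
theorem exists_eLpNorm_four_le_two {Ω : Set (Space 2)} : ∃ C : ℝ≥0∞, C ≠ ⊤ ∧ ∀ u : H10sol Ω,
    eLpNorm (val u) 4 (volume.restrict Ω) ^ 4 ≤ C * (‖val u‖ₑ ^ 2 * ‖wgrad u‖ₑ ^ 2) := by
  obtain ⟨K, hK, hK'⟩ := exists_eLpNorm_fderiv_testField_le Ω
  set C₁ : ℝ≥0∞ := ENNReal.ofNNReal
    (eLpNormLESNormFDerivOneConst (volume : Measure (Space 2)) ((2 : NNReal) : ℝ)) with hC₁
  have hC : (C₁ * (2 * K)) ^ 2 ≠ ⊤ := by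
    refine ENNReal.pow_ne_top (ENNReal.mul_ne_top ENNReal.coe_ne_top (ENNReal.mul_ne_top ?_ hK))
    simp
  refine ⟨(C₁ * (2 * K)) ^ 2, hC, fun u => ?_⟩
  have hcont : Continuous fun u : H10sol Ω => ‖val u‖ₑ ^ 2 * ‖wgrad u‖ₑ ^ 2 := by
    have e : (fun u : H10sol Ω => ‖val u‖ₑ ^ 2 * ‖wgrad u‖ₑ ^ 2) =
        fun u => ENNReal.ofReal (‖val u‖ ^ 2 * ‖wgrad u‖ ^ 2) := by
      funext u
      rw [ENNReal.ofReal_mul (by positivity), ENNReal.ofReal_pow (norm_nonneg _),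
        ENNReal.ofReal_pow (norm_nonneg _), ofReal_norm, ofReal_norm]
    rw [e]
    exact ENNReal.continuous_ofReal.comp
      (((valL Ω).continuous.norm.pow 2).mul ((wgradL Ω).continuous.norm.pow 2))
  have hlsc : LowerSemicontinuous fun u : H10sol Ω =>
      eLpNorm (val u) 4 (volume.restrict Ω) ^ 4 :=
    Continuous.comp_lowerSemicontinuous (ENNReal.continuous_pow 4)
      (lowerSemicontinuous_eLpNorm_val 4) (fun a b h => pow_le_pow_left' h 4)
  refine le_of_forall_solToH hlsc ((ENNReal.continuous_const_mul hC).comp hcont) (fun φ => ?_) u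
  change _ ≤ _ * (_ * _)
  have hφd : ∀ x, HasFDerivAt φ.1.1 (fderiv ℝ φ.1.1 x) x := fun x =>
    (differentiable_testField φ.1 x).hasFDerivAt
  -- The embedding of `W^{1,1}` into `L²` of the plane, applied to `|φ|²`, whose gradient is at most
  -- `2 |φ| |∇φ|`.
  have hsm : ContDiff ℝ 1 fun x => ‖φ.1.1 x‖ ^ 2 := (φ.1.2.1.of_le (by simp)).norm_sq ℝ
  have hcs : HasCompactSupport fun x => ‖φ.1.1 x‖ ^ 2 :=
    φ.1.2.2.1.comp_left (g := fun y : Space 2 => ‖y‖ ^ 2) (by simp)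
  have hconj : NNReal.HolderConjugate (Module.finrank ℝ (Space 2)) 2 := by
    rw [finrank_space]
    rw [NNReal.holderConjugate_iff]
    constructor
    · norm_num
    · rw [← NNReal.coe_inj]
      push_cast
      norm_num
  have h1 := eLpNorm_le_eLpNorm_fderiv_one (μ := volume) hsm hcs hconj
  have h2 : eLpNorm (fderiv ℝ fun x => ‖φ.1.1 x‖ ^ 2) 1 volume ≤
      2 * eLpNorm φ.1.1 2 volume * eLpNorm (fderiv ℝ φ.1.1) 2 volume := by
    have hb : ∀ x, ‖fderiv ℝ (fun x => ‖φ.1.1 x‖ ^ 2) x‖ ≤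
        2 * (‖φ.1.1 x‖ * ‖fderiv ℝ φ.1.1 x‖) := by
      intro x
      have e : fderiv ℝ (fun x => ‖φ.1.1 x‖ ^ 2) x = _ := (hφd x).norm_sq.fderiv
      have h7 : ‖(innerSL ℝ (φ.1.1 x)).comp (fderiv ℝ φ.1.1 x)‖ ≤
          ‖φ.1.1 x‖ * ‖fderiv ℝ φ.1.1 x‖ := by
        refine (ContinuousLinearMap.opNorm_comp_le _ _).trans ?_
        rw [innerSL_apply_norm]
      rw [e, two_smul, two_mul]
      exact (norm_add_le _ _).trans (add_le_add h7 h7)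
    have hm1 : AEStronglyMeasurable φ.1.1 volume := φ.1.2.1.continuous.aestronglyMeasurable
    have hm2 : AEStronglyMeasurable (fderiv ℝ φ.1.1) volume :=
      (φ.1.2.1.continuous_fderiv (by simp)).aestronglyMeasurable
    refine (eLpNorm_le_mul_eLpNorm_of_ae_le_mul (c := 2)
      (g := fun x => ‖φ.1.1 x‖ * ‖fderiv ℝ φ.1.1 x‖) (ae_of_all _ fun x => ?_) 1).trans ?_
    · rw [Real.norm_of_nonneg (by positivity)]
      exact hb x
    · have h3 := eLpNorm_le_eLpNorm_mul_eLpNorm'_of_norm (p := 2) (q := 2) (r := 1)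
        hm1.norm hm2.norm (fun a b : ℝ => a * b) 1 (ae_of_all _ fun x => by
          rw [NNReal.coe_one, one_mul]
          exact norm_mul_le _ _)
      rw [ENNReal.coe_one, one_mul, eLpNorm_norm, eLpNorm_norm] at h3
      rw [mul_assoc]
      simpa using mul_le_mul_right h3 2
  have h4 : eLpNorm (fun x => ‖φ.1.1 x‖ ^ 2) 2 volume ^ 2 =
      eLpNorm (val (solToH φ)) 4 (volume.restrict Ω) ^ 4 := by
    rw [← eLpNorm_testField, eLpNorm_two_sq]
    have h := eLpNorm_nnreal_pow_eq_lintegral (f := φ.1.1) (μ := volume) (p := 4) (by simp)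
    have h' : eLpNorm φ.1.1 4 volume ^ 4 = ∫⁻ x, ‖φ.1.1 x‖ₑ ^ 4 := by simpa using h
    rw [h']
    refine lintegral_congr fun x => ?_
    rw [enorm_pow, enorm_norm]
    ring
  rw [← h4]
  have h5 : eLpNorm (fun x => ‖φ.1.1 x‖ ^ 2) 2 volume ≤
      C₁ * (2 * K) * (‖val (solToH φ)‖ₑ * ‖wgrad (solToH φ)‖ₑ) := by
    have e2 : ((2 : NNReal) : ℝ≥0∞) = 2 := rfl
    rw [e2, ← hC₁] at h1
    refine (h1.trans (mul_le_mul_right h2 _)).trans ?_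
    rw [eLpNorm_testField, Lp.enorm_def, Lp.enorm_def]
    calc _ ≤ C₁ * (2 * eLpNorm (val (solToH φ)) 2 (volume.restrict Ω) *
          (K * eLpNorm (wgrad (solToH φ)) 2 (volume.restrict Ω))) := by
          gcongr
          exact hK' φ 2
      _ = _ := by ring
  calc _ ≤ (C₁ * (2 * K) * (‖val (solToH φ)‖ₑ * ‖wgrad (solToH φ)‖ₑ)) ^ 2 :=
        pow_le_pow_left' h5 2
    _ = _ := by ring

theorem ennreal_rpow_mul_rpow_le {α β : ℝ} (hα : 0 ≤ α) (hβ : 0 ≤ β) (h : α + β ≤ 1)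
    (x y : ℝ≥0∞) : x ^ α * y ^ β ≤ 1 + x + y := by
  calc x ^ α * y ^ β ≤ (1 + x + y) ^ α * (1 + x + y) ^ β := by
        gcongr
        · rw [add_right_comm]
          exact le_add_self
        · exact le_add_self
    _ = (1 + x + y) ^ (α + β) := (ENNReal.rpow_add_of_nonneg _ _ hα hβ).symm
    _ ≤ (1 + x + y) ^ (1 : ℝ) :=
        ENNReal.rpow_le_rpow_of_exponent_le (by rw [add_assoc]; exact le_self_add) h
    _ = _ := ENNReal.rpow_one _

theorem lintegral_rpow_enorm_eq {α E : Type*} [MeasurableSpace α] {μ : Measure α}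
    [NormedAddCommGroup E] (f : α → E) {p : ℝ} (hp : 0 < p) :
    ∫⁻ x, ‖f x‖ₑ ^ p ∂μ = eLpNorm f (ENNReal.ofReal p) μ ^ p := by
  have h := eLpNorm_nnreal_pow_eq_lintegral (f := f) (μ := μ) (p := p.toNNReal)
    (by simpa using hp)
  rw [Real.coe_toNNReal p hp.le] at h
  exact h.symm

/-- Interpolation of `L⁴` between `L^r`, `L²` and `L^{2d/(d-2)}`. -/
theorem eLpNorm_four_interpolation {α E : Type*} [MeasurableSpace α] {μ : Measure α}
    [NormedAddCommGroup E] {f : α → E} (hf : AEStronglyMeasurable f μ) (hd : 3 ≤ d) {r : ℝ}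
    (hr : (d : ℝ) < r) :
    eLpNorm f 4 μ ^ 4 ≤ eLpNorm f (ENNReal.ofReal r) μ ^ 2 *
      (eLpNorm f 2 μ ^ 2) ^ (1 - d / r : ℝ) *
      (eLpNorm f (ENNReal.ofReal (2 * d / (d - 2))) μ ^ 2) ^ (d / r : ℝ) := by
  have hd' : (3 : ℝ) ≤ d := by exact_mod_cast hd
  have hr0 : 0 < r := by linarith
  have hq : 0 < 2 * (d : ℝ) / (d - 2) := div_pos (by linarith) (by linarith)
  have hdr : (d : ℝ) / r ≤ 1 := (div_le_one hr0).2 hr.le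
  have e4 := lintegral_rpow_enorm_eq (μ := μ) f (p := 4) (by norm_num)
  have e2 := lintegral_rpow_enorm_eq (μ := μ) f (p := 2) (by norm_num)
  have er := lintegral_rpow_enorm_eq (μ := μ) f hr0
  have eq := lintegral_rpow_enorm_eq (μ := μ) f hq
  have t4 : ENNReal.ofReal 4 = 4 := by simp
  have t2 : ENNReal.ofReal 2 = 2 := by simp
  rw [t4] at e4
  rw [t2] at e2
  have h4 : eLpNorm f 4 μ ^ 4 = ∫⁻ x, ‖f x‖ₑ ^ (4 : ℝ) ∂μ := by
    rw [e4, ← ENNReal.rpow_natCast]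
    norm_num
  -- Hölder with three weights `2/r`, `1 - d/r`, `(d-2)/r`, which sum to one; the resulting powers
  -- `2`, `2 - 2d/r`, `2d/r` sum to four.
  have hH := ENNReal.lintegral_prod_norm_pow_le (μ := μ) (Finset.univ : Finset (Fin 3))
    (f := ![fun x => ‖f x‖ₑ ^ r, fun x => ‖f x‖ₑ ^ (2 : ℝ),
      fun x => ‖f x‖ₑ ^ (2 * (d : ℝ) / (d - 2))])
    (p := ![2 / r, 1 - d / r, (d - 2) / r]) (by
      intro i _
      fin_cases i
      · exact hf.enorm.pow_const _
      · exact hf.enorm.pow_const _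
      · exact hf.enorm.pow_const _) (by
      simp only [Fin.sum_univ_three, Matrix.cons_val_zero, Matrix.cons_val_one,
        Matrix.cons_val]
      field_simp
      ring) (by
      intro i _
      fin_cases i
      · exact (div_pos two_pos hr0).le
      · exact sub_nonneg.2 hdr
      · exact div_nonneg (by linarith) hr0.le)
  simp only [Fin.prod_univ_three, Matrix.cons_val_zero, Matrix.cons_val_one,
    Matrix.cons_val] at hH
  rw [er, e2, eq] at hH
  simp only [← ENNReal.rpow_mul] at hH
  have hd2 : (d : ℝ) - 2 ≠ 0 := by
    intro h
    linarith
  have x1 : r * (2 / r) = 2 := by field_simp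
  have x3 : 2 * (d : ℝ) / (d - 2) * ((d - 2) / r) = 2 * (d / r) := by field_simp
  rw [x1, x3] at hH
  rw [h4]
  refine le_trans (le_of_eq (lintegral_congr fun x => ?_)) (hH.trans (le_of_eq ?_))
  · rw [← ENNReal.rpow_add_of_nonneg _ _ (by norm_num)
      (mul_nonneg (by norm_num) (sub_nonneg.2 hdr)),
      ← ENNReal.rpow_add_of_nonneg _ _ (add_nonneg (by norm_num)
        (mul_nonneg (by norm_num) (sub_nonneg.2 hdr)))
      (mul_nonneg (by norm_num) (div_nonneg (by linarith) hr0.le))]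
    congr 1
    ring
  · rw [ENNReal.rpow_mul, ENNReal.rpow_mul _ 2 (d / r : ℝ)]
    norm_num

theorem eLpNorm_four_le_top {α E : Type*} [MeasurableSpace α] {μ : Measure α}
    [NormedAddCommGroup E] {f : α → E} (hf : AEStronglyMeasurable f μ) :
    eLpNorm f 4 μ ^ 4 ≤ eLpNorm f ⊤ μ ^ 2 * eLpNorm f 2 μ ^ 2 := by
  have h := eLpNorm_nnreal_pow_eq_lintegral (f := f) (μ := μ) (p := 4) (by simp)
  have h' : eLpNorm f 4 μ ^ 4 = ∫⁻ x, ‖f x‖ₑ ^ 4 ∂μ := by simpa using h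
  rw [h', eLpNorm_two_sq, ← lintegral_const_mul'' _ (hf.enorm.pow_const 2)]
  refine lintegral_mono_ae ?_
  filter_upwards [enorm_ae_le_eLpNormEssSup f μ] with x hx
  rw [eLpNorm_exponent_top]
  calc ‖f x‖ₑ ^ 4 = ‖f x‖ₑ ^ 2 * ‖f x‖ₑ ^ 2 := by ring
    _ ≤ _ := by gcongr

/-- Fields in the energy space that satisfy the Serrin condition are in `L⁴`. -/
theorem exists_eLpNorm_four_le (hΩ : Bornology.IsBounded Ω) (hd : 2 ≤ d) {s : ℝ} (hs : 0 < s)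
    {r : ℝ≥0∞} (hsr : 2 / ENNReal.ofReal s + (d : ℝ≥0∞) / r ≤ 1) :
    ∃ C : ℝ≥0∞, C ≠ ⊤ ∧ ∀ u : H10sol Ω, eLpNorm (val u) 4 (volume.restrict Ω) ^ 4 ≤
      C * (1 + ‖val u‖ₑ ^ 2) * (1 + eLpNorm (val u) r (volume.restrict Ω) ^ s +
        ‖wgrad u‖ₑ ^ 2) := by
  rcases hd.eq_or_lt with rfl | hd3
  -- In two dimensions the energy space embeds into `L⁴(L⁴)` without any Serrin bound.
  · obtain ⟨C, hC, hC'⟩ := exists_eLpNorm_four_le_two (Ω := Ω)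
    refine ⟨C, hC, fun u => (hC' u).trans ?_⟩
    rw [← mul_assoc]
    gcongr
    · exact le_add_self
    · exact le_add_self
  have hs2 : 2 / ENNReal.ofReal s ≤ 1 := le_self_add.trans hsr
  have e2 : 2 / ENNReal.ofReal s = ENNReal.ofReal (2 / s) := by
    rw [ENNReal.ofReal_div_of_pos hs]
    simp
  have hxs : ∀ x : ℝ≥0∞, x ^ 2 = (x ^ s) ^ (2 / s) := fun x => by
    rw [← ENNReal.rpow_mul, ← ENNReal.rpow_natCast]
    congr 1
    field_simp
    norm_num
  rcases eq_or_ne r ⊤ with rfl | hrt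
  · refine ⟨1, by simp, fun u => (eLpNorm_four_le_top (Lp.aestronglyMeasurable _)).trans ?_⟩
    rw [one_mul, mul_comm, Lp.enorm_def]
    gcongr
    · exact le_add_self
    · have h1 : 2 / s ≤ 1 := by
        rw [e2, ← ENNReal.ofReal_one] at hs2
        exact (ENNReal.ofReal_le_ofReal_iff (by norm_num)).1 hs2
      have := ennreal_rpow_mul_rpow_le (div_pos two_pos hs).le le_rfl (by rw [add_zero]; exact h1)
        (eLpNorm (val u) ⊤ (volume.restrict Ω) ^ s) (eLpNorm (wgrad u) 2 (volume.restrict Ω) ^ 2)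
      rw [ENNReal.rpow_zero, mul_one, ← hxs] at this
      exact this.trans (by rw [← Lp.enorm_def])
  have hr0 : r ≠ 0 := by
    rintro rfl
    rw [ENNReal.div_zero (by simp; omega)] at hsr
    simp at hsr
  set ρ : ℝ := r.toReal with hρ
  have hρ0 : 0 < ρ := ENNReal.toReal_pos hr0 hrt
  have hrρ : r = ENNReal.ofReal ρ := (ENNReal.ofReal_toReal hrt).symm
  have hreal : 2 / s + d / ρ ≤ 1 := by
    have e3 : (d : ℝ≥0∞) / r = ENNReal.ofReal (d / ρ) := by
      rw [ENNReal.ofReal_div_of_pos hρ0, ← hrρ, ENNReal.ofReal_natCast]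
    rw [e2, e3, ← ENNReal.ofReal_add (by positivity) (by positivity), ← ENNReal.ofReal_one] at hsr
    exact (ENNReal.ofReal_le_ofReal_iff (by norm_num)).1 hsr
  have hs0 : 0 < 2 / s := by positivity
  have hdρ : (d : ℝ) < ρ := by
    have : (d : ℝ) / ρ < 1 := by linarith
    exact (div_lt_one hρ0).1 this
  have hd' : (3 : ℝ) ≤ d := by exact_mod_cast hd3
  have hdρ1 : (d : ℝ) / ρ ≤ 1 := by linarith
  have hdρ0 : 0 ≤ (d : ℝ) / ρ := by positivity
  have hq0 : 0 < 2 * (d : ℝ) / (d - 2) := div_pos (by linarith) (by linarith)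
  obtain ⟨C, hC, hC'⟩ := exists_eLpNorm_val_le (Ω := Ω) (p := 2)
    (q := (2 * (d : ℝ) / (d - 2)).toNNReal) hΩ (by norm_num) le_rfl
    (by exact_mod_cast hd3) (by
      rw [Real.coe_toNNReal _ hq0.le, inv_div]
      have : (d : ℝ) - 2 ≠ 0 := by
        intro h
        linarith
      push_cast
      refine le_of_eq ?_
      field_simp)
  refine ⟨(C ^ 2) ^ (d / ρ : ℝ), ENNReal.rpow_ne_top_of_nonneg hdρ0 (ENNReal.pow_ne_top hC),
    fun u => ?_⟩
  have h1 := eLpNorm_four_interpolation (Lp.aestronglyMeasurable (val u)) hd3 hdρ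
  rw [← hrρ] at h1
  refine h1.trans ?_
  have h2 : (eLpNorm (val u) 2 (volume.restrict Ω) ^ 2) ^ (1 - d / ρ : ℝ) ≤ 1 + ‖val u‖ₑ ^ 2 := by
    have := ennreal_rpow_mul_rpow_le (sub_nonneg.2 hdρ1) le_rfl
      (by rw [add_zero]; linarith) (eLpNorm (val u) 2 (volume.restrict Ω) ^ 2) 0
    rw [ENNReal.rpow_zero, mul_one, add_zero] at this
    rwa [Lp.enorm_def]
  -- The left side is `(‖u‖_r^s)^(2/s) (‖∇u‖²)^(d/r)`; the Serrin condition says precisely that the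
  -- exponents sum to at most one, which makes it integrable in time.
  have h3 : eLpNorm (val u) r (volume.restrict Ω) ^ 2 * (‖wgrad u‖ₑ ^ 2) ^ (d / ρ : ℝ) ≤
      1 + eLpNorm (val u) r (volume.restrict Ω) ^ s + ‖wgrad u‖ₑ ^ 2 := by
    rw [hxs (eLpNorm (val u) r (volume.restrict Ω))]
    exact ennreal_rpow_mul_rpow_le hs0.le hdρ0 hreal _ _
  calc _ ≤ eLpNorm (val u) r (volume.restrict Ω) ^ 2 * (1 + ‖val u‖ₑ ^ 2) *
        ((C * ‖wgrad u‖ₑ) ^ 2) ^ (d / ρ : ℝ) := by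
        gcongr
        exact hC' u
    _ = (C ^ 2) ^ (d / ρ : ℝ) * (1 + ‖val u‖ₑ ^ 2) *
        (eLpNorm (val u) r (volume.restrict Ω) ^ 2 * (‖wgrad u‖ₑ ^ 2) ^ (d / ρ : ℝ)) := by
        rw [mul_pow, ENNReal.mul_rpow_of_nonneg _ _ hdρ0]
        ring
    _ ≤ _ := by gcongr

end Sobolev

/-! ### Time regularization of weak evolution equations -/

section Evolution

variable {V H : Type*} [NormedAddCommGroup V] [InnerProductSpace ℝ V] [CompleteSpace V]
  [NormedAddCommGroup H] [InnerProductSpace ℝ H] [CompleteSpace H]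

/-- The equation `(L† L v)' = g` on `(0, T)` with `L v(0) = v₀`, in weak form. -/
def IsWeakEvolution (T : ℝ) (L : V →L[ℝ] H) (v g : ℝ → V) (v₀ : H) : Prop :=
  ∀ θ : ℝ → ℝ, ContDiff ℝ 1 θ → (∃ T' < T, ∀ t, T' ≤ t → θ t = 0) → ∀ z : V,
    - ∫ t in Ioo 0 T, deriv θ t * inner ℝ (L z) (L (v t)) =
      (∫ t in Ioo 0 T, θ t * inner ℝ z (g t)) + θ 0 * inner ℝ (L z) v₀

/-- Extension of a curve on `(0, T)` by zero. -/
noncomputable def extendTime {E : Type*} [Zero E] (T : ℝ) (v : ℝ → E) : ℝ → E :=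
  (Ioo 0 T).indicator v

variable {T : ℝ}

theorem memLp_extendTime {E : Type*} [NormedAddCommGroup E] {v : ℝ → E} {p : ℝ≥0∞}
    (hv : MemLp v p (timeMeasure T)) : MemLp (extendTime T v) p volume :=
  (memLp_indicator_iff_restrict measurableSet_Ioo).2 hv

theorem locallyIntegrable_extendTime {E : Type*} [NormedAddCommGroup E] {v : ℝ → E}
    (hv : MemLp v 2 (timeMeasure T)) : LocallyIntegrable (extendTime T v) volume :=
  (memLp_extendTime hv).locallyIntegrable (by norm_num)

theorem integral_extendTime_mul {E : Type*} [NormedAddCommGroup E] [InnerProductSpace ℝ E]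
    (k : ℝ → ℝ) (w : E) (v : ℝ → E) :
    ∫ t, k t * inner ℝ w (extendTime T v t) = ∫ t in Ioo 0 T, k t * inner ℝ w (v t) := by
  rw [← integral_indicator measurableSet_Ioo]
  refine integral_congr_ae (ae_of_all _ fun t => ?_)
  by_cases ht : t ∈ Ioo 0 T
  · simp [extendTime, ht]
  · simp [extendTime, ht]

theorem inner_convolution_extendTime {E : Type*} [NormedAddCommGroup E] [InnerProductSpace ℝ E]
    [CompleteSpace E] {k : ℝ → ℝ} (hk : Continuous k) (hs : HasCompactSupport k) {v : ℝ → E}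
    (hv : LocallyIntegrable (extendTime T v)) (w : E) (t : ℝ) :
    inner ℝ w (convolution k (extendTime T v) (ContinuousLinearMap.lsmul ℝ ℝ) volume t) =
      ∫ τ in Ioo 0 T, k (t - τ) * inner ℝ w (v τ) := by
  rw [convolution_lsmul_swap, ← integral_extendTime_mul]
  have hi : Integrable fun τ => k (t - τ) • extendTime T v τ :=
    convolutionExistsAt_iff_integrable_swap.1
      (hs.convolutionExists_left (ContinuousLinearMap.lsmul ℝ ℝ) hk hv t)
  rw [← integral_inner hi]
  refine integral_congr_ae (ae_of_all _ fun τ => ?_)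
  dsimp only
  rw [inner_smul_right]

theorem hasDerivAt_mollify {E : Type*} [NormedAddCommGroup E] [InnerProductSpace ℝ E]
    {δ : ℝ} {ρ : ℝ → ℝ} (h : IsKernel δ ρ) {f : ℝ → E} (hf : LocallyIntegrable f) (t : ℝ) :
    HasDerivAt (mollify ρ f)
      (convolution (deriv ρ) f (ContinuousLinearMap.lsmul ℝ ℝ) volume t) t :=
  h.hasCompactSupport.hasDerivAt_convolution_left (ContinuousLinearMap.lsmul ℝ ℝ)
    (h.contDiff.of_le (by simp)) hf t

/-- Mollification with a backward kernel turns the weak equation into a pointwise one. -/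
theorem IsWeakEvolution.deriv_mollify {L : V →L[ℝ] H} {v g : ℝ → V} {v₀ : H}
    (hw : IsWeakEvolution T L v g v₀) (hv : MemLp v 2 (timeMeasure T))
    (hg : MemLp g 2 (timeMeasure T)) {δ : ℝ} {ρ : ℝ → ℝ} (h : IsKernel δ ρ)
    (hneg : Function.support ρ ⊆ Ioo (-δ) 0) {t : ℝ} (ht0 : 0 ≤ t) (ht : t < T - δ) :
    L.adjoint (L (deriv (mollify ρ (extendTime T v)) t)) = mollify ρ (extendTime T g) t := by
  have hvl := locallyIntegrable_extendTime hv
  have hgl := locallyIntegrable_extendTime hg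
  refine ext_inner_left ℝ fun z => ?_
  rw [ContinuousLinearMap.adjoint_inner_right, (hasDerivAt_mollify h hvl t).deriv]
  have hL : L (convolution (deriv ρ) (extendTime T v) (ContinuousLinearMap.lsmul ℝ ℝ) volume t) =
      convolution (deriv ρ) (extendTime T fun s => L (v s)) (ContinuousLinearMap.lsmul ℝ ℝ)
        volume t := by
    rw [convolution_lsmul_swap, convolution_lsmul_swap, ← L.integral_comp_comm]
    · refine integral_congr_ae (ae_of_all _ fun τ => ?_)
      by_cases hτ : τ ∈ Ioo 0 T
      · simp [extendTime, hτ]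
      · simp [extendTime, hτ]
    · exact convolutionExistsAt_iff_integrable_swap.1
        (h.hasCompactSupport.deriv.convolutionExists_left (ContinuousLinearMap.lsmul ℝ ℝ)
          (h.contDiff.continuous_deriv (by simp)) hvl t)
  have hLv : LocallyIntegrable (extendTime T fun s => L (v s)) :=
    locallyIntegrable_extendTime (L.comp_memLp' hv)
  rw [hL, inner_convolution_extendTime (h.contDiff.continuous_deriv (by simp))
    h.hasCompactSupport.deriv hLv]
  have hrhs : inner ℝ z (mollify ρ (extendTime T g) t) =
      ∫ τ in Ioo 0 T, ρ (t - τ) * inner ℝ z (g τ) :=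
    inner_convolution_extendTime h.contDiff.continuous h.hasCompactSupport hgl z t
  rw [hrhs]
  have hzero : ∀ x, 0 ≤ x ∨ x ≤ -δ → ρ x = 0 := by
    intro x hx
    by_contra hne
    have := hneg hne
    rcases hx with hx | hx
    · linarith [this.2]
    · linarith [this.1]
  -- An admissible test function: it vanishes for `τ ≥ t + δ`, which is below `T`, and at `τ = 0`
  -- because `ρ` is zero on `[0, ∞)`. Hence no initial term appears, even for `t = 0`.
  have key := hw (fun τ => ρ (t - τ)) ((h.contDiff.of_le (by simp)).comp
    (contDiff_const.sub contDiff_id)) ⟨t + δ, by linarith, fun τ hτ => hzero _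
      (Or.inr (by linarith))⟩ z
  have hder : ∀ τ, deriv (fun τ => ρ (t - τ)) τ = - deriv ρ (t - τ) := fun τ =>
    deriv_comp_const_sub ρ t τ
  simp only [hder, neg_mul, integral_neg, neg_neg, sub_zero] at key
  rw [key, hzero t (Or.inl ht0)]
  simp

theorem contDiff_mollify_extendTime {v : ℝ → V} (hv : MemLp v 2 (timeMeasure T)) {δ : ℝ}
    {ρ : ℝ → ℝ} (h : IsKernel δ ρ) : ContDiff ℝ ∞ (mollify ρ (extendTime T v)) :=
  h.contDiff_mollify (locallyIntegrable_extendTime hv)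

/-- The weak form of the initial condition for mollifications. -/
theorem IsWeakEvolution.inner_mollify_zero {L : V →L[ℝ] H} {v g : ℝ → V} {v₀ : H}
    (hw : IsWeakEvolution T L v g v₀) (hv : MemLp v 2 (timeMeasure T))
    (hg : MemLp g 2 (timeMeasure T)) (z : V) {ε : ℝ} (hε : 0 < ε) (hT : 0 < T) :
    ∃ δ₀ > 0, ∀ (δ : ℝ) (ρ : ℝ → ℝ), δ ≤ δ₀ → IsKernel δ ρ → Function.support ρ ⊆ Ioo (-δ) 0 →
      |inner ℝ (L z) (L (mollify ρ (extendTime T v) 0) - v₀)| ≤ ε := by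
  have hgi : Integrable (fun t => inner ℝ z (extendTime T g t)) := by
    have h1 : MemLp (fun t => inner ℝ z (g t)) 2 (timeMeasure T) := hg.const_inner z
    have h2 : Integrable (extendTime T fun t => inner ℝ z (g t)) :=
      (memLp_one_iff_integrable.1 ((memLp_extendTime (h1.mono_exponent (by norm_num)))))
    refine h2.congr (ae_of_all _ fun t => ?_)
    by_cases ht : t ∈ Ioo 0 T
    · simp [extendTime, ht]
    · simp [extendTime, ht]
  have hcont : Continuous fun b => ∫ t in (0 : ℝ)..b, |inner ℝ z (extendTime T g t)| :=
    hgi.abs.continuous_primitive 0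
  have hlim : Tendsto (fun b => ∫ t in (0 : ℝ)..b, |inner ℝ z (extendTime T g t)|) (𝓝 0) (𝓝 0) := by
    have := hcont.tendsto 0
    rwa [intervalIntegral.integral_same] at this
  obtain ⟨η, hη, hη'⟩ := Metric.eventually_nhds_iff.1 (hlim.eventually (gt_mem_nhds hε))
  refine ⟨min (η / 2) (T / 2), lt_min (by linarith) (by linarith), fun δ ρ hδ h hneg => ?_⟩
  have hδ1 : δ ≤ η / 2 := hδ.trans (min_le_left (η / 2) (T / 2))
  have hδ2 : δ ≤ T / 2 := hδ.trans (min_le_right (η / 2) (T / 2))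
  -- A kernel of nonpositive radius would have empty support, against total mass one.
  have hδ0 : 0 < δ := by
    by_contra hne
    have hsupp : Function.support ρ = ∅ := by
      refine eq_empty_of_subset_empty (hneg.trans ?_)
      rw [Ioo_eq_empty (by linarith)]
    have h1 := h.integral_eq_one
    rw [Function.support_eq_empty_iff] at hsupp
    rw [hsupp] at h1
    simp at h1
  have hvl := locallyIntegrable_extendTime hv
  have hρc := h.contDiff.continuous
  -- An antiderivative of `-ρ(-τ)` with `θ(0) = 1` and `θ = 0` from `δ` on. Testing with it compares
  -- the mollified value at zero with `v₀`; the remainder is an integral of `g` over `(0, δ)`.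
  set θ : ℝ → ℝ := fun τ => 1 - ∫ s in (0 : ℝ)..τ, ρ (-s) with hθ
  have hρn : Continuous fun s => ρ (-s) := hρc.comp continuous_neg
  have hθd : ∀ τ, HasDerivAt θ (-ρ (-τ)) τ := fun τ => by
    have := (hρn.integral_hasStrictDerivAt 0 τ).hasDerivAt.const_sub 1
    exact this
  have hθ' : deriv θ = fun τ => -ρ (-τ) := funext fun τ => (hθd τ).deriv
  have hθc : ContDiff ℝ 1 θ := by
    rw [contDiff_one_iff_deriv]
    refine ⟨fun τ => (hθd τ).differentiableAt, ?_⟩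
    rw [hθ']
    exact hρn.neg
  have hint1 : ∫ s in (0 : ℝ)..δ, ρ (-s) = 1 := by
    rw [intervalIntegral.integral_comp_neg, neg_zero, ← h.integral_eq_one,
      intervalIntegral.integral_of_le (by linarith)]
    refine setIntegral_eq_integral_of_forall_compl_eq_zero fun x hx => ?_
    by_contra hne
    exact hx ⟨(hneg hne).1, (hneg hne).2.le⟩
  have hρi : ∀ a b, IntervalIntegrable (fun s => ρ (-s)) volume a b := fun a b =>
    hρn.intervalIntegrable a b
  have hθ0 : ∀ τ, δ ≤ τ → θ τ = 0 := by
    intro τ hτ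
    have h2 : ∫ s in δ..τ, ρ (-s) = 0 := by
      rw [intervalIntegral.integral_of_le hτ]
      refine setIntegral_eq_zero_of_forall_eq_zero fun x hx => ?_
      by_contra hne
      linarith [(hneg hne).1, hx.1]
    have h3 := intervalIntegral.integral_add_adjacent_intervals (hρi 0 δ) (hρi δ τ)
    rw [hint1, h2] at h3
    change 1 - ∫ s in (0 : ℝ)..τ, ρ (-s) = 0
    linarith
  have hθ1 : ∀ τ, 0 ≤ τ → |θ τ| ≤ 1 := by
    intro τ hτ
    have h2 : 0 ≤ ∫ s in (0 : ℝ)..τ, ρ (-s) :=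
      intervalIntegral.integral_nonneg hτ fun s _ => h.nonneg _
    have h4 : 0 ≤ ∫ s in τ..max τ δ, ρ (-s) :=
      intervalIntegral.integral_nonneg (le_max_left τ δ) fun s _ => h.nonneg _
    have h3 := intervalIntegral.integral_add_adjacent_intervals (hρi 0 τ) (hρi τ (max τ δ))
    have h5 := hθ0 (max τ δ) (le_max_right τ δ)
    have h6 : 1 - ∫ s in (0 : ℝ)..max τ δ, ρ (-s) = 0 := h5
    have h7 : θ τ = 1 - ∫ s in (0 : ℝ)..τ, ρ (-s) := rfl
    rw [abs_le, h7]
    constructor <;> linarith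
  have key := hw θ hθc ⟨δ, by linarith, hθ0⟩ z
  have hθz : θ 0 = 1 := by
    change 1 - ∫ s in (0 : ℝ)..0, ρ (-s) = 1
    rw [intervalIntegral.integral_same, sub_zero]
  have hL : L (mollify ρ (extendTime T v) 0) = mollify ρ (extendTime T fun s => L (v s)) 0 := by
    rw [mollify_apply, mollify_apply, ← L.integral_comp_comm (h.exists_mollify hvl 0)]
    refine integral_congr_ae (ae_of_all _ fun τ => ?_)
    by_cases hτ : 0 - τ ∈ Ioo 0 T
    · simp only [extendTime, indicator_of_mem hτ, map_smul]
    · simp only [extendTime, indicator_of_notMem hτ, smul_zero, map_zero]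
  have hLv : LocallyIntegrable (extendTime T fun s => L (v s)) :=
    locallyIntegrable_extendTime (L.comp_memLp' hv)
  have e1 : inner ℝ (L z) (mollify ρ (extendTime T fun s => L (v s)) 0) =
      ∫ τ in Ioo 0 T, ρ (0 - τ) * inner ℝ (L z) (L (v τ)) :=
    inner_convolution_extendTime hρc h.hasCompactSupport hLv (L z) 0
  simp only [hθ', neg_mul, integral_neg, neg_neg, hθz, one_mul] at key
  simp only [zero_sub] at e1
  rw [inner_sub_right, hL, e1, key, add_sub_cancel_right, ← integral_extendTime_mul]
  have hb : ∀ t, |θ t * inner ℝ z (extendTime T g t)| ≤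
      (Ioc 0 δ).indicator (fun t => |inner ℝ z (extendTime T g t)|) t := by
    intro t
    by_cases ht0 : 0 < t
    · by_cases htδ : t ≤ δ
      · rw [indicator_of_mem (mem_Ioc.2 ⟨ht0, htδ⟩), abs_mul]
        exact mul_le_of_le_one_left (abs_nonneg _) (hθ1 t ht0.le)
      · rw [hθ0 t (not_le.1 htδ).le, zero_mul, abs_zero]
        exact indicator_nonneg (fun _ _ => abs_nonneg _) _
    · have : extendTime T g t = 0 := indicator_of_notMem (fun hm => ht0 hm.1) _
      rw [this, inner_zero_right, mul_zero, abs_zero]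
      exact indicator_nonneg (fun _ _ => abs_nonneg _) _
  calc |∫ t, θ t * inner ℝ z (extendTime T g t)|
      ≤ ∫ t, |θ t * inner ℝ z (extendTime T g t)| := abs_integral_le_integral_abs
    _ ≤ ∫ t, (Ioc 0 δ).indicator (fun t => |inner ℝ z (extendTime T g t)|) t :=
        integral_mono_of_nonneg (ae_of_all _ fun _ => abs_nonneg _)
          (hgi.abs.indicator measurableSet_Ioc) (ae_of_all _ hb)
    _ = ∫ t in (0 : ℝ)..δ, |inner ℝ z (extendTime T g t)| := by
        rw [integral_indicator measurableSet_Ioc, intervalIntegral.integral_of_le hδ0.le]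
    _ ≤ ε := (hη' (by
        rw [Real.dist_eq, sub_zero, abs_of_pos hδ0]
        linarith)).le

/-- The energy identity bounds the initial value. -/
theorem norm_sq_zero_le {L : V →L[ℝ] H} {u k : ℝ → V} (hu : ContDiff ℝ 1 u) {b : ℝ}
    (hk : ∀ t ∈ Ioo 0 b, L.adjoint (L (deriv u t)) = k t) (hkc : Continuous k) :
    ENNReal.ofReal b * ‖L (u 0)‖ₑ ^ 2 ≤ eLpNorm (fun t => L (u t)) 2 (timeMeasure b) ^ 2 +
      ENNReal.ofReal b * (2 * (eLpNorm k 2 (timeMeasure b) * eLpNorm u 2 (timeMeasure b))) := by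
  have huc : Continuous u := hu.continuous
  have hd : ∀ t, HasDerivAt (fun t => ‖L (u t)‖ ^ 2) (2 * inner ℝ (L (u t)) (L (deriv u t))) t := by
    intro t
    exact (L.hasFDerivAt.comp_hasDerivAt t
      (hu.differentiable one_ne_zero t).hasDerivAt).norm_sq
  have hdc : Continuous fun t => 2 * inner ℝ (L (u t)) (L (deriv u t)) :=
    continuous_const.mul ((L.continuous.comp huc).inner
      (L.continuous.comp (hu.continuous_deriv le_rfl)))
  set Y : ℝ≥0∞ := 2 * (eLpNorm k 2 (timeMeasure b) * eLpNorm u 2 (timeMeasure b)) with hY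
  -- From `d/dt ‖L u‖² = 2 ⟨k, u⟩`. The bound is averaged over `(0, b)`, so that only square
  -- integrals of `u` and `k` remain.
  have hpt : ∀ t ∈ Ioo 0 b, ‖L (u 0)‖ₑ ^ 2 ≤ ‖L (u t)‖ₑ ^ 2 + Y := by
    intro t ht
    have h1 := intervalIntegral.integral_eq_sub_of_hasDerivAt (fun s _ => hd s)
      (hdc.intervalIntegrable 0 t)
    have h2 : ‖∫ s in (0 : ℝ)..t, 2 * inner ℝ (L (u s)) (L (deriv u s))‖ₑ ≤ Y := by
      rw [intervalIntegral.integral_of_le ht.1.le]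
      refine (enorm_integral_le_lintegral_enorm _).trans ?_
      have hsub : Ioc 0 t ⊆ Ioo 0 b := fun x hx => ⟨hx.1, hx.2.trans_lt ht.2⟩
      refine (lintegral_mono_set hsub).trans ?_
      have h3 : eLpNorm (fun s => inner ℝ (k s) (u s)) 1 (timeMeasure b) ≤ _ :=
        eLpNorm_inner_le hkc.aestronglyMeasurable huc.aestronglyMeasurable
      rw [eLpNorm_one_eq_lintegral_enorm] at h3
      rw [hY]
      refine le_trans (le_of_eq ?_) (mul_le_mul_right h3 2)
      rw [← lintegral_const_mul' _ _ (by simp)]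
      refine setLIntegral_congr_fun measurableSet_Ioo fun s hs => ?_
      rw [← hk s hs, ContinuousLinearMap.adjoint_inner_left, real_inner_comm, enorm_mul]
      congr 1
      rw [← ofReal_norm]
      simp
    have h4 : ‖L (u 0)‖ ^ 2 = ‖L (u t)‖ ^ 2 -
        ∫ s in (0 : ℝ)..t, 2 * inner ℝ (L (u s)) (L (deriv u s)) := by
      rw [h1]
      ring
    have e : ∀ x : H, ‖x‖ₑ ^ 2 = ‖‖x‖ ^ 2‖ₑ := fun x => by rw [enorm_pow, enorm_norm]
    rw [e, e, h4]
    exact enorm_sub_le.trans (add_le_add le_rfl h2)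
  have hm : volume (Ioo 0 b) = ENNReal.ofReal b := by rw [Real.volume_Ioo, sub_zero]
  calc ENNReal.ofReal b * ‖L (u 0)‖ₑ ^ 2 = ∫⁻ _ in Ioo 0 b, ‖L (u 0)‖ₑ ^ 2 := by
        rw [setLIntegral_const, hm, mul_comm]
    _ ≤ ∫⁻ t in Ioo 0 b, (‖L (u t)‖ₑ ^ 2 + Y) := setLIntegral_mono' measurableSet_Ioo hpt
    _ = _ := by
        rw [lintegral_add_right _ measurable_const, setLIntegral_const, hm, eLpNorm_two_sq,
          mul_comm Y]

end Evolution

/-! ### Strong convergence to the initial value. -/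

section InitialValue

variable {V H : Type*} [NormedAddCommGroup V] [InnerProductSpace ℝ V] [CompleteSpace V]
  [NormedAddCommGroup H] [InnerProductSpace ℝ H] [CompleteSpace H] {T : ℝ}

theorem eLpNorm_mollify_sub_mollify_le {v : ℝ → V} {δ δ' : ℝ} {ρ ρ' : ℝ → ℝ}
    (hv : MemLp v 2 (timeMeasure T)) (h : IsKernel δ ρ) (h' : IsKernel δ' ρ')
    {η : ℝ≥0∞} (h1 : eLpNorm (mollify ρ (extendTime T v) - extendTime T v) 2 ≤ η)
    (h2 : eLpNorm (mollify ρ' (extendTime T v) - extendTime T v) 2 ≤ η) (b : ℝ) :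
    eLpNorm (fun t => mollify ρ (extendTime T v) t - mollify ρ' (extendTime T v) t) 2
      (timeMeasure b) ≤ η + η := by
  have hm := (memLp_extendTime hv).1
  have e : (fun t => mollify ρ (extendTime T v) t - mollify ρ' (extendTime T v) t) =
      (mollify ρ (extendTime T v) - extendTime T v) -
        (mollify ρ' (extendTime T v) - extendTime T v) := by
    funext t
    simp
  refine (eLpNorm_mono_measure _ Measure.restrict_le_self).trans ?_
  rw [e]
  refine (eLpNorm_sub_le ?_ ?_ (by norm_num)).trans (add_le_add h1 h2)
  · exact (contDiff_mollify_extendTime hv h).continuous.aestronglyMeasurable.sub hm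
  · exact (contDiff_mollify_extendTime hv h').continuous.aestronglyMeasurable.sub hm

/-- The mollified curves attain the initial value strongly. -/
theorem IsWeakEvolution.exists_norm_mollify_zero_sub_le {L : V →L[ℝ] H} {v g : ℝ → V} {v₀ : H}
    (hw : IsWeakEvolution T L v g v₀) (hv : MemLp v 2 (timeMeasure T))
    (hg : MemLp g 2 (timeMeasure T)) (hv₀ : v₀ ∈ closure (range L)) {ε : ℝ} (hε : 0 < ε)
    (hT : 0 < T) :
    ∃ δ₀ > 0, ∀ (δ : ℝ) (ρ : ℝ → ℝ), δ ≤ δ₀ → IsKernel δ ρ → Function.support ρ ⊆ Ioo (-δ) 0 →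
      ‖L (mollify ρ (extendTime T v) 0) - v₀‖ ≤ ε := by
  have hb : 0 < T / 2 := by linarith
  -- With both `L²` distances at most `2η`, the averaged energy bound yields `K η²`, and `K η² ≤ ((K
  -- + 1) η)² = ε²`.
  set K : ℝ := 4 * ‖L‖ ^ 2 / (T / 2) + 8 with hK
  have hK0 : 0 < K := by positivity
  set η : ℝ := ε / (K + 1) with hη
  have hη0 : 0 < η := by positivity
  have hηe : ENNReal.ofReal η ≠ 0 := (ENNReal.ofReal_pos.2 hη0).ne'
  obtain ⟨δ₁, hδ₁, H1⟩ := exists_eLpNorm_mollify_sub_le (p := 2) (by norm_num) (by norm_num)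
    (memLp_extendTime hv) hηe
  obtain ⟨δ₂, hδ₂, H2⟩ := exists_eLpNorm_mollify_sub_le (p := 2) (by norm_num) (by norm_num)
    (memLp_extendTime hg) hηe
  -- The difference of two mollifications solves the equation with the difference of the mollified
  -- right-hand sides on `(0, T/2)`.
  have hcauchy : ∀ (δ : ℝ) (ρ : ℝ → ℝ) (δ' : ℝ) (ρ' : ℝ → ℝ), δ ≤ min δ₁ (min δ₂ (T / 2)) →
      δ' ≤ min δ₁ (min δ₂ (T / 2)) → IsKernel δ ρ → IsKernel δ' ρ' →
      Function.support ρ ⊆ Ioo (-δ) 0 → Function.support ρ' ⊆ Ioo (-δ') 0 →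
      ‖L (mollify ρ (extendTime T v) 0) - L (mollify ρ' (extendTime T v) 0)‖ ≤ ε := by
    intro δ ρ δ' ρ' hδ hδ' h h' hn hn'
    rw [le_min_iff, le_min_iff] at hδ hδ'
    have hu1 := eLpNorm_mollify_sub_mollify_le hv h h' (H1 δ ρ hδ.1 h) (H1 δ' ρ' hδ'.1 h') (T / 2)
    have hg1 := eLpNorm_mollify_sub_mollify_le hg h h' (H2 δ ρ hδ.2.1 h) (H2 δ' ρ' hδ'.2.1 h')
      (T / 2)
    have cv : ContDiff ℝ 1 (mollify ρ (extendTime T v)) :=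
      (contDiff_mollify_extendTime hv h).of_le (by simp)
    have cv' : ContDiff ℝ 1 (mollify ρ' (extendTime T v)) :=
      (contDiff_mollify_extendTime hv h').of_le (by simp)
    have hmain := norm_sq_zero_le (L := L) (b := T / 2)
      (k := fun t => mollify ρ (extendTime T g) t - mollify ρ' (extendTime T g) t)
      (cv.sub cv') (fun t ht => by
        have e : deriv (fun x => mollify ρ (extendTime T v) x - mollify ρ' (extendTime T v) x) t =
            deriv (mollify ρ (extendTime T v)) t - deriv (mollify ρ' (extendTime T v)) t :=
          deriv_fun_sub (cv.differentiable one_ne_zero t) (cv'.differentiable one_ne_zero t)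
        rw [e, map_sub, map_sub, hw.deriv_mollify hv hg h hn ht.1.le (by linarith [ht.2, hδ.2.2]),
          hw.deriv_mollify hv hg h' hn' ht.1.le (by linarith [ht.2, hδ'.2.2])])
      ((contDiff_mollify_extendTime hg h).continuous.sub
        (contDiff_mollify_extendTime hg h').continuous)
    have hLu : eLpNorm (fun t => L (mollify ρ (extendTime T v) t - mollify ρ' (extendTime T v) t)) 2
        (timeMeasure (T / 2)) ≤ ENNReal.ofReal ‖L‖ * (ENNReal.ofReal η + ENNReal.ofReal η) :=
      (eLpNorm_le_mul_eLpNorm_of_ae_le_mul (ae_of_all _ fun t => L.le_opNorm _) 2).trans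
        (mul_le_mul_right hu1 _)
    rw [← ENNReal.ofReal_add hη0.le hη0.le] at hu1 hg1 hLu
    rw [← ENNReal.ofReal_mul (norm_nonneg L)] at hLu
    have hall : ENNReal.ofReal (T / 2) * ‖L (mollify ρ (extendTime T v) 0 -
        mollify ρ' (extendTime T v) 0)‖ₑ ^ 2 ≤ ENNReal.ofReal (‖L‖ * (η + η)) ^ 2 +
        ENNReal.ofReal (T / 2) * (2 * (ENNReal.ofReal (η + η) * ENNReal.ofReal (η + η))) := by
      refine hmain.trans ?_
      gcongr
    have h2e : (2 : ℝ≥0∞) = ENNReal.ofReal 2 := by simp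
    rw [← ofReal_norm, h2e, ← ENNReal.ofReal_mul (by positivity), ← ENNReal.ofReal_mul (by positivity),
      ← ENNReal.ofReal_mul (by positivity), ← ENNReal.ofReal_pow (by positivity),
      ← ENNReal.ofReal_pow (by positivity), ← ENNReal.ofReal_mul (by positivity),
      ← ENNReal.ofReal_add (by positivity) (by positivity),
      ENNReal.ofReal_le_ofReal_iff (by positivity), map_sub] at hall
    set D := ‖L (mollify ρ (extendTime T v) 0) - L (mollify ρ' (extendTime T v) 0)‖ with hD
    have e1 : (‖L‖ * (η + η)) ^ 2 + T / 2 * (2 * ((η + η) * (η + η))) = T / 2 * (K * η ^ 2) := by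
      rw [hK]
      field_simp
      ring
    rw [e1] at hall
    have h3 : D ^ 2 ≤ K * η ^ 2 := le_of_mul_le_mul_left hall hb
    have h4 : ε = (K + 1) * η := by
      rw [hη]
      field_simp
    refine abs_le_of_sq_le_sq' ?_ hε.le |>.2
    rw [h4]
    nlinarith [sq_nonneg η, mul_pos hK0 hη0]
  refine ⟨min δ₁ (min δ₂ (T / 2)), lt_min hδ₁ (lt_min hδ₂ hb), fun δ ρ hδ h hn => ?_⟩
  set D := L (mollify ρ (extendTime T v) 0) - v₀ with hD
  -- A second kernel, fine enough for this particular `z`, carries the weak initial condition; the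
  -- Cauchy bound is uniform in it. By density `z` may be replaced by `D` itself, giving `‖D‖² ≤ ε
  -- ‖D‖`.
  have hz : ∀ z, inner ℝ (L z) D ≤ ε * ‖L z‖ := by
    intro z
    refine le_of_forall_pos_le_add fun ε' hε' => ?_
    obtain ⟨δ₃, hδ₃, H3⟩ := hw.inner_mollify_zero hv hg z hε' hT
    obtain ⟨ρ', h', hn'⟩ := exists_isKernel_of_neg (δ := min δ₃ (min δ₁ (min δ₂ (T / 2))))
      (lt_min hδ₃ (lt_min hδ₁ (lt_min hδ₂ hb)))
    have h1 := hcauchy δ ρ _ ρ' hδ (min_le_right δ₃ (min δ₁ (min δ₂ (T / 2)))) h h' hn hn'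
    have h2 := (le_abs_self _).trans (H3 _ ρ' (min_le_left δ₃ (min δ₁ (min δ₂ (T / 2)))) h' hn')
    have e : D = (L (mollify ρ (extendTime T v) 0) - L (mollify ρ' (extendTime T v) 0)) +
        (L (mollify ρ' (extendTime T v) 0) - v₀) := by rw [hD]; abel
    rw [e, inner_add_right]
    have h3 := real_inner_le_norm (L z)
      (L (mollify ρ (extendTime T v) 0) - L (mollify ρ' (extendTime T v) 0))
    have h4 := mul_le_mul_of_nonneg_left h1 (norm_nonneg (L z))
    linarith
  have hcl : ∀ x ∈ closure (range L), inner ℝ x D ≤ ε * ‖x‖ := by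
    intro x hx
    refine closure_minimal ?_ (isClosed_le (f := fun x => inner ℝ x D) (g := fun x => ε * ‖x‖)
      (continuous_id.inner continuous_const) (continuous_const.mul continuous_norm)) hx
    rintro _ ⟨z, rfl⟩
    exact hz z
  have hDm : D ∈ closure (range L) := by
    have e : (closure (range L) : Set H) = (LinearMap.range L.toLinearMap).topologicalClosure := by
      rw [Submodule.topologicalClosure_coe]
      rfl
    rw [e] at hv₀ ⊢
    refine Submodule.sub_mem _ ?_ hv₀
    rw [← SetLike.mem_coe, ← e]
    exact subset_closure ⟨_, rfl⟩
  have h5 := hcl D hDm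
  rw [real_inner_self_eq_norm_mul_norm] at h5
  rcases eq_or_lt_of_le (norm_nonneg D) with h6 | h6
  · rw [← h6]
    exact hε.le
  · exact le_of_mul_le_mul_right h5 h6

end InitialValue

/-! ### Jensen's inequality for vector valued averages -/

section Jensen

variable {E : Type*} [NormedAddCommGroup E] [NormedSpace ℝ E] [CompleteSpace E]

/-- The epigraph in `E × ℝ` is closed and convex, hence contains the mean of the points `(F x, N (F
x))`. The case of an infinite right-hand side is trivial. -/
theorem integral_mem_epigraph {α : Type*} [MeasurableSpace α] {P : Measure α}
    [IsProbabilityMeasure P] {N : E → ℝ≥0∞} (hN : LowerSemicontinuous N)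
    (hc : ∀ a b : ℝ, 0 ≤ a → 0 ≤ b → a + b = 1 → ∀ x y,
      N (a • x + b • y) ≤ ENNReal.ofReal a * N x + ENNReal.ofReal b * N y)
    {F : α → E} (hF : Integrable F P) (hm : AEMeasurable (fun x => N (F x)) P) :
    N (∫ x, F x ∂P) ≤ ∫⁻ x, N (F x) ∂P := by
  by_cases htop : ∫⁻ x, N (F x) ∂P = ⊤
  · rw [htop]
    exact le_top
  set s : Set (E × ℝ) := {p | 0 ≤ p.2 ∧ N p.1 ≤ ENNReal.ofReal p.2} with hs
  have hconv : Convex ℝ s := by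
    intro p hp q hq a b ha hb hab
    refine ⟨add_nonneg (mul_nonneg ha hp.1) (mul_nonneg hb hq.1), ?_⟩
    refine (hc a b ha hb hab p.1 q.1).trans ?_
    change _ ≤ ENNReal.ofReal (a * p.2 + b * q.2)
    rw [ENNReal.ofReal_add (mul_nonneg ha hp.1) (mul_nonneg hb hq.1), ENNReal.ofReal_mul ha,
      ENNReal.ofReal_mul hb]
    exact add_le_add (mul_le_mul_right hp.2 _) (mul_le_mul_right hq.2 _)
  have hcl : IsClosed s := by
    refine (isClosed_le continuous_const continuous_snd).inter ?_
    have h1 : IsClosed {p : E × ℝ≥0∞ | N p.1 ≤ p.2} := hN.isClosed_epigraph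
    exact h1.preimage (f := fun p : E × ℝ => (p.1, ENNReal.ofReal p.2))
      (continuous_fst.prodMk (ENNReal.continuous_ofReal.comp continuous_snd))
  have hfin : ∀ᵐ x ∂P, N (F x) < ⊤ := ae_lt_top' hm htop
  have hφ : Integrable (fun x => (N (F x)).toReal) P := integrable_toReal_of_lintegral_ne_top hm htop
  have hmem := hconv.integral_mem hcl (f := fun x => (F x, (N (F x)).toReal)) (μ := P) (by
    filter_upwards [hfin] with x hx
    exact ⟨ENNReal.toReal_nonneg, (ENNReal.ofReal_toReal hx.ne).ge⟩) (hF.prodMk hφ)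
  rw [integral_pair hF hφ] at hmem
  refine hmem.2.trans (le_of_eq ?_)
  rw [integral_toReal hm hfin, ENNReal.ofReal_toReal htop]

/-- Jensen's inequality for convex functions of mollifications. -/
theorem IsKernel.convex_mollify_le {N : E → ℝ≥0∞} (hN : LowerSemicontinuous N)
    (hc : ∀ a b : ℝ, 0 ≤ a → 0 ≤ b → a + b = 1 → ∀ x y,
      N (a • x + b • y) ≤ ENNReal.ofReal a * N x + ENNReal.ofReal b * N y)
    {δ : ℝ} {ρ : ℝ → ℝ} (h : IsKernel δ ρ) {f : ℝ → E} (hf : LocallyIntegrable f)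
    (hm : AEMeasurable fun t => N (f t)) (t : ℝ) :
    N (mollify ρ f t) ≤ ∫⁻ y, ENNReal.ofReal (ρ y) * N (f (t - y)) := by
  have hmt : AEMeasurable fun y => N (f (t - y)) :=
    hm.comp_quasiMeasurePreserving (quasiMeasurePreserving_sub_left volume t)
  have := h.isProbabilityMeasure
  have hac := withDensity_absolutelyContinuous (volume : Measure ℝ) fun x => ENNReal.ofReal (ρ x)
  have e : ∀ y, (ENNReal.ofReal (ρ y)).toReal • f (t - y) = ρ y • f (t - y) := fun y => by
    rw [ENNReal.toReal_ofReal (h.nonneg y)]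
  have hlt : ∀ᵐ x : ℝ, ENNReal.ofReal (ρ x) < ⊤ := ae_of_all _ fun _ => ENNReal.ofReal_lt_top
  have hF : Integrable (fun y => f (t - y)) ((volume : Measure ℝ).withDensity
      fun x => ENNReal.ofReal (ρ x)) := by
    rw [integrable_withDensity_iff_integrable_smul' h.measurable_ofReal hlt]
    simp only [e]
    exact h.exists_mollify hf t
  have key := integral_mem_epigraph hN hc hF (hmt.mono_ac hac)
  rw [integral_withDensity_eq_integral_toReal_smul h.measurable_ofReal hlt,
    lintegral_withDensity_eq_lintegral_mul₀' h.measurable_ofReal.aemeasurable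
      (hmt.mono_ac hac)] at key
  simp only [e] at key
  exact key

/-- Jensen's inequality for `N` and again for the power, and Tonelli. With a one-sided kernel, times
in `(0, b)` see only `f` on `(0, b + δ)`. -/
theorem IsKernel.lintegral_convex_mollify_rpow_le {N : E → ℝ≥0∞} (hN : LowerSemicontinuous N)
    (hc : ∀ a b : ℝ, 0 ≤ a → 0 ≤ b → a + b = 1 → ∀ x y,
      N (a • x + b • y) ≤ ENNReal.ofReal a * N x + ENNReal.ofReal b * N y)
    {δ : ℝ} {ρ : ℝ → ℝ} (h : IsKernel δ ρ) (hneg : Function.support ρ ⊆ Ioo (-δ) 0) {f : ℝ → E}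
    (hf : LocallyIntegrable f) (hm : AEMeasurable fun t => N (f t)) {q : ℝ} (hq : 1 ≤ q) (b : ℝ) :
    ∫⁻ t in Ioo 0 b, N (mollify ρ f t) ^ q ≤ ∫⁻ t in Ioo 0 (b + δ), N (f t) ^ q := by
  have hq0 : 0 ≤ q := by linarith
  have hmq : AEMeasurable ((Ioo 0 (b + δ)).indicator fun t => N (f t) ^ q) :=
    (hm.pow_const q).indicator measurableSet_Ioo
  rw [← lintegral_indicator (s := Ioo 0 (b + δ)) measurableSet_Ioo,
    ← lintegral_lintegral_translate h hmq]
  refine (setLIntegral_mono' measurableSet_Ioo fun t ht => ?_).trans (setLIntegral_le_lintegral _ _)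
  have hmt : AEMeasurable fun y => N (f (t - y)) :=
    hm.comp_quasiMeasurePreserving (quasiMeasurePreserving_sub_left volume t)
  refine (ENNReal.rpow_le_rpow (h.convex_mollify_le hN hc hf hm t) hq0).trans ?_
  refine (h.lintegral_rpow_le hmt hq).trans (lintegral_mono fun y => ?_)
  by_cases hy : ρ y = 0
  · simp [hy]
  · have := hneg hy
    rw [indicator_of_mem (mem_Ioo.2 ⟨by linarith [this.2, ht.1], by linarith [this.1, ht.2]⟩)]

theorem lowerSemicontinuous_measurable_comp {N : E → ℝ≥0∞} (hN : LowerSemicontinuous N)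
    {α : Type*} [MeasurableSpace α] {μ : Measure α} {f : α → E} (hf : AEStronglyMeasurable f μ) :
    AEMeasurable (fun x => N (f x)) μ := by
  borelize E
  exact hN.measurable.comp_aemeasurable hf.aemeasurable

/-- Norm-like convex functions of mollified curves exceed those of the curve by little. -/
theorem exists_lintegral_convex_mollify_le {N : E → ℝ≥0∞} (hN : LowerSemicontinuous N)
    (hc : ∀ a b : ℝ, 0 ≤ a → 0 ≤ b → a + b = 1 → ∀ x y,
      N (a • x + b • y) ≤ ENNReal.ofReal a * N x + ENNReal.ofReal b * N y) (hN0 : N 0 = 0)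
    {T : ℝ} {v : ℝ → E} (hv : MemLp v 2 (timeMeasure T)) {q : ℝ} (hq : 1 ≤ q)
    (hfin : ∫⁻ t in Ioo 0 T, N (v t) ^ q < ⊤) {b : ℝ} {ε : ℝ≥0∞} (hε : ε ≠ 0) :
    ∃ δ₀ > 0, ∀ (δ : ℝ) (ρ : ℝ → ℝ), δ ≤ δ₀ → IsKernel δ ρ → Function.support ρ ⊆ Ioo (-δ) 0 →
      ∫⁻ t in Ioo 0 T, N (mollify ρ (extendTime T v) t) ^ q < ⊤ ∧
      (b ≤ T → ∫⁻ t in Ioo 0 b, N (mollify ρ (extendTime T v) t) ^ q ≤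
        (∫⁻ t in Ioo 0 b, N (v t) ^ q) + ε) := by
  have hq0 : 0 < q := by linarith
  have hloc : LocallyIntegrable (extendTime T v) volume :=
    (memLp_extendTime hv).locallyIntegrable (by norm_num)
  have hm := lowerSemicontinuous_measurable_comp hN (memLp_extendTime hv).1
  have e : (fun t => N (extendTime T v t) ^ q) = (Ioo 0 T).indicator fun t => N (v t) ^ q := by
    funext t
    by_cases ht : t ∈ Ioo 0 T
    · simp [extendTime, ht]
    · simp [extendTime, ht, hN0, hq0]
  have htot : ∫⁻ t, N (extendTime T v t) ^ q = ∫⁻ t in Ioo 0 T, N (v t) ^ q := by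
    rw [e, lintegral_indicator measurableSet_Ioo]
  -- The excess is the integral over `[b, b + δ)`, small by absolute continuity.
  obtain ⟨η, hη, hη'⟩ := exists_pos_setLIntegral_lt_of_measure_lt (by rw [htot]; exact hfin.ne) hε
  obtain ⟨η', hη0, hηη⟩ := exists_between hη
  have hη't : η' ≠ ⊤ := (hηη.trans_le le_top).ne
  refine ⟨η'.toReal, ENNReal.toReal_pos hη0.ne' hη't, fun δ ρ hδ h hneg => ⟨?_, fun hbT => ?_⟩⟩
  · refine (h.lintegral_convex_mollify_rpow_le hN hc hneg hloc hm hq T).trans_lt ?_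
    refine (setLIntegral_le_lintegral _ _).trans_lt ?_
    rw [htot]
    exact hfin
  · refine (h.lintegral_convex_mollify_rpow_le hN hc hneg hloc hm hq b).trans ?_
    have hsub : Ioo 0 (b + δ) ⊆ Ioo 0 b ∪ Ico b (b + δ) := by
      intro x hx
      rcases lt_or_ge x b with hxb | hxb
      · exact Or.inl ⟨hx.1, hxb⟩
      · exact Or.inr ⟨hxb, hx.2⟩
    refine (lintegral_mono_set hsub).trans ((lintegral_union_le _ _ _).trans (add_le_add ?_ ?_))
    · refine setLIntegral_mono' measurableSet_Ioo fun t ht => ?_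
      rw [extendTime, indicator_of_mem (mem_Ioo.2 ⟨ht.1, ht.2.trans_le hbT⟩)]
    · refine (hη' _ ?_).le
      rw [Real.volume_Ico, add_sub_cancel_left]
      exact (ENNReal.ofReal_le_of_le_toReal hδ).trans_lt hηη

end Jensen

/-! ### Smooth approximation of weak solutions -/

section SmoothApproximation


/-- Dominated convergence: the operators converge pointwise, and a continuous curve is bounded on
`[0, b]`. -/
theorem tendsto_eLpNorm_comp_sub {V : Type*} [NormedAddCommGroup V] [NormedSpace ℝ V]
    {S : ℕ → V →L[ℝ] V} {C : ℝ} (hC : ∀ n x, ‖S n x‖ ≤ C * ‖x‖)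
    (hS : ∀ x, Tendsto (fun n => S n x) atTop (𝓝 x)) {w : ℝ → V} (hw : Continuous w) (b : ℝ) :
    Tendsto (fun n => eLpNorm (fun t => S n (w t) - w t) 2 (timeMeasure b)) atTop (𝓝 0) := by
  obtain ⟨M, hM⟩ := (isCompact_Icc (a := (0 : ℝ)) (b := b)).exists_bound_of_continuousOn
    hw.continuousOn
  have hC0 : ∀ n t, t ∈ Ioo 0 b → ‖S n (w t) - w t‖ ≤ |C| * M + M := by
    intro n t ht
    have h1 := hM t (mem_Icc.2 ⟨ht.1.le, ht.2.le⟩)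
    refine (norm_sub_le (S n (w t)) (w t)).trans (add_le_add ((hC n (w t)).trans ?_) h1)
    exact (mul_le_mul_of_nonneg_right (le_abs_self C) (norm_nonneg (w t))).trans
      (mul_le_mul_of_nonneg_left h1 (abs_nonneg C))
  have hsq : Tendsto (fun n => eLpNorm (fun t => S n (w t) - w t) 2 (timeMeasure b) ^ 2) atTop
      (𝓝 0) := by
    simp only [eLpNorm_two_sq]
    have h0 : ∫⁻ _ in Ioo 0 b, (0 : ℝ≥0∞) = 0 := lintegral_zero
    rw [← h0]
    refine tendsto_lintegral_of_dominated_convergence' (fun _ => ENNReal.ofReal (|C| * M + M) ^ 2)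
      (fun n => ?_) (fun n => ?_) ?_ (ae_of_all _ fun t => ?_)
    · exact ((((S n).continuous.comp hw).sub hw).aestronglyMeasurable.enorm).pow_const 2
    · filter_upwards [self_mem_ae_restrict (measurableSet_Ioo (a := (0 : ℝ)) (b := b))] with t ht
      rw [← ofReal_norm]
      exact pow_le_pow_left' (ENNReal.ofReal_le_ofReal (hC0 n t ht)) 2
    · rw [lintegral_const]
      exact ENNReal.mul_ne_top (by simp) (measure_ne_top _ _)
    · have h1 : Tendsto (fun n => S n (w t) - w t) atTop (𝓝 0) := by
        have := (hS (w t)).sub_const (w t)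
        rwa [sub_self] at this
      have h2 := ((continuous_enorm.tendsto (0 : V)).comp h1)
      rw [enorm_zero] at h2
      have h3 := (ENNReal.continuous_pow 2).tendsto 0 |>.comp h2
      simpa [Function.comp_def] using h3
  have h3 := (ENNReal.continuous_rpow_const (y := 1 / 2)).tendsto 0 |>.comp hsq
  rw [ENNReal.zero_rpow_of_pos (by norm_num)] at h3
  refine h3.congr fun n => ?_
  change (_ ^ 2 : ℝ≥0∞) ^ (1 / 2 : ℝ) = _
  rw [← ENNReal.rpow_natCast, ← ENNReal.rpow_mul]
  norm_num

variable {d : ℕ} {Ω : Set (Space d)}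

theorem eLpNorm_val_convex {p : ℝ≥0∞} (hp : 1 ≤ p) (a b : ℝ) (ha : 0 ≤ a) (hb : 0 ≤ b)
    (x y : H10sol Ω) :
    eLpNorm (val (a • x + b • y)) p (volume.restrict Ω) ≤
      ENNReal.ofReal a * eLpNorm (val x) p (volume.restrict Ω) +
      ENNReal.ofReal b * eLpNorm (val y) p (volume.restrict Ω) := by
  have e : val (a • x + b • y) = a • val x + b • val y := by
    simp only [← valL_apply, map_add, map_smul]
  rw [e, eLpNorm_congr_ae (Lp.coeFn_add _ _)]
  refine (eLpNorm_add_le (Lp.aestronglyMeasurable _) (Lp.aestronglyMeasurable _) hp).trans ?_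
  rw [eLpNorm_congr_ae (Lp.coeFn_smul a (val x)), eLpNorm_congr_ae (Lp.coeFn_smul b (val y)),
    eLpNorm_const_smul, eLpNorm_const_smul, Real.enorm_eq_ofReal ha, Real.enorm_eq_ofReal hb]

theorem eLpNorm_val_zero (p : ℝ≥0∞) :
    eLpNorm (val (0 : H10sol Ω)) p (volume.restrict Ω) = 0 := by
  have e : val (0 : H10sol Ω) = 0 := by rw [← valL_apply, map_zero]
  rw [e, eLpNorm_congr_ae (Lp.coeFn_zero _ _ _), eLpNorm_zero]

theorem eventually_rpow_mul_le {c : ℕ → ℝ≥0∞} (hc : Tendsto c atTop (𝓝 1)) (q : ℝ) {X ε : ℝ≥0∞}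
    (hX : X ≠ ⊤) (hε : ε ≠ 0) : ∀ᶠ n in atTop, c n ^ q * X ≤ X + ε := by
  have h1 : Tendsto (fun n => c n ^ q * X) atTop (𝓝 (1 ^ q * X)) :=
    ENNReal.Tendsto.mul_const (((ENNReal.continuous_rpow_const (y := q)).tendsto 1).comp hc)
      (Or.inr hX)
  rw [ENNReal.one_rpow, one_mul] at h1
  exact (h1.eventually (gt_mem_nhds (ENNReal.lt_add_right hX hε))).mono fun n hn => hn.le

theorem tendsto_ofReal_one_add_sq :
    Tendsto (fun n : ℕ => ENNReal.ofReal ((1 + 1 / ((n : ℝ) + 1)) ^ 2)) atTop (𝓝 1) := by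
  have h := ((tendsto_one_div_add_atTop_nhds_zero_nat (𝕜 := ℝ)).const_add 1).pow 2
  simpa [Function.comp_def] using (ENNReal.continuous_ofReal.tendsto _).comp h

/-- Lower semicontinuous convex functions that vanish at the origin. -/
def IsConvexGauge {V : Type*} [NormedAddCommGroup V] [NormedSpace ℝ V] (N : V → ℝ≥0∞) : Prop :=
  LowerSemicontinuous N ∧ (∀ a b : ℝ, 0 ≤ a → 0 ≤ b → a + b = 1 → ∀ x y,
    N (a • x + b • y) ≤ ENNReal.ofReal a * N x + ENNReal.ofReal b * N y) ∧ N 0 = 0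

theorem lintegral_comp_rpow_le {V : Type*} {N : V → ℝ≥0∞} {c : ℝ≥0∞} (hc : c ≠ ⊤) {S : V → V}
    (hS : ∀ u, N (S u) ≤ c * N u) (w : ℝ → V) {q : ℝ} (hq : 0 ≤ q) (b : ℝ) :
    ∫⁻ t in Ioo 0 b, N (S (w t)) ^ q ≤ c ^ q * ∫⁻ t in Ioo 0 b, N (w t) ^ q := by
  rw [← lintegral_const_mul' _ _ (ENNReal.rpow_ne_top_of_nonneg hq hc)]
  refine lintegral_mono fun t => ?_
  rw [← ENNReal.mul_rpow_of_nonneg _ _ hq]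
  exact ENNReal.rpow_le_rpow (hS (w t)) hq

/-- Weak evolutions can be approximated by smooth curves in the range of smoothing operators, with
control of the equation, of the initial value and of two convex functionals. -/
theorem IsWeakEvolution.exists_approx {V H : Type*} [NormedAddCommGroup V] [InnerProductSpace ℝ V]
    [CompleteSpace V] [NormedAddCommGroup H] [InnerProductSpace ℝ H] [CompleteSpace H]
    {L : V →L[ℝ] H} {T : ℝ} {v g : ℝ → V} {v₀ : H} (hw : IsWeakEvolution T L v g v₀)
    (hv : MemLp v 2 (timeMeasure T)) (hg : MemLp g 2 (timeMeasure T))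
    (hv₀ : v₀ ∈ closure (range L)) {J : V →L[ℝ] V}
    (hJ' : ∀ x z, inner ℝ (J x) z = inner ℝ (L x) (L z)) {A : ℕ → V →L[ℝ] V} {C : ℝ} (hC : ∀ n x, ‖A n x‖ ≤ C * ‖x‖)
    (hS : ∀ x, Tendsto (fun n => A n x) atTop (𝓝 x)) {c : ℕ → ℝ≥0∞} (hct : ∀ n, c n ≠ ⊤)
    (hc : Tendsto c atTop (𝓝 1)) {N₁ N₂ : V → ℝ≥0∞} (hN₁ : IsConvexGauge N₁)
    (hN₂ : IsConvexGauge N₂) (hS₁ : ∀ n x, N₁ (A n x) ≤ c n * N₁ x)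
    (hS₂ : ∀ n x, N₂ (A n x) ≤ c n * N₂ x) {q₁ q₂ : ℝ} (hq₁ : 1 ≤ q₁) (hq₂ : 1 ≤ q₂)
    (h₁ : ∫⁻ t in Ioo 0 T, N₁ (v t) ^ q₁ < ⊤) (h₂ : ∫⁻ t in Ioo 0 T, N₂ (v t) ^ q₂ < ⊤)
    {b ε : ℝ} (hb0 : 0 < b) (hb : b < T) (hε : 0 < ε) :
    ∃ (n : ℕ) (u : ℝ → V), ContDiff ℝ 1 u ∧
      ∫⁻ t in Ioo 0 T, N₁ (A n (u t)) ^ q₁ < ⊤ ∧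
      eLpNorm (fun t => A n (u t) - v t) 2 (timeMeasure b) ≤ ENNReal.ofReal ε ∧
      eLpNorm (fun t => J (A n (deriv u t)) - g t) 2 (timeMeasure b) ≤
        ENNReal.ofReal ε ∧
      ‖L (A n (u 0)) - v₀‖ ≤ ε ∧
      ∫⁻ t in Ioo 0 b, N₁ (A n (u t)) ^ q₁ ≤
        (∫⁻ t in Ioo 0 b, N₁ (v t) ^ q₁) + ENNReal.ofReal ε ∧
      ∫⁻ t in Ioo 0 b, N₂ (A n (u t)) ^ q₂ ≤
        (∫⁻ t in Ioo 0 b, N₂ (v t) ^ q₂) + ENNReal.ofReal ε := by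
  have hε2 : 0 < ε / 2 := by linarith
  have hε2e : ENNReal.ofReal (ε / 2) ≠ 0 := (ENNReal.ofReal_pos.2 hε2).ne'
  have hεadd : ENNReal.ofReal (ε / 2) + ENNReal.ofReal (ε / 2) = ENNReal.ofReal ε := by
    rw [← ENNReal.ofReal_add hε2.le hε2.le, add_halves]
  obtain ⟨δ₁, hδ₁, H1⟩ := exists_eLpNorm_mollify_sub_le (p := 2) (by norm_num) (by norm_num)
    (memLp_extendTime hv) hε2e
  obtain ⟨δ₂, hδ₂, H2⟩ := exists_eLpNorm_mollify_sub_le (p := 2) (by norm_num) (by norm_num)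
    (memLp_extendTime hg) hε2e
  obtain ⟨δ₃, hδ₃, H3⟩ := hw.exists_norm_mollify_zero_sub_le hv hg hv₀ hε2 (hb0.trans hb)
  obtain ⟨δ₄, hδ₄, H4⟩ := exists_lintegral_convex_mollify_le hN₁.1 hN₁.2.1 hN₁.2.2 hv hq₁ h₁ (b := b) hε2e
  obtain ⟨δ₅, hδ₅, H5⟩ := exists_lintegral_convex_mollify_le hN₂.1 hN₂.2.1 hN₂.2.2 hv hq₂ h₂ (b := b) hε2e
  -- The kernel is fixed before the index `n`: the spatial operators converge only strongly, so `n`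
  -- has to depend on the mollified curve and its derivative.
  obtain ⟨δ, hδ0, hδ⟩ : ∃ δ > 0, δ ≤ δ₁ ∧ δ ≤ δ₂ ∧ δ ≤ δ₃ ∧ δ ≤ δ₄ ∧ δ ≤ δ₅ ∧ δ ≤ T - b := by
    have hpos : 0 < min δ₁ (min δ₂ (min δ₃ (min δ₄ (min δ₅ (T - b))))) := by
      simp only [lt_min_iff]
      exact ⟨hδ₁, hδ₂, hδ₃, hδ₄, hδ₅, sub_pos.2 hb⟩
    refine ⟨_, hpos, ?_⟩
    simpa only [le_min_iff] using le_refl (min δ₁ (min δ₂ (min δ₃ (min δ₄ (min δ₅ (T - b))))))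
  obtain ⟨ρ, hρ, hneg⟩ := exists_isKernel_of_neg hδ0
  have G1 := H1 δ ρ hδ.1 hρ
  have G2 := H2 δ ρ hδ.2.1 hρ
  have G3 := H3 δ ρ hδ.2.2.1 hρ hneg
  have G4 := H4 δ ρ hδ.2.2.2.1 hρ hneg
  have G5 := H5 δ ρ hδ.2.2.2.2.1 hρ hneg
  set u := mollify ρ (extendTime T v) with hu
  have hucd : ContDiff ℝ 1 u := (contDiff_mollify_extendTime hv hρ).of_le (by simp)
  have huc : Continuous u := hucd.continuous
  have hu'c : Continuous (deriv u) := hucd.continuous_deriv le_rfl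
  have hJ : ∀ x, L.adjoint (L x) = J x := fun x => ext_inner_right ℝ fun z => by
    rw [ContinuousLinearMap.adjoint_inner_left, hJ']
  have hIoo : Ioo 0 b ⊆ Ioo 0 T := Ioo_subset_Ioo_right hb.le
  have hext : ∀ w : ℝ → V, ∀ t ∈ Ioo 0 b, extendTime T w t = w t := fun w t ht =>
    indicator_of_mem (hIoo ht) _
  have hae : ∀ᵐ t ∂(timeMeasure b), t ∈ Ioo 0 b := ae_restrict_mem measurableSet_Ioo
  have hfin₄ : ∫⁻ t in Ioo 0 b, N₁ (u t) ^ q₁ ≠ ⊤ :=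
    ((lintegral_mono_set hIoo).trans_lt G4.1).ne
  have hfin₅ : ∫⁻ t in Ioo 0 b, N₂ (u t) ^ q₂ ≠ ⊤ :=
    ((lintegral_mono_set hIoo).trans_lt G5.1).ne
  have hε2n : 0 < ENNReal.ofReal (ε / 2) := ENNReal.ofReal_pos.2 hε2
  have E1 : ∀ᶠ n in atTop, eLpNorm (fun t => A n (u t) - u t) 2 (timeMeasure b) ≤
      ENNReal.ofReal (ε / 2) :=
    ((tendsto_eLpNorm_comp_sub hC hS huc b).eventually (gt_mem_nhds hε2n)).mono fun n h => h.le
  have E2 : ∀ᶠ n in atTop, ENNReal.ofReal ‖J‖ *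
      eLpNorm (fun t => A n (deriv u t) - deriv u t) 2 (timeMeasure b) ≤
      ENNReal.ofReal (ε / 2) := by
    have h0 := ENNReal.Tendsto.const_mul (a := ENNReal.ofReal ‖J‖)
      (tendsto_eLpNorm_comp_sub hC hS hu'c b) (Or.inr ENNReal.ofReal_ne_top)
    rw [mul_zero] at h0
    exact (h0.eventually (gt_mem_nhds hε2n)).mono fun n h => h.le
  have E3 : ∀ᶠ n in atTop, ‖L (A n (u 0)) - L (u 0)‖ ≤ ε / 2 := by
    have h0 := (((L).continuous.tendsto _).comp (hS (u 0)))
    exact ((tendsto_iff_norm_sub_tendsto_zero.1 h0).eventually (gt_mem_nhds hε2)).mono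
      fun n h => h.le
  have E4 := eventually_rpow_mul_le hc q₁ hfin₄ hε2e
  have E5 := eventually_rpow_mul_le hc q₂ hfin₅ hε2e
  obtain ⟨n, F1, F2, F3, F4, F5⟩ := (E1.and (E2.and (E3.and (E4.and E5)))).exists
  refine ⟨n, u, hucd, ?_, ?_, ?_, ?_, ?_, ?_⟩
  · exact (lintegral_comp_rpow_le (hct n) (hS₁ n) u
      (by linarith) T).trans_lt (ENNReal.mul_lt_top
        (ENNReal.rpow_lt_top_of_nonneg (by linarith) (hct n)) G4.1)
  · have e : eLpNorm (fun t => A n (u t) - v t) 2 (timeMeasure b) =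
        eLpNorm ((fun t => A n (u t) - u t) + (u - extendTime T v)) 2 (timeMeasure b) := by
      refine eLpNorm_congr_ae ?_
      filter_upwards [hae] with t ht
      rw [Pi.add_apply, Pi.sub_apply, hext v t ht]
      abel
    rw [e, ← hεadd]
    refine (eLpNorm_add_le ?_ ?_ (by norm_num)).trans (add_le_add F1 ?_)
    · exact (((A n).continuous.comp huc).sub huc).aestronglyMeasurable
    · exact huc.aestronglyMeasurable.sub (memLp_extendTime hv).1.restrict
    · exact (eLpNorm_mono_measure _ Measure.restrict_le_self).trans G1
  -- Since `J u' = ρ ⋆ g` on `(0, b)`, the error is `J (A u' - u') + (ρ ⋆ g - g)`; spatial smoothing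
  -- and the equation need not commute.
  · have e : eLpNorm (fun t => J (A n (deriv u t)) - g t) 2
        (timeMeasure b) = eLpNorm ((fun t => J (A n (deriv u t) - deriv u t)) +
          (mollify ρ (extendTime T g) - extendTime T g)) 2 (timeMeasure b) := by
      refine eLpNorm_congr_ae ?_
      filter_upwards [hae] with t ht
      rw [Pi.add_apply, Pi.sub_apply, hext g t ht,
        ← hw.deriv_mollify hv hg hρ hneg ht.1.le (by linarith [ht.2, hδ.2.2.2.2.2]), hJ, map_sub, sub_add_sub_cancel]
    rw [e, ← hεadd]
    refine (eLpNorm_add_le ?_ ?_ (by norm_num)).trans (add_le_add ?_ ?_)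
    · exact (J.continuous.comp (((A n).continuous.comp hu'c).sub hu'c)).aestronglyMeasurable
    · exact (contDiff_mollify_extendTime hg hρ).continuous.aestronglyMeasurable.sub
        (memLp_extendTime hg).1.restrict
    · exact (eLpNorm_le_mul_eLpNorm_of_ae_le_mul
        (ae_of_all _ fun t => J.le_opNorm (A n (deriv u t) - deriv u t)) 2).trans F2
    · exact (eLpNorm_mono_measure _ Measure.restrict_le_self).trans G2
  · have h0 := norm_sub_le_norm_sub_add_norm_sub (L (A n (u 0))) (L (u 0)) v₀
    linarith
  · refine (lintegral_comp_rpow_le (hct n) (hS₁ n) u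
      (by linarith) b).trans (F4.trans ?_)
    rw [← hεadd, ← add_assoc]
    exact add_le_add (G4.2 hb.le) le_rfl
  · refine (lintegral_comp_rpow_le (hct n) (hS₂ n) u
      (by linarith) b).trans (F5.trans ?_)
    rw [← hεadd, ← add_assoc]
    exact add_le_add (G5.2 hb.le) le_rfl

theorem isConvexGauge_eLpNorm_val {p : ℝ≥0∞} (hp : 1 ≤ p) :
    IsConvexGauge fun u : H10sol Ω => eLpNorm (val u) p (volume.restrict Ω) :=
  ⟨lowerSemicontinuous_eLpNorm_val p, fun a b ha hb _ => eLpNorm_val_convex hp a b ha hb,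
    eLpNorm_val_zero p⟩

theorem exists_smoothing_operators (hΩ : IsLipschitzDomain Ω) :
    ∃ (A : ℕ → H10sol Ω →L[ℝ] H10sol Ω) (S : ℕ → H10sol Ω → SolTestField Ω) (C : ℝ),
      (∀ n x, solToH (S n x) = A n x) ∧ (∀ n x, ‖A n x‖ ≤ C * ‖x‖) ∧
      (∀ x, Tendsto (fun n => A n x) atTop (𝓝 x)) ∧
      ∀ p, 1 ≤ p → ∀ n x, eLpNorm (val (A n x)) p (volume.restrict Ω) ≤
        ENNReal.ofReal ((1 + 1 / ((n : ℝ) + 1)) ^ 2) * eLpNorm (val x) p (volume.restrict Ω) :=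
  (exists_smoothing hΩ).elim fun S h => h.1.elim fun C hC =>
    ⟨fun n => ((solToHₗ Ω).comp (S n)).mkContinuous C (hC.2 n), fun n => S n, C, fun _ _ => rfl,
      hC.2, h.2.1, fun p hp n x => h.2.2 n x p hp⟩

/-- Weak evolutions can be approximated by smooth curves with values in the test fields, with
control of the equation, of the initial value and of Lebesgue norms. -/
theorem IsWeakEvolution.exists_approx_solTestField (hΩ : IsLipschitzDomain Ω) {T : ℝ}
    {v g : ℝ → H10sol Ω} {v₀ : L2 Ω (Space d)} (hw : IsWeakEvolution T (valL Ω) v g v₀) (hv : MemLp v 2 (timeMeasure T))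
    (hg : MemLp g 2 (timeMeasure T)) (hv₀ : v₀ ∈ closure (range (valL Ω)))
    {J : H10sol Ω →L[ℝ] H10sol Ω} (hJ : ∀ x z, inner ℝ (J x) z = inner ℝ (val x) (val z))
    {p₁ p₂ : ℝ≥0∞} {q₁ q₂ : ℝ} (hp₁ : 1 ≤ p₁) (hp₂ : 1 ≤ p₂) (hq₁ : 1 ≤ q₁) (hq₂ : 1 ≤ q₂)
    (h₁ : ∫⁻ t in Ioo 0 T, eLpNorm (val (v t)) p₁ (volume.restrict Ω) ^ q₁ < ⊤)
    (h₂ : ∫⁻ t in Ioo 0 T, eLpNorm (val (v t)) p₂ (volume.restrict Ω) ^ q₂ < ⊤)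
    {b ε : ℝ} (hb0 : 0 < b) (hb : b < T) (hε : 0 < ε) :
    ∃ (S : H10sol Ω →L[ℝ] H10sol Ω) (S' : H10sol Ω → SolTestField Ω) (u : ℝ → H10sol Ω),
      (∀ x, solToH (S' x) = S x) ∧ ContDiff ℝ 1 u ∧
      ∫⁻ t in Ioo 0 T, eLpNorm (val (S (u t))) p₁ (volume.restrict Ω) ^ q₁ < ⊤ ∧
      eLpNorm (fun t => S (u t) - v t) 2 (timeMeasure b) ≤ ENNReal.ofReal ε ∧
      eLpNorm (fun t => J (S (deriv u t)) - g t) 2 (timeMeasure b) ≤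
        ENNReal.ofReal ε ∧
      ‖val (S (u 0)) - v₀‖ ≤ ε ∧
      ∫⁻ t in Ioo 0 b, eLpNorm (val (S (u t))) p₁ (volume.restrict Ω) ^ q₁ ≤
        (∫⁻ t in Ioo 0 b, eLpNorm (val (v t)) p₁ (volume.restrict Ω) ^ q₁) + ENNReal.ofReal ε ∧
      ∫⁻ t in Ioo 0 b, eLpNorm (val (S (u t))) p₂ (volume.restrict Ω) ^ q₂ ≤
        (∫⁻ t in Ioo 0 b, eLpNorm (val (v t)) p₂ (volume.restrict Ω) ^ q₂) + ENNReal.ofReal ε := by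
  obtain ⟨A, S, C, hA, hC, hS, hSp⟩ := exists_smoothing_operators hΩ
  have key := IsWeakEvolution.exists_approx (V := H10sol Ω) (H := L2 Ω (Space d))
    (L := valL Ω) hw hv hg hv₀ hJ hC hS (fun _ => ENNReal.ofReal_ne_top) tendsto_ofReal_one_add_sq
    (isConvexGauge_eLpNorm_val hp₁) (isConvexGauge_eLpNorm_val hp₂) (hSp p₁ hp₁) (hSp p₂ hp₂)
    hq₁ hq₂ h₁ h₂ hb0 hb hε
  exact key.elim fun n h => h.elim fun u h' => ⟨A n, S n, u, hA n, h'⟩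

end SmoothApproximation

/-! ### Weak solutions as weak evolutions -/

section Abstract

variable {V H : Type*} [NormedAddCommGroup V] [InnerProductSpace ℝ V] [CompleteSpace V]
  [NormedAddCommGroup H] [InnerProductSpace ℝ H] [CompleteSpace H]

theorem exists_adjoint (L : V →L[ℝ] H) :
    ∃ G : H →L[ℝ] V, ∀ x z, inner ℝ (G x) z = inner ℝ x (L z) :=
  ⟨L.adjoint, fun x z => L.adjoint_inner_left z x⟩

theorem exists_riesz {W : Type*} [NormedAddCommGroup W] [NormedSpace ℝ W] (i : V →ₗ[ℝ] W)
    (hi : ∀ x, ‖i x‖ ≤ ‖x‖) :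
    ∃ R : StrongDual ℝ W →L[ℝ] V, ∀ f z, inner ℝ (R f) z = f (i z) := by
  set I : V →L[ℝ] W := i.mkContinuous 1 fun x => by rw [one_mul]; exact hi x with hI
  let R : StrongDual ℝ W →ₗ[ℝ] V :=
    { toFun := fun f => (InnerProductSpace.toDual ℝ V).symm (f.comp I)
      map_add' := fun f g => by rw [ContinuousLinearMap.add_comp, map_add]
      map_smul' := fun c f => by simp }
  refine ⟨R.mkContinuous ‖I‖ fun f => ?_, fun f z => InnerProductSpace.toDual_symm_apply⟩
  change ‖(InnerProductSpace.toDual ℝ V).symm (f.comp I)‖ ≤ _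
  rw [LinearIsometryEquiv.norm_map, mul_comm]
  exact f.opNorm_comp_le I

theorem integrable_smul_of_continuous {T : ℝ} {θ : ℝ → ℝ} (hθ : Continuous θ) {w : ℝ → V}
    (hw : MemLp w 2 (timeMeasure T)) : Integrable (fun t => θ t • w t) (timeMeasure T) := by
  obtain ⟨M, hM⟩ := (isCompact_Icc (a := (0 : ℝ)) (b := T)).exists_bound_of_continuousOn
    hθ.continuousOn
  refine ((hw.integrable (by norm_num)).norm.const_mul M).mono'
    (hθ.aestronglyMeasurable.smul hw.1) ?_
  filter_upwards [ae_restrict_mem measurableSet_Ioo] with t ht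
  rw [norm_smul]
  exact mul_le_mul_of_nonneg_right (hM t (mem_Icc.2 ⟨ht.1.le, ht.2.le⟩)) (norm_nonneg _)

theorem integral_mul_inner {T : ℝ} {θ : ℝ → ℝ} (hθ : Continuous θ) {w : ℝ → V}
    (hw : MemLp w 2 (timeMeasure T)) (z : V) :
    ∫ t in Ioo 0 T, θ t * inner ℝ z (w t) = inner ℝ z (∫ t in Ioo 0 T, θ t • w t) := by
  rw [← integral_inner (integrable_smul_of_continuous hθ hw)]
  simp only [inner_smul_right]

theorem integral_mul_inner_sub {T : ℝ} {θ : ℝ → ℝ} (hθ : Continuous θ) {a b : ℝ → V}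
    (ha : MemLp a 2 (timeMeasure T)) (hb : MemLp b 2 (timeMeasure T)) (z : V) :
    ∫ t in Ioo 0 T, θ t * inner ℝ z (a t - b t) =
      (∫ t in Ioo 0 T, θ t * inner ℝ z (a t)) - ∫ t in Ioo 0 T, θ t * inner ℝ z (b t) := by
  have h := integral_mul_inner hθ (ha.sub hb) z
  simp only [Pi.sub_apply] at h
  rw [h, integral_mul_inner hθ ha, integral_mul_inner hθ hb, ← inner_sub_right,
    ← integral_sub (integrable_smul_of_continuous hθ ha) (integrable_smul_of_continuous hθ hb)]
  simp only [smul_sub]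

/-- For fixed `θ` both sides are inner products of `z` or `L z` with fixed vectors, so the equation
is a closed condition on `z`. -/
theorem isWeakEvolution_of_denseRange {L : V →L[ℝ] H} {T : ℝ} {v g : ℝ → V} {v₀ : H} {ι : Type*}
    {D : ι → V} (hD : DenseRange D) (hv : MemLp v 2 (timeMeasure T))
    (hg : MemLp g 2 (timeMeasure T))
    (h : ∀ θ : ℝ → ℝ, ContDiff ℝ 1 θ → (∃ T' < T, ∀ t, T' ≤ t → θ t = 0) → ∀ i,
      - ∫ t in Ioo 0 T, deriv θ t * inner ℝ (L (D i)) (L (v t)) =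
        (∫ t in Ioo 0 T, θ t * inner ℝ (D i) (g t)) + θ 0 * inner ℝ (L (D i)) v₀) :
    IsWeakEvolution T L v g v₀ := by
  intro θ hθ hT z
  refine hD.induction_on (p := fun z => - ∫ t in Ioo 0 T, deriv θ t * inner ℝ (L z) (L (v t)) =
        (∫ t in Ioo 0 T, θ t * inner ℝ z (g t)) + θ 0 * inner ℝ (L z) v₀) z ?_ (h θ hθ hT)
  have hLv : MemLp (fun t => L (v t)) 2 (timeMeasure T) := L.comp_memLp' hv
  have e1 : ∀ z, ∫ t in Ioo 0 T, deriv θ t * inner ℝ (L z) (L (v t)) = _ := fun z =>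
    integral_mul_inner (hθ.continuous_deriv le_rfl) hLv (L z)
  simp only [e1, integral_mul_inner hθ.continuous hg]
  refine isClosed_eq ?_ ?_ <;> fun_prop

theorem isWeakEvolution_sub_of_denseRange {L : V →L[ℝ] H} {T : ℝ} {v a b : ℝ → V} {v₀ : H}
    {ι : Type*} {D : ι → V} (hD : DenseRange D) (hv : MemLp v 2 (timeMeasure T))
    (ha : MemLp a 2 (timeMeasure T)) (hb : MemLp b 2 (timeMeasure T))
    (h : ∀ θ : ℝ → ℝ, ContDiff ℝ 1 θ → (∃ T' < T, ∀ t, T' ≤ t → θ t = 0) → ∀ i,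
      - (∫ t in Ioo 0 T, deriv θ t * inner ℝ (L (D i)) (L (v t))) +
        (∫ t in Ioo 0 T, θ t * inner ℝ (D i) (b t)) =
        (∫ t in Ioo 0 T, θ t * inner ℝ (D i) (a t)) + θ 0 * inner ℝ (L (D i)) v₀) :
    IsWeakEvolution T L v (fun t => a t - b t) v₀ := by
  refine isWeakEvolution_of_denseRange hD hv (ha.sub hb) fun θ hθ hT i => ?_
  rw [integral_mul_inner_sub hθ.continuous ha hb]
  linarith [h θ hθ hT i]

theorem memLp_comp_dual {W : Type*} [NormedAddCommGroup W] [NormedSpace ℝ W]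
    (R : StrongDual ℝ W →L[ℝ] V) {T : ℝ} {f : ℝ → StrongDual ℝ W}
    (hf : MemLp f 2 (timeMeasure T)) : MemLp (fun t => R (f t)) 2 (timeMeasure T) :=
  R.comp_memLp' hf

theorem memLp_smul_comp_sub_comp (G : H →L[ℝ] V) (ν : ℝ) {T : ℝ} {a b : ℝ → H}
    (ha : MemLp a 2 (timeMeasure T)) (hb : MemLp b 2 (timeMeasure T)) :
    MemLp (fun t => ν • G (a t) - G (b t)) 2 (timeMeasure T) :=
  ((G.comp_memLp' ha).const_smul ν).sub (G.comp_memLp' hb)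

end Abstract

/-! ### Riesz representatives of the terms of the equation, and their integrability. -/

section Concrete

variable {d : ℕ} {Ω : Set (Space d)}

/-- The operator `z ↦ ⟨val x, val z⟩` of the `L²` inner product on `H¹_{0,σ}`. -/
noncomputable def massL (Ω : Set (Space d)) : H10sol Ω →L[ℝ] H10sol Ω :=
  ((exists_adjoint (V := H10sol Ω) (H := L2 Ω (Space d)) (valL Ω)).choose).comp (valL Ω)

theorem inner_massL (x z : H10sol Ω) : inner ℝ (massL Ω x) z = inner ℝ (val x) (val z) :=
  (exists_adjoint (V := H10sol Ω) (H := L2 Ω (Space d)) (valL Ω)).choose_spec (val x) z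

/-- The adjoint of the weak gradient. -/
noncomputable def gradAdj (Ω : Set (Space d)) : L2 Ω (Mat d) →L[ℝ] H10sol Ω :=
  (exists_adjoint (V := H10sol Ω) (H := L2 Ω (Mat d)) (wgradL Ω)).choose

theorem inner_gradAdj (x : L2 Ω (Mat d)) (z : H10sol Ω) :
    inner ℝ (gradAdj Ω x) z = inner ℝ x (wgrad z) :=
  (exists_adjoint (V := H10sol Ω) (H := L2 Ω (Mat d)) (wgradL Ω)).choose_spec x z

/-- The Riesz representative in `H¹_{0,σ}` of an element of `H⁻¹`. -/
noncomputable def riesz (Ω : Set (Space d)) : Hneg1 Ω →L[ℝ] H10sol Ω :=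
  (exists_riesz (V := H10sol Ω) (W := H10 Ω) (Submodule.inclusion (H10sol_le_H10 Ω))
    fun _ => le_rfl).choose

theorem inner_riesz (f : Hneg1 Ω) (z : H10sol Ω) : inner ℝ (riesz Ω f) z = pair f z :=
  (exists_riesz (V := H10sol Ω) (W := H10 Ω) (Submodule.inclusion (H10sol_le_H10 Ω))
    fun _ => le_rfl).choose_spec f z

theorem MemX.exists_enorm_val_le {T : ℝ} {v : ℝ → H10sol Ω} (hv : MemX T v) :
    ∃ M : ℝ≥0∞, M ≠ ⊤ ∧ ∀ᵐ t ∂(timeMeasure T), ‖val (v t)‖ₑ ≤ M :=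
  ⟨_, hv.memLp_L2.2.ne, by
    rw [eLpNorm_exponent_top]
    exact enorm_ae_le_eLpNormEssSup _ _⟩

theorem MemX.memLp_wgrad {T : ℝ} {v : ℝ → H10sol Ω} (hv : MemX T v) :
    MemLp (fun t => wgrad (v t)) 2 (timeMeasure T) :=
  (wgradL Ω).comp_memLp' hv.memLp_H1

/-- Fields in `𝕏` that satisfy the Serrin condition are in `L⁴(0, T; L⁴)`. -/
theorem MemX.memLsLr_four {T s : ℝ} {r : ℝ≥0∞} {v : ℝ → H10sol Ω} (hv : MemX T v)
    (hΩ : Bornology.IsBounded Ω) (hd : 2 ≤ d) (hs : 0 < s)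
    (hsr : 2 / ENNReal.ofReal s + (d : ℝ≥0∞) / r ≤ 1) (hr : MemLsLr T s r v) :
    MemLsLr T 4 4 v := by
  obtain ⟨C, hC, hb⟩ := exists_eLpNorm_four_le (Ω := Ω) hΩ hd hs hsr
  obtain ⟨M, hM, hv2⟩ := hv.exists_enorm_val_le
  have hc : C * (1 + M ^ 2) ≠ ⊤ :=
    ENNReal.mul_ne_top hC (ENNReal.add_ne_top.2 ⟨by simp, ENNReal.pow_ne_top hM⟩)
  have hm : AEMeasurable (fun t => eLpNorm (val (v t)) r (volume.restrict Ω)) (timeMeasure T) :=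
    aemeasurable_eLpNorm r hv.memLp_L2.1
  have h1 : ∫⁻ t in Ioo 0 T, eLpNorm (val (v t)) 4 (volume.restrict Ω) ^ (4 : ℝ) ≤
      ∫⁻ t in Ioo 0 T, C * (1 + M ^ 2) * (1 + eLpNorm (val (v t)) r (volume.restrict Ω) ^ s +
        ‖wgrad (v t)‖ₑ ^ 2) := by
    refine lintegral_mono_ae ?_
    filter_upwards [hv2] with t ht
    have e : eLpNorm (val (v t)) 4 (volume.restrict Ω) ^ (4 : ℝ) =
        eLpNorm (val (v t)) 4 (volume.restrict Ω) ^ 4 := by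
      rw [← ENNReal.rpow_natCast]
      norm_num
    rw [e]
    refine (hb (v t)).trans ?_
    gcongr
  refine h1.trans_lt ?_
  rw [lintegral_const_mul' _ _ hc]
  refine ENNReal.mul_lt_top hc.lt_top ?_
  have hwm : AEMeasurable (fun t => ‖wgrad (v t)‖ₑ ^ 2) (timeMeasure T) :=
    hv.memLp_wgrad.1.enorm.pow_const 2
  rw [lintegral_add_right' _ hwm, lintegral_add_right' _ (hm.pow_const s), lintegral_const,
    ← eLpNorm_two_sq]
  refine ENNReal.add_lt_top.2 ⟨ENNReal.add_lt_top.2 ⟨?_, hr⟩, ENNReal.pow_lt_top hv.memLp_wgrad.2⟩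
  rw [one_mul]
  exact measure_lt_top _ _

theorem MemX.ae_eLpNorm_lt_top {T s : ℝ} {r : ℝ≥0∞} {v : ℝ → H10sol Ω} (hv : MemX T v)
    (hs : 0 < s) (hr : MemLsLr T s r v) :
    ∀ᵐ t ∂(timeMeasure T), eLpNorm (val (v t)) r (volume.restrict Ω) < ⊤ := by
  have hm : AEMeasurable (fun t => eLpNorm (val (v t)) r (volume.restrict Ω)) (timeMeasure T) :=
    aemeasurable_eLpNorm r hv.memLp_L2.1
  filter_upwards [ae_lt_top' (hm.pow_const s) hr.ne] with t ht
  exact (ENNReal.rpow_lt_top_iff_of_pos hs).1 ht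

theorem enorm_tens_sq_rpow {u : L2 Ω (Space d)} (hu : eLpNorm u 4 (volume.restrict Ω) < ⊤) :
    ‖tens u‖ₑ ^ 2 = eLpNorm u 4 (volume.restrict Ω) ^ (4 : ℝ) := by
  rw [enorm_tens_sq hu, ← ENNReal.rpow_natCast]
  norm_num

/-- As `|v ⊗ v| = |v|²`, the norm in `L²(0,T;L²)` is the square of the norm in `L⁴(0,T;L⁴)`. -/
theorem MemX.memLp_tens {T : ℝ} {v : ℝ → H10sol Ω} (hv : MemX T v) (h4 : MemLsLr T 4 4 v) :
    MemLp (fun t => tens (val (v t))) 2 (timeMeasure T) := by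
  have hae := hv.ae_eLpNorm_lt_top (by norm_num) h4
  refine ⟨aestronglyMeasurable_tens hv.memLp_L2.1 hae, ?_⟩
  have h1 : eLpNorm (fun t => tens (val (v t))) 2 (timeMeasure T) ^ 2 < ⊤ := by
    rw [eLpNorm_two_sq]
    refine lt_of_le_of_lt (lintegral_mono_ae ?_) h4
    filter_upwards [hae] with t ht
    rw [enorm_tens_sq_rpow ht]
  by_contra hne
  rw [not_lt, top_le_iff] at hne
  rw [hne] at h1
  simp at h1

/-- The representative in `H¹_{0,σ}` of the time derivative of a solution. -/
noncomputable def flux (ν : ℝ) (f : ℝ → Hneg1 Ω) (v : ℝ → H10sol Ω) (t : ℝ) : H10sol Ω :=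
  riesz Ω (f t) - (ν • gradAdj Ω (wgrad (v t)) - gradAdj Ω (tens (val (v t))))

theorem memLp_flux {T ν : ℝ} {f : ℝ → Hneg1 Ω} {v : ℝ → H10sol Ω}
    (hf : MemLp f 2 (timeMeasure T)) (hv : MemX T v) (h4 : MemLsLr T 4 4 v) :
    MemLp (flux ν f v) 2 (timeMeasure T) := by
  have h1 := memLp_comp_dual (V := H10sol Ω) (W := H10 Ω) (riesz Ω) hf
  have h2 := memLp_smul_comp_sub_comp (V := H10sol Ω) (H := L2 Ω (Mat d)) (gradAdj Ω) ν
    hv.memLp_wgrad (hv.memLp_tens h4)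
  exact h1.sub h2

theorem isTimeTest_smul {T : ℝ} {θ : ℝ → ℝ} (hθ : ContDiff ℝ 1 θ)
    (hT : ∃ T' < T, ∀ t, T' ≤ t → θ t = 0) (ψ : SolTestField Ω) :
    IsTimeTest T (fun t => θ t • ψ) (fun t => deriv θ t • ψ) := by
  have hsm : ∀ (m : ℕ) (c : ℝ) (x : Space d), iteratedFDeriv ℝ m (c • ψ).1.1 x =
      c • iteratedFDeriv ℝ m ψ.1.1 x := fun m c x =>
    iteratedFDeriv_const_smul_apply ((ψ.1.2.1.of_le (by exact_mod_cast le_top)).contDiffAt)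
  have hcont : ∀ m : ℕ, Continuous (iteratedFDeriv ℝ m ψ.1.1) := fun m =>
    ψ.1.2.1.continuous_iteratedFDeriv (by exact_mod_cast le_top)
  refine ⟨⟨tsupport ψ.1.1, ψ.1.2.2.1, ψ.1.2.2.2, fun t => ?_⟩, ?_, fun x t _ => ?_, fun m => ?_,
    fun m => ?_⟩
  · exact tsupport_smul_subset_right (fun _ => θ t) ψ.1.1
  · obtain ⟨T', h1, h2⟩ := hT
    exact ⟨T', h1, fun t ht => by rw [h2 t ht, zero_smul]⟩
  · exact ((hθ.differentiable one_ne_zero t).hasDerivAt.smul_const (ψ.1.1 x)).hasDerivWithinAt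
  · simp only [hsm]
    exact ((hθ.continuous.comp continuous_fst).smul ((hcont m).comp continuous_snd)).continuousOn
  · simp only [hsm]
    exact (((hθ.continuous_deriv le_rfl).comp continuous_fst).smul
      ((hcont m).comp continuous_snd)).continuousOn

end Concrete

/-! ### The weak formulation with separated test fields. -/

section Evolution

variable {d : ℕ} {Ω : Set (Space d)}

theorem toL2_smul (c : ℝ) (ψ : SolTestField Ω) :
    toL2 (c • ψ).1 = c • val (solToH ψ) := by
  rw [val_solToH]
  exact map_smul (toL2 (Ω := Ω)) c ψ.1

theorem solToH_smul (c : ℝ) (ψ : SolTestField Ω) : solToH (c • ψ) = c • solToH ψ :=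
  map_smul (solToHₗ Ω) c ψ

theorem wgrad_smul (c : ℝ) (z : H10sol Ω) : wgrad (c • z) = c • wgrad z :=
  map_smul (wgradL Ω) c z

theorem pair_smul (f : Hneg1 Ω) (c : ℝ) (z : H10sol Ω) : pair f (c • z) = c * pair f z :=
  (congrArg f (map_smul (Submodule.inclusion (H10sol_le_H10 Ω)) c z)).trans
    (f.map_smul c _)

theorem inner_smul_sub_eq {V : Type*} [NormedAddCommGroup V] [InnerProductSpace ℝ V] (ν : ℝ)
    (x y z : V) : inner ℝ z (ν • x - y) = ν * inner ℝ x z - inner ℝ y z := by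
  rw [inner_sub_right, inner_smul_right, real_inner_comm z x, real_inner_comm z y]

theorem inner_gradAdj_combination (ν : ℝ) (G M : L2 Ω (Mat d)) (z : H10sol Ω) :
    inner ℝ z (ν • gradAdj Ω G - gradAdj Ω M) = ν * inner ℝ G (wgrad z) - inner ℝ M (wgrad z) := by
  rw [← inner_gradAdj, ← inner_gradAdj]
  exact inner_smul_sub_eq (V := H10sol Ω) ν _ _ z

theorem inner_riesz_right (f : Hneg1 Ω) (z : H10sol Ω) : inner ℝ z (riesz Ω f) = pair f z :=
  (real_inner_comm (F := H10sol Ω) (riesz Ω f) z).trans (inner_riesz f z)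

theorem weak_form_smul {v : H10sol Ω} (hv : eLpNorm (val v) 4 (volume.restrict Ω) < ⊤) (ν c : ℝ)
    (ψ : SolTestField Ω) :
    ν * inner ℝ (wgrad v) (wgrad (solToH (c • ψ))) + conv (val v) (wgrad v) (toL2 (c • ψ).1) =
      c * (ν * inner ℝ (wgrad v) (wgrad (solToH ψ)) -
        inner ℝ (tens (val v)) (wgrad (solToH ψ))) := by
  rw [conv_toL2_eq_inner_tens hv, solToH_smul, wgrad_smul, inner_smul_right, inner_smul_right]
  ring

/-- The weak formulation against `θ(t) ψ(x)`. -/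
theorem IsWeakSolution.weak_form_mul {T ν : ℝ} {f : ℝ → Hneg1 Ω} {v₀ : L2 Ω (Space d)}
    {v : ℝ → H10sol Ω} (hv : IsWeakSolution T ν f v₀ v) (h4 : MemLsLr T 4 4 v) {θ : ℝ → ℝ}
    (hθ : ContDiff ℝ 1 θ) (hT : ∃ T' < T, ∀ t, T' ≤ t → θ t = 0) (ψ : SolTestField Ω) :
    - (∫ t in Ioo 0 T, deriv θ t * inner ℝ (val (solToH ψ)) (val (v t))) +
      (∫ t in Ioo 0 T, θ t * inner ℝ (solToH ψ)
        (ν • gradAdj Ω (wgrad (v t)) - gradAdj Ω (tens (val (v t))))) =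
      (∫ t in Ioo 0 T, θ t * inner ℝ (solToH ψ) (riesz Ω (f t))) +
        θ 0 * inner ℝ (val (solToH ψ)) v₀ := by
  have key := hv.weak_form _ _ (isTimeTest_smul hθ hT ψ)
  have e0 : inner ℝ v₀ (toL2 (θ 0 • ψ).1) = θ 0 * inner ℝ (val (solToH ψ)) v₀ := by
    rw [toL2_smul, inner_smul_right, real_inner_comm]
  have e1 : ∀ t, inner ℝ (val (v t)) (toL2 (deriv θ t • ψ).1) =
      deriv θ t * inner ℝ (val (solToH ψ)) (val (v t)) := fun t => by
    rw [toL2_smul, inner_smul_right, real_inner_comm]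
  have e3 : ∀ t, pair (f t) (solToH (θ t • ψ)) = θ t * inner ℝ (solToH ψ) (riesz Ω (f t)) :=
    fun t => by rw [solToH_smul, pair_smul, inner_riesz_right]
  simp only [e0, e1, e3] at key
  rw [← key]
  refine congrArg _ (integral_congr_ae ?_)
  filter_upwards [hv.memX.ae_eLpNorm_lt_top (by norm_num) h4] with t ht
  exact ((weak_form_smul ht ν (θ t) ψ).trans
    (congrArg (θ t * ·) (inner_gradAdj_combination ν _ _ (solToH ψ)).symm)).symm

/-- Weak solutions in `L⁴(0, T; L⁴)` are weak evolutions in `H¹_{0,σ}`. -/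
theorem IsWeakSolution.isWeakEvolution {T ν : ℝ} {f : ℝ → Hneg1 Ω} {v₀ : L2 Ω (Space d)}
    {v : ℝ → H10sol Ω} (hv : IsWeakSolution T ν f v₀ v) (hf : MemLp f 2 (timeMeasure T))
    (h4 : MemLsLr T 4 4 v) : IsWeakEvolution T (valL Ω) v (flux ν f v) v₀ :=
  isWeakEvolution_sub_of_denseRange (V := H10sol Ω) (H := L2 Ω (Space d)) denseRange_solToH
    hv.memX.memLp_H1 (memLp_comp_dual (V := H10sol Ω) (W := H10 Ω) (riesz Ω) hf)
    (memLp_smul_comp_sub_comp (V := H10sol Ω) (H := L2 Ω (Mat d)) (gradAdj Ω) ν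
      hv.memX.memLp_wgrad (hv.memX.memLp_tens h4)) fun _ hθ hT ψ => hv.weak_form_mul h4 hθ hT ψ

/-- The divergence free fields in `L²` are limits of elements of `H¹_{0,σ}`. -/
theorem mem_closure_range_valL {v₀ : L2 Ω (Space d)} (h : v₀ ∈ L2sol Ω) :
    v₀ ∈ closure (range (valL Ω)) := by
  have h' : v₀ ∈ closure (((SolTestField Ω).map toL2 : Submodule ℝ (L2 Ω (Space d))) :
    Set (L2 Ω (Space d))) := h
  refine closure_mono ?_ h'
  rintro _ ⟨φ, hφ, rfl⟩
  exact ⟨solToH ⟨φ, hφ⟩, val_solToH ⟨φ, hφ⟩⟩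

end Evolution

/-! ### The relative energy inequality along approximations of a weak solution -/

section Approximation

variable {d : ℕ} {Ω : Set (Space d)}

/-- The Serrin condition forces `s ≥ 2` and, below, `r ≥ d`; the exponents are thus in the range of
Jensen's and Minkowski's inequalities. -/
theorem two_le_of_serrin {s : ℝ} (hs : 0 < s) {r : ℝ≥0∞}
    (hsr : 2 / ENNReal.ofReal s + (d : ℝ≥0∞) / r ≤ 1) : 2 ≤ s := by
  have h : 2 / ENNReal.ofReal s ≤ 1 := le_self_add.trans hsr
  rw [ENNReal.div_le_iff (ENNReal.ofReal_pos.2 hs).ne' ENNReal.ofReal_ne_top, one_mul] at h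
  have h2 : (2 : ℝ≥0∞) = ENNReal.ofReal 2 := by simp
  rw [h2] at h
  exact (ENNReal.ofReal_le_ofReal_iff hs.le).1 h

theorem one_le_of_serrin (hd : 2 ≤ d) {s : ℝ} {r : ℝ≥0∞}
    (hsr : 2 / ENNReal.ofReal s + (d : ℝ≥0∞) / r ≤ 1) : 1 ≤ r := by
  have h : (d : ℝ≥0∞) / r ≤ 1 := le_add_self.trans hsr
  have hd1 : (1 : ℝ≥0∞) ≤ d := by exact_mod_cast (by omega : 1 ≤ d)
  rw [ENNReal.div_le_iff_le_mul (Or.inr ENNReal.one_ne_top) (Or.inr one_ne_zero), one_mul] at h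
  exact hd1.trans h

theorem inner_combination {V : Type*} [NormedAddCommGroup V] [InnerProductSpace ℝ V]
    (a b c e z : V) (ν : ℝ) : inner ℝ (a + (ν • b - c) - e) z =
      inner ℝ a z + ν * inner ℝ b z - inner ℝ c z - inner ℝ e z := by
  rw [inner_sub_left, inner_add_left, inner_sub_left, real_inner_smul_left]
  ring

/-- The representative in `H¹_{0,σ}` of `⟨𝒜(w), ·⟩`, where `ℓ` stands for `∂_t w`. -/
noncomputable def residual (ν : ℝ) (f : Hneg1 Ω) (w ℓ : H10sol Ω) : H10sol Ω :=
  ℓ + (ν • gradAdj Ω (wgrad w) - gradAdj Ω (tens (val w))) - riesz Ω f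

theorem inner_residual (ν : ℝ) (f : Hneg1 Ω) (w ℓ z : H10sol Ω) :
    inner ℝ (residual ν f w ℓ) z = inner ℝ ℓ z + ν * inner ℝ (wgrad w) (wgrad z) -
      inner ℝ (tens (val w)) (wgrad z) - pair f z := by
  rw [← inner_gradAdj, ← inner_gradAdj, ← inner_riesz]
  exact inner_combination (V := H10sol Ω) _ _ _ _ z ν

/-- When `w` is a test field, the functional is represented by an element of `H¹_{0,σ}` in which the
convective term enters through `w ⊗ w`. In this form it can pass to the limit. -/
theorem solOp_solToH (ν : ℝ) (f : Hneg1 Ω) (φ : SolTestField Ω) (w' z : H10sol Ω) :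
    solOp ν f (solToH φ) w' z = inner ℝ (residual ν f (solToH φ) (massL Ω w')) z := by
  rw [inner_residual, inner_massL, solOp, conv_solToH]
  ring

/-- `v` solves its own equation, so only the difference of the forces remains. -/
theorem residual_flux (ν : ℝ) (f : ℝ → Hneg1 Ω) (f₁ : Hneg1 Ω) (v : ℝ → H10sol Ω) (t : ℝ) :
    residual ν f₁ (v t) (flux ν f v t) = riesz Ω (f t) - riesz Ω f₁ := by
  rw [residual, flux, sub_add_cancel]

/-- Smoothed curves are admissible in the relative energy inequality on all of `(0, T)`, while
closeness to `v` is claimed only on `(0, b)`, as mollification looks past `b`. Here `ℓ` represents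
the time derivative of `w`. -/
theorem IsDissipativeSolution.exists_approx (hΩ : IsLipschitzDomain Ω) (hd : 2 ≤ d)
    {T ν κ s : ℝ} {r : ℝ≥0∞} (hT : 0 < T) (hs : 0 < s)
    (hsr : 2 / ENNReal.ofReal s + (d : ℝ≥0∞) / r ≤ 1)
    {f : ℝ → Hneg1 Ω} {v₀ : L2 Ω (Space d)} {v : ℝ → H10sol Ω} (hf : MemLp f 2 (timeMeasure T))
    (hv₀ : v₀ ∈ L2sol Ω) (hv : IsWeakSolution T ν f v₀ v) (hr : MemLsLr T s r v)
    {f₁ : ℝ → Hneg1 Ω} {v₁₀ : L2 Ω (Space d)} {v₁ : ℝ → H10sol Ω}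
    (hv₁ : IsDissipativeSolution T ν κ s r f₁ v₁₀ v₁) {b ε : ℝ} (hb0 : 0 < b) (hb : b < T)
    (hε : 0 < ε) :
    ∃ w ℓ : ℝ → H10sol Ω, (Continuous w ∧ Continuous ℓ ∧
      ∀ t p, eLpNorm (val (w t)) p (volume.restrict Ω) < ⊤) ∧
      eLpNorm (fun t => w t - v t) 2 (timeMeasure b) ≤ ENNReal.ofReal ε ∧
      eLpNorm (fun t => ℓ t - flux ν f v t) 2 (timeMeasure b) ≤ ENNReal.ofReal ε ∧
      ‖val (w 0) - v₀‖ ≤ ε ∧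
      ∫⁻ t in Ioo 0 b, eLpNorm (val (w t)) r (volume.restrict Ω) ^ s ≤
        (∫⁻ t in Ioo 0 b, eLpNorm (val (v t)) r (volume.restrict Ω) ^ s) + ENNReal.ofReal ε ∧
      ∫⁻ t in Ioo 0 b, eLpNorm (val (w t)) 4 (volume.restrict Ω) ^ (4 : ℝ) ≤
        (∫⁻ t in Ioo 0 b, eLpNorm (val (v t)) 4 (volume.restrict Ω) ^ (4 : ℝ)) +
          ENNReal.ofReal ε ∧
      ∀ᵐ t ∂(timeMeasure T), relEnergy (val (v₁ t)) (val (w t))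
        + ∫ σ in (0 : ℝ)..t, (relDiss ν (v₁ σ) (w σ) +
            inner ℝ (residual ν (f₁ σ) (w σ) (ℓ σ)) (v₁ σ - w σ))
            * Real.exp (∫ τ in σ..t, regMeasure κ s r (w τ))
      ≤ relEnergy v₁₀ (val (w 0)) * Real.exp (∫ τ in (0 : ℝ)..t, regMeasure κ s r (w τ)) := by
  have h4 : MemLsLr T 4 4 v := hv.memX.memLsLr_four hΩ.isBounded hd hs hsr hr
  have hs1 : 1 ≤ s := by linarith [two_le_of_serrin hs hsr]
  have key := IsWeakEvolution.exists_approx_solTestField hΩ (hv.isWeakEvolution hf h4)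
    hv.memX.memLp_H1 (memLp_flux hf hv.memX h4) (mem_closure_range_valL hv₀) inner_massL
    (one_le_of_serrin hd hsr) (by norm_num : (1 : ℝ≥0∞) ≤ 4) hs1 (by norm_num : (1 : ℝ) ≤ 4) hr h4
    hb0 hb hε
  refine key.elim fun S h => h.elim fun S' h => h.elim fun u h => ?_
  refine ⟨fun t => S (u t), fun t => massL Ω (S (deriv u t)),
    ⟨S.continuous.comp h.2.1.continuous, (massL Ω).continuous.comp (S.continuous.comp
      (h.2.1.continuous_deriv le_rfl)), fun t p => ?_⟩, h.2.2.2.1, h.2.2.2.2.1, h.2.2.2.2.2.1,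
    h.2.2.2.2.2.2.1, h.2.2.2.2.2.2.2, ?_⟩
  · change eLpNorm (val (S (u t))) p _ < ⊤
    rw [← h.1]
    exact eLpNorm_val_solToH_lt_top _ p
  · have hae := hv₁.rel_energy_smoothing hΩ.isOpen hT S S' h.1 h.2.1 h.2.2.1
    have e : ∀ σ, solOp ν (f₁ σ) (S (u σ)) (S (deriv u σ)) (v₁ σ - S (u σ)) =
        inner ℝ (residual ν (f₁ σ) (S (u σ)) (massL Ω (S (deriv u σ)))) (v₁ σ - S (u σ)) :=
      fun σ => by rw [← h.1 (u σ)]; exact solOp_solToH _ _ _ _ _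
    simp only [e] at hae
    exact hae

end Approximation

/-! ### Convergence in Lebesgue spaces -/

section TendstoLp

variable {α : Type*} [MeasurableSpace α] {μ : Measure α} {p : ℝ≥0∞}

/-- Convergence in `L^p` of a sequence of functions in `L^p`. -/
structure TendstoLp {E : Type*} [NormedAddCommGroup E] (p : ℝ≥0∞) (μ : Measure α)
    (F : ℕ → α → E) (f : α → E) : Prop where
  memLp_limit : MemLp f p μ
  memLp : ∀ k, MemLp (F k) p μ
  tendsto : Tendsto (fun k => eLpNorm (F k - f) p μ) atTop (𝓝 0)

variable {E E' : Type*} [NormedAddCommGroup E] [NormedAddCommGroup E']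

theorem TendstoLp.of_le {F : ℕ → α → E} {f : α → E} (hf : MemLp f p μ)
    (hF : ∀ k, AEStronglyMeasurable (F k) μ) {ε : ℕ → ℝ}
    (hε : Tendsto ε atTop (𝓝 0))
    (h : ∀ k, eLpNorm (fun x => F k x - f x) p μ ≤ ENNReal.ofReal (ε k)) : TendstoLp p μ F f := by
  refine ⟨hf, fun k => ?_, ?_⟩
  · have h1 : MemLp (fun x => F k x - f x) p μ :=
      ⟨(hF k).sub hf.1, (h k).trans_lt ENNReal.ofReal_lt_top⟩
    refine (h1.add hf).ae_eq (ae_of_all _ fun x => ?_)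
    simp
  · refine tendsto_of_tendsto_of_tendsto_of_le_of_le tendsto_const_nhds ?_ (fun _ => zero_le) h
    simpa using ENNReal.tendsto_ofReal hε

theorem TendstoLp.comp {F : ℕ → α → E} {f : α → E} (h : TendstoLp p μ F f) {n : ℕ → ℕ}
    (hn : StrictMono n) : TendstoLp p μ (fun k => F (n k)) f :=
  ⟨h.memLp_limit, fun k => h.memLp (n k), h.tendsto.comp hn.tendsto_atTop⟩

theorem TendstoLp.const {f : α → E} (h : MemLp f p μ) : TendstoLp p μ (fun _ => f) f :=
  ⟨h, fun _ => h, by simp⟩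

theorem TendstoLp.add {F G : ℕ → α → E} {f g : α → E} (hp : 1 ≤ p) (h : TendstoLp p μ F f)
    (h' : TendstoLp p μ G g) :
    TendstoLp p μ (fun k x => F k x + G k x) fun x => f x + g x := by
  refine ⟨h.memLp_limit.add h'.memLp_limit, fun k => (h.memLp k).add (h'.memLp k), ?_⟩
  have h0 := h.tendsto.add h'.tendsto
  rw [add_zero] at h0
  refine tendsto_of_tendsto_of_tendsto_of_le_of_le tendsto_const_nhds h0 (fun _ => zero_le)
    fun k => ?_
  have e : ((fun x => F k x + G k x) - fun x => f x + g x) = (F k - f) + (G k - g) := by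
    funext x
    simp only [Pi.sub_apply, Pi.add_apply]
    abel
  change eLpNorm ((fun x => F k x + G k x) - fun x => f x + g x) p μ ≤ _
  rw [e]
  exact eLpNorm_add_le ((h.memLp k).sub h.memLp_limit).1 ((h'.memLp k).sub h'.memLp_limit).1 hp

theorem TendstoLp.clm [NormedSpace ℝ E] [NormedSpace ℝ E'] (L : E →L[ℝ] E') {F : ℕ → α → E}
    {f : α → E} (h : TendstoLp p μ F f) :
    TendstoLp p μ (fun k x => L (F k x)) fun x => L (f x) := by
  refine ⟨L.comp_memLp' h.memLp_limit, fun k => L.comp_memLp' (h.memLp k), ?_⟩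
  have h0 := ENNReal.Tendsto.const_mul (a := ENNReal.ofReal ‖L‖) h.tendsto
    (Or.inr ENNReal.ofReal_ne_top)
  rw [mul_zero] at h0
  refine tendsto_of_tendsto_of_tendsto_of_le_of_le tendsto_const_nhds h0 (fun _ => zero_le)
    fun k => ?_
  refine eLpNorm_le_mul_eLpNorm_of_ae_le_mul (ae_of_all _ fun x => ?_) p
  rw [Pi.sub_apply, Pi.sub_apply, ← map_sub]
  exact L.le_opNorm _

theorem TendstoLp.const_smul [NormedSpace ℝ E] (c : ℝ) {F : ℕ → α → E}
    {f : α → E} (h : TendstoLp p μ F f) :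
    TendstoLp p μ (fun k x => c • F k x) fun x => c • f x :=
  h.clm (c • ContinuousLinearMap.id ℝ E)

theorem TendstoLp.sub [NormedSpace ℝ E] {F G : ℕ → α → E} {f g : α → E} (hp : 1 ≤ p)
    (h : TendstoLp p μ F f) (h' : TendstoLp p μ G g) :
    TendstoLp p μ (fun k x => F k x - G k x) fun x => f x - g x := by
  simpa only [neg_one_smul, ← sub_eq_add_neg] using h.add hp (h'.const_smul (-1))

theorem memLp_one_inner [InnerProductSpace ℝ E] {f g : α → E} (hf : MemLp f 2 μ)
    (hg : MemLp g 2 μ) : MemLp (fun x => inner ℝ (f x) (g x)) 1 μ :=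
  ⟨hf.1.inner hg.1, (eLpNorm_inner_le hf.1 hg.1).trans_lt (ENNReal.mul_lt_top hf.2 hg.2)⟩

theorem TendstoLp.inner [InnerProductSpace ℝ E] {F G : ℕ → α → E} {f g : α → E}
    (h : TendstoLp 2 μ F f) (h' : TendstoLp 2 μ G g) :
    TendstoLp 1 μ (fun k x => inner ℝ (F k x) (G k x)) fun x => inner ℝ (f x) (g x) :=
  ⟨memLp_one_inner h.memLp_limit h'.memLp_limit, fun k => memLp_one_inner (h.memLp k) (h'.memLp k),
    tendsto_eLpNorm_inner_sub h.memLp_limit h'.memLp_limit (fun k => (h.memLp k).1)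
      (fun k => (h'.memLp k).1) h.tendsto h'.tendsto⟩

theorem TendstoLp.exists_seq_tendsto_ae {F : ℕ → α → E} {f : α → E} (h : TendstoLp 2 μ F f) :
    ∃ n : ℕ → ℕ, StrictMono n ∧ ∀ᵐ x ∂μ, Tendsto (fun k => F (n k) x) atTop (𝓝 (f x)) :=
  (tendstoInMeasure_of_tendsto_eLpNorm (by norm_num) (fun k => (h.memLp k).1) h.memLp_limit.1
    h.tendsto).exists_seq_tendsto_ae

theorem le_liminf_comp {X : Type*} [TopologicalSpace X] {N : X → ℝ≥0∞}
    (hN : LowerSemicontinuous N) {x : ℕ → X} {x₀ : X} (hx : Tendsto x atTop (𝓝 x₀)) :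
    N x₀ ≤ liminf (fun k => N (x k)) atTop := by
  refine le_of_forall_lt fun c hc => ?_
  obtain ⟨c', h1, h2⟩ := exists_between hc
  refine h1.trans_le (le_liminf_of_le (by isBoundedDefault) ?_)
  exact (hx.eventually (hN x₀ c' h2)).mono fun k hk => hk.le

/-- Convergence in `L²` from Radon-Riesz. -/
theorem tendstoLp_of_le_liminf {E : Type*} [NormedAddCommGroup E]
    [InnerProductSpace ℝ E] {q : α → E} {Q : ℕ → α → E} (hq : AEStronglyMeasurable q μ)
    (hQ : ∀ k, AEStronglyMeasurable (Q k) μ) (hfin : ∫⁻ x, ‖q x‖ₑ ^ 2 ∂μ < ⊤)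
    (h1 : ∀ᵐ x ∂μ, ‖q x + q x‖ₑ ^ 2 ≤ liminf (fun k => ‖Q k x + q x‖ₑ ^ 2) atTop)
    {ε : ℕ → ℝ} (hε : Tendsto ε atTop (𝓝 0))
    (h2 : ∀ k, ∫⁻ x, ‖Q k x‖ₑ ^ 2 ∂μ ≤ (∫⁻ x, ‖q x‖ₑ ^ 2 ∂μ) + ENNReal.ofReal (ε k)) :
    TendstoLp 2 μ Q q := by
  have hsq : ∀ {f : α → E}, AEStronglyMeasurable f μ → ∫⁻ x, ‖f x‖ₑ ^ 2 ∂μ < ⊤ → MemLp f 2 μ := by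
    intro f hf h
    refine ⟨hf, ?_⟩
    rw [← eLpNorm_two_sq] at h
    by_contra hne
    rw [not_lt, top_le_iff] at hne
    rw [hne] at h
    simp at h
  have hq2 := hsq hq hfin
  refine ⟨hq2, fun k => hsq (hQ k) ((h2 k).trans_lt
    (ENNReal.add_lt_top.2 ⟨hfin, ENNReal.ofReal_lt_top⟩)), ?_⟩
  refine tendsto_eLpNorm_sub_of_le_liminf hq2 hQ h1 fun η hη => ?_
  have h3 := ENNReal.tendsto_ofReal hε
  rw [ENNReal.ofReal_zero] at h3
  filter_upwards [h3.eventually (gt_mem_nhds hη)] with k hk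
  exact (h2 k).trans (add_le_add le_rfl hk.le)

/-- The Radon-Riesz property is applied in `L²` to the square roots `N^(s/2)`: lower semicontinuity
bounds the midpoints and `hle` the norms. Squaring returns to `L¹`. -/
theorem tendstoLp_toReal_rpow {N : E → ℝ≥0∞} (hN : LowerSemicontinuous N) {s : ℝ} (hs : 0 < s)
    {v : α → E} {w : ℕ → α → E} (hv : AEMeasurable (fun x => N (v x)) μ)
    (hw : ∀ k, AEMeasurable (fun x => N (w k x)) μ) (hfin : ∀ k x, N (w k x) < ⊤)
    (hvfin : ∫⁻ x, N (v x) ^ s ∂μ < ⊤)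
    (hlim : ∀ᵐ x ∂μ, Tendsto (fun k => w k x) atTop (𝓝 (v x))) {ε : ℕ → ℝ}
    (hε : Tendsto ε atTop (𝓝 0))
    (hle : ∀ k, ∫⁻ x, N (w k x) ^ s ∂μ ≤ (∫⁻ x, N (v x) ^ s ∂μ) + ENNReal.ofReal (ε k)) :
    TendstoLp 1 μ (fun k x => (N (w k x)).toReal ^ s) fun x => (N (v x)).toReal ^ s := by
  have hs2 : 0 < s / 2 := by linarith
  have hvae : ∀ᵐ x ∂μ, N (v x) < ⊤ := by
    filter_upwards [ae_lt_top' (hv.pow_const s) hvfin.ne] with x hx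
    exact (ENNReal.rpow_lt_top_iff_of_pos hs).1 hx
  have henorm : ∀ a : ℝ≥0∞, a < ⊤ → ENNReal.ofReal (a.toReal ^ (s / 2)) = a ^ (s / 2) := by
    intro a ha
    rw [← ENNReal.ofReal_rpow_of_nonneg ENNReal.toReal_nonneg hs2.le, ENNReal.ofReal_toReal ha.ne]
  have hpos : ∀ a : ℝ≥0∞, 0 ≤ a.toReal ^ (s / 2) := fun a =>
    Real.rpow_nonneg ENNReal.toReal_nonneg _
  have hsq : ∀ a : ℝ≥0∞, a < ⊤ → ‖a.toReal ^ (s / 2)‖ₑ ^ 2 = a ^ s := by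
    intro a ha
    rw [Real.enorm_eq_ofReal (hpos a), henorm a ha, ← ENNReal.rpow_natCast, ← ENNReal.rpow_mul]
    congr 1
    push_cast
    ring
  have hI : ∫⁻ x, ‖(N (v x)).toReal ^ (s / 2)‖ₑ ^ 2 ∂μ = ∫⁻ x, N (v x) ^ s ∂μ :=
    lintegral_congr_ae (hvae.mono fun x hx => hsq _ hx)
  have hIk : ∀ k, ∫⁻ x, ‖(N (w k x)).toReal ^ (s / 2)‖ₑ ^ 2 ∂μ = ∫⁻ x, N (w k x) ^ s ∂μ :=
    fun k => lintegral_congr fun x => hsq _ (hfin k x)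
  have key : TendstoLp 2 μ (fun k x => (N (w k x)).toReal ^ (s / 2))
      fun x => (N (v x)).toReal ^ (s / 2) := by
    refine tendstoLp_of_le_liminf (hv.ennreal_toReal.pow_const _).aestronglyMeasurable
      (fun k => ((hw k).ennreal_toReal.pow_const _).aestronglyMeasurable) (by rwa [hI]) ?_ hε
      (fun k => by rw [hI, hIk]; exact hle k)
    filter_upwards [hvae, hlim] with x hx hxl
    have e : ∀ a : ℝ≥0∞, a < ⊤ → ‖a.toReal ^ (s / 2) + (N (v x)).toReal ^ (s / 2)‖ₑ ^ 2 =
        (a ^ (s / 2) + N (v x) ^ (s / 2)) ^ 2 := by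
      intro a ha
      rw [Real.enorm_eq_ofReal (add_nonneg (hpos _) (hpos _)), ENNReal.ofReal_add (hpos _) (hpos _),
        henorm a ha, henorm _ hx]
    rw [e _ hx]
    simp only [e _ (hfin _ x)]
    refine le_liminf_comp (N := fun y => (N y ^ (s / 2) + N (v x) ^ (s / 2)) ^ 2) ?_ hxl
    refine Continuous.comp_lowerSemicontinuous
      (g := fun a : ℝ≥0∞ => (a ^ (s / 2) + N (v x) ^ (s / 2)) ^ 2) (by fun_prop) hN
      fun a b hab => ?_
    exact pow_le_pow_left' (add_le_add (ENNReal.rpow_le_rpow hab hs2.le) le_rfl) 2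
  have e : ∀ a : ℝ≥0∞, inner ℝ (a.toReal ^ (s / 2)) (a.toReal ^ (s / 2)) = a.toReal ^ s := by
    intro a
    change a.toReal ^ (s / 2) * a.toReal ^ (s / 2) = _
    rw [← Real.rpow_add_of_nonneg ENNReal.toReal_nonneg hs2.le hs2.le, add_halves]
  simpa only [e] using key.inner key

end TendstoLp

/-! ### Strong convergence of the tensors `w ⊗ w`. -/

section Fields

variable {d : ℕ} {Ω : Set (Space d)} {α : Type*} [MeasurableSpace α] {μ : Measure α}

/-- Convergence in `L²` at almost every time makes `‖u ⊗ u + M‖` lower semicontinuous, and the `L⁴`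
bounds control the norms from above. Radon-Riesz then applies in `L²` of the time variable with
values in `L²(Ω)`. -/
theorem tendstoLp_tens {v : α → L2 Ω (Space d)} {w : ℕ → α → L2 Ω (Space d)}
    (hv : AEStronglyMeasurable v μ) (hw : ∀ k, AEStronglyMeasurable (w k) μ)
    (hfin : ∀ k x, eLpNorm (w k x) 4 (volume.restrict Ω) < ⊤)
    (hvfin : ∫⁻ x, eLpNorm (v x) 4 (volume.restrict Ω) ^ (4 : ℝ) ∂μ < ⊤)
    (hlim : ∀ᵐ x ∂μ, Tendsto (fun k => w k x) atTop (𝓝 (v x))) {ε : ℕ → ℝ}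
    (hε : Tendsto ε atTop (𝓝 0))
    (hle : ∀ k, ∫⁻ x, eLpNorm (w k x) 4 (volume.restrict Ω) ^ (4 : ℝ) ∂μ ≤
      (∫⁻ x, eLpNorm (v x) 4 (volume.restrict Ω) ^ (4 : ℝ) ∂μ) + ENNReal.ofReal (ε k)) :
    TendstoLp 2 μ (fun k x => tens (w k x)) fun x => tens (v x) := by
  have hvae : ∀ᵐ x ∂μ, eLpNorm (v x) 4 (volume.restrict Ω) < ⊤ := by
    filter_upwards [ae_lt_top' ((aemeasurable_eLpNorm 4 hv).pow_const 4) hvfin.ne] with x hx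
    exact (ENNReal.rpow_lt_top_iff_of_pos (by norm_num)).1 hx
  have hI : ∫⁻ x, ‖tens (v x)‖ₑ ^ 2 ∂μ =
      ∫⁻ x, eLpNorm (v x) 4 (volume.restrict Ω) ^ (4 : ℝ) ∂μ :=
    lintegral_congr_ae (hvae.mono fun x hx => enorm_tens_sq_rpow hx)
  have hIk : ∀ k, ∫⁻ x, ‖tens (w k x)‖ₑ ^ 2 ∂μ =
      ∫⁻ x, eLpNorm (w k x) 4 (volume.restrict Ω) ^ (4 : ℝ) ∂μ :=
    fun k => lintegral_congr fun x => enorm_tens_sq_rpow (hfin k x)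
  refine tendstoLp_of_le_liminf (aestronglyMeasurable_tens hv hvae)
    (fun k => aestronglyMeasurable_tens (hw k) (ae_of_all _ (hfin k))) (by rwa [hI]) ?_ hε
    (fun k => by rw [hI, hIk]; exact hle k)
  filter_upwards [hvae, hlim] with x hx hxl
  set M := tens (v x) with hM
  have e : ∀ u : L2 Ω (Space d), eLpNorm u 4 (volume.restrict Ω) < ⊤ →
      ‖tens u + M‖ₑ = eLpNorm (fun y => outer (u y) (u y) + M y) 2 (volume.restrict Ω) := by
    intro u hu
    rw [Lp.enorm_def]
    refine eLpNorm_congr_ae ?_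
    filter_upwards [Lp.coeFn_add (tens u) M, coeFn_tens hu] with y h1 h2
    rw [h1, Pi.add_apply, h2]
  have e0 : ‖M + M‖ₑ = _ := e (v x) hx
  rw [e0]
  simp only [e _ (hfin _ x)]
  refine le_liminf_comp (N := fun u : L2 Ω (Space d) =>
    eLpNorm (fun y => outer (u y) (u y) + M y) 2 (volume.restrict Ω) ^ 2) ?_ hxl
  refine Continuous.comp_lowerSemicontinuous (g := fun a : ℝ≥0∞ => a ^ 2)
    (ENNReal.continuous_pow 2) (lowerSemicontinuous_eLpNorm_comp 2 (fun y z => outer z z + M y)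
      (fun y => continuous_outer_self.add continuous_const) fun u => ?_)
    fun a b hab => pow_le_pow_left' hab 2
  exact (continuous_outer_self.comp_aestronglyMeasurable (Lp.aestronglyMeasurable u)).add
    (Lp.aestronglyMeasurable M)

end Fields

/-! ### Passage to the limit in the relative energy inequality -/

section Limit

theorem TendstoLp.combination {α V H : Type*} [MeasurableSpace α] {μ : Measure α}
    [NormedAddCommGroup V] [InnerProductSpace ℝ V] [NormedAddCommGroup H] [InnerProductSpace ℝ H]
    (G : H →L[ℝ] V) (ν : ℝ) {ℓ : ℕ → α → V} {g : α → V} {A B : ℕ → α → H} {a b : α → H} {e : α → V}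
    (hℓ : TendstoLp 2 μ ℓ g) (hA : TendstoLp 2 μ A a) (hB : TendstoLp 2 μ B b)
    (he : MemLp e 2 μ) :
    TendstoLp 2 μ (fun k x => ℓ k x + (ν • G (A k x) - G (B k x)) - e x)
      fun x => g x + (ν • G (a x) - G (b x)) - e x :=
  (hℓ.add (by norm_num) (((hA.clm G).const_smul ν).sub (by norm_num) (hB.clm G))).sub
    (by norm_num) (.const he)

theorem TendstoLp.const_sub {α V : Type*} [MeasurableSpace α] {μ : Measure α}
    [NormedAddCommGroup V] [InnerProductSpace ℝ V] {F : ℕ → α → V} {f g : α → V}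
    (h : TendstoLp 2 μ F f) (hg : MemLp g 2 μ) :
    TendstoLp 2 μ (fun k x => g x - F k x) fun x => g x - f x :=
  (TendstoLp.const hg).sub (by norm_num) h

theorem TendstoLp.norm_sq {α V : Type*} [MeasurableSpace α] {μ : Measure α}
    [NormedAddCommGroup V] [InnerProductSpace ℝ V] {F : ℕ → α → V} {f : α → V}
    (h : TendstoLp 2 μ F f) :
    TendstoLp 1 μ (fun k x => ‖F k x‖ ^ 2) fun x => ‖f x‖ ^ 2 := by
  simpa only [real_inner_self_eq_norm_sq] using h.inner h

variable {d : ℕ} {Ω : Set (Space d)}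

theorem pair_sub_eq_inner (f g : Hneg1 Ω) (z : H10sol Ω) :
    inner ℝ (riesz Ω f - riesz Ω g) z = pair f z - pair g z := by
  rw [← inner_riesz, ← inner_riesz]
  exact inner_sub_left (E := H10sol Ω) _ _ z

theorem timeMeasure_mono {b T : ℝ} (h : b ≤ T) : timeMeasure b ≤ timeMeasure T :=
  Measure.restrict_mono (Ioo_subset_Ioo_right h) le_rfl

theorem tendstoLp_regMeasure {b κ s : ℝ} {r : ℝ≥0∞} (hs : 0 < s) {v : ℝ → H10sol Ω}
    {w : ℕ → ℝ → H10sol Ω} (hv : AEStronglyMeasurable v (timeMeasure b))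
    (hw : ∀ k, AEStronglyMeasurable (w k) (timeMeasure b))
    (hfin : ∀ k t, eLpNorm (val (w k t)) r (volume.restrict Ω) < ⊤)
    (hvfin : MemLsLr b s r v)
    (hlim : ∀ᵐ t ∂(timeMeasure b), Tendsto (fun k => w k t) atTop (𝓝 (v t))) {ε : ℕ → ℝ}
    (hε : Tendsto ε atTop (𝓝 0))
    (hle : ∀ k, ∫⁻ t in Ioo 0 b, eLpNorm (val (w k t)) r (volume.restrict Ω) ^ s ≤
      (∫⁻ t in Ioo 0 b, eLpNorm (val (v t)) r (volume.restrict Ω) ^ s) + ENNReal.ofReal (ε k)) :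
    TendstoLp 1 (timeMeasure b) (fun k t => regMeasure κ s r (w k t))
      fun t => regMeasure κ s r (v t) :=
  (tendstoLp_toReal_rpow (E := H10sol Ω)
    (N := fun u => eLpNorm (val u) r (volume.restrict Ω)) (lowerSemicontinuous_eLpNorm_val r) hs
    (lowerSemicontinuous_measurable_comp (lowerSemicontinuous_eLpNorm_val r) hv)
    (fun k => lowerSemicontinuous_measurable_comp (lowerSemicontinuous_eLpNorm_val r) (hw k))
    hfin hvfin hlim hε hle).const_smul κ

theorem continuous_val : Continuous fun u : H10sol Ω => val u := (valL Ω).continuous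

theorem tendstoLp_wgrad {b : ℝ} {v : ℝ → H10sol Ω} {w : ℕ → ℝ → H10sol Ω}
    (h : TendstoLp 2 (timeMeasure b) w v) :
    TendstoLp 2 (timeMeasure b) (fun k t => wgrad (w k t)) fun t => wgrad (v t) :=
  h.clm (wgradL Ω)

/-- The residual is a sum of bounded operators applied to `ℓ`, `∇w`, `w ⊗ w` and the force; being
strongly convergent in `L²`, it may be paired with the strongly convergent `v₁ - w`. -/
theorem tendstoLp_dissipation {b ν : ℝ} {v v₁ : ℝ → H10sol Ω} {f₁ : ℝ → Hneg1 Ω}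
    {w ℓ : ℕ → ℝ → H10sol Ω} {g : ℝ → H10sol Ω} (hw : TendstoLp 2 (timeMeasure b) w v)
    (hℓ : TendstoLp 2 (timeMeasure b) ℓ g) (hv₁ : MemLp v₁ 2 (timeMeasure b))
    (hf₁ : MemLp f₁ 2 (timeMeasure b))
    (ht : TendstoLp 2 (timeMeasure b) (fun k t => tens (val (w k t))) fun t => tens (val (v t))) :
    TendstoLp 1 (timeMeasure b) (fun k σ => relDiss ν (v₁ σ) (w k σ) +
        inner ℝ (residual ν (f₁ σ) (w k σ) (ℓ k σ)) (v₁ σ - w k σ))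
      fun σ => relDiss ν (v₁ σ) (v σ) +
        inner ℝ (residual ν (f₁ σ) (v σ) (g σ)) (v₁ σ - v σ) := by
  have hG := tendstoLp_wgrad hw
  have h1 := TendstoLp.combination (V := H10sol Ω) (H := L2 Ω (Mat d)) (gradAdj Ω) ν hℓ hG ht
    (memLp_comp_dual (V := H10sol Ω) (W := H10 Ω) (riesz Ω) hf₁)
  have h2 := TendstoLp.const_sub (V := H10sol Ω) hw hv₁
  have h3 := TendstoLp.inner (E := H10sol Ω) h1 h2
  have hg₁ : MemLp (fun t => wgrad (v₁ t)) 2 (timeMeasure b) := (wgradL Ω).comp_memLp' hv₁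
  have h4 := ((hG.const_sub hg₁).norm_sq).const_smul (ν / 2)
  exact h4.add le_rfl h3

end Limit

/-! ### The relative energy inequality tested with the weak solution. -/

section WeakStrong

theorem aestronglyMeasurable_timeMeasure {V : Type*} [NormedAddCommGroup V]
    {w : ℝ → V} (hw : Continuous w) (b : ℝ) : AEStronglyMeasurable w (timeMeasure b) :=
  hw.aestronglyMeasurable

theorem memLp_dual_mono {W : Type*} [NormedAddCommGroup W] [NormedSpace ℝ W] {b T : ℝ} (h : b ≤ T)
    {f : ℝ → StrongDual ℝ W} (hf : MemLp f 2 (timeMeasure T)) : MemLp f 2 (timeMeasure b) :=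
  hf.mono_measure (timeMeasure_mono h)

variable {d : ℕ} {Ω : Set (Space d)}

theorem tendsto_relEnergy (u : L2 Ω (Space d)) {x : ℕ → L2 Ω (Space d)} {y : L2 Ω (Space d)}
    (h : Tendsto x atTop (𝓝 y)) :
    Tendsto (fun k => relEnergy u (x k)) atTop (𝓝 (relEnergy u y)) :=
  ((h.const_sub u).norm.pow 2).const_mul (1 / 2)

theorem tendsto_of_norm_sub_le {E : Type*} [NormedAddCommGroup E] {x : ℕ → E} {y : E} {ε : ℕ → ℝ}
    (hε : Tendsto ε atTop (𝓝 0)) (h : ∀ k, ‖x k - y‖ ≤ ε k) : Tendsto x atTop (𝓝 y) :=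
  tendsto_iff_norm_sub_tendsto_zero.2 (squeeze_zero (fun _ => norm_nonneg _) h hε)

/-- The relative energy inequality is stable under approximation. -/
theorem rel_energy_of_tendsto {b ν κ s : ℝ} {r : ℝ≥0∞} {v₀ v₁₀ : L2 Ω (Space d)}
    {v v₁ : ℝ → H10sol Ω} {f₁ : ℝ → Hneg1 Ω} {w ℓ : ℕ → ℝ → H10sol Ω} {g : ℝ → H10sol Ω}
    (hw : TendstoLp 2 (timeMeasure b) w v) (hℓ : TendstoLp 2 (timeMeasure b) ℓ g)
    (hv₁ : MemLp v₁ 2 (timeMeasure b)) (hf₁ : MemLp f₁ 2 (timeMeasure b))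
    (ht : TendstoLp 2 (timeMeasure b) (fun k t => tens (val (w k t))) fun t => tens (val (v t)))
    (hK : TendstoLp 1 (timeMeasure b) (fun k t => regMeasure κ s r (w k t))
      fun t => regMeasure κ s r (v t))
    (hlim : ∀ᵐ t ∂(timeMeasure b), Tendsto (fun k => w k t) atTop (𝓝 (v t)))
    (h0 : Tendsto (fun k => val (w k 0)) atTop (𝓝 v₀))
    (hineq : ∀ k, ∀ᵐ t ∂(timeMeasure b), relEnergy (val (v₁ t)) (val (w k t))
        + ∫ σ in (0 : ℝ)..t, (relDiss ν (v₁ σ) (w k σ) +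
            inner ℝ (residual ν (f₁ σ) (w k σ) (ℓ k σ)) (v₁ σ - w k σ))
            * Real.exp (∫ τ in σ..t, regMeasure κ s r (w k τ))
      ≤ relEnergy v₁₀ (val (w k 0)) * Real.exp (∫ τ in (0 : ℝ)..t, regMeasure κ s r (w k τ))) :
    ∀ᵐ t ∂(timeMeasure b), relEnergy (val (v₁ t)) (val (v t))
        + ∫ σ in (0 : ℝ)..t, (relDiss ν (v₁ σ) (v σ) +
            inner ℝ (residual ν (f₁ σ) (v σ) (g σ)) (v₁ σ - v σ))
            * Real.exp (∫ τ in σ..t, regMeasure κ s r (v τ))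
      ≤ relEnergy v₁₀ v₀ * Real.exp (∫ τ in (0 : ℝ)..t, regMeasure κ s r (v τ)) := by
  have ha := tendstoLp_dissipation (ν := ν) hw hℓ hv₁ hf₁ ht
  -- The exceptional null set depends on the index, but there are only countably many indices.
  filter_upwards [ae_all_iff.2 hineq, hlim, ae_restrict_mem measurableSet_Ioo] with t h1 h2 ht0
  have h3 := tendsto_integral_mul_exp (memLp_one_iff_integrable.1 ha.memLp_limit)
    (memLp_one_iff_integrable.1 hK.memLp_limit)
    (fun k => memLp_one_iff_integrable.1 (ha.memLp k))
    (fun k => memLp_one_iff_integrable.1 (hK.memLp k)) ha.tendsto hK.tendsto ht0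
  have h4 := (continuous_val.tendsto (v t)).comp h2
  exact le_of_tendsto_of_tendsto' ((tendsto_relEnergy (val (v₁ t)) h4).add h3.1)
    ((tendsto_relEnergy v₁₀ h0).mul ((Real.continuous_exp.tendsto _).comp h3.2)) h1

theorem IsDissipativeSolution.rel_energy_weak_of_lt (hΩ : IsLipschitzDomain Ω) (hd : 2 ≤ d)
    {T ν κ s : ℝ} {r : ℝ≥0∞} (hT : 0 < T) (hs : 0 < s)
    (hsr : 2 / ENNReal.ofReal s + (d : ℝ≥0∞) / r ≤ 1)
    {f : ℝ → Hneg1 Ω} {v₀ : L2 Ω (Space d)} {v : ℝ → H10sol Ω} (hf : MemLp f 2 (timeMeasure T))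
    (hv₀ : v₀ ∈ L2sol Ω) (hv : IsWeakSolution T ν f v₀ v) (hr : MemLsLr T s r v)
    {f₁ : ℝ → Hneg1 Ω} {v₁₀ : L2 Ω (Space d)} {v₁ : ℝ → H10sol Ω}
    (hf₁ : MemLp f₁ 2 (timeMeasure T)) (hv₁ : IsDissipativeSolution T ν κ s r f₁ v₁₀ v₁) {b : ℝ}
    (hb0 : 0 < b) (hb : b < T) :
    Integrable (fun t => regMeasure κ s r (v t)) (timeMeasure b) ∧
    ∀ᵐ t ∂(timeMeasure b), relEnergy (val (v₁ t)) (val (v t))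
        + ∫ σ in (0 : ℝ)..t, (relDiss ν (v₁ σ) (v σ) +
            (pair (f σ) (v₁ σ - v σ) - pair (f₁ σ) (v₁ σ - v σ)))
            * Real.exp (∫ τ in σ..t, regMeasure κ s r (v τ))
      ≤ relEnergy v₁₀ v₀ * Real.exp (∫ τ in (0 : ℝ)..t, regMeasure κ s r (v τ)) := by
  have h4 : MemLsLr T 4 4 v := hv.memX.memLsLr_four hΩ.isBounded hd hs hsr hr
  have hμ := timeMeasure_mono hb.le
  have hsub : Ioo 0 b ⊆ Ioo 0 T := Ioo_subset_Ioo_right hb.le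
  have hvb : MemLp v 2 (timeMeasure b) := hv.memX.memLp_H1.mono_measure hμ
  have hgb : MemLp (flux ν f v) 2 (timeMeasure b) := (memLp_flux hf hv.memX h4).mono_measure hμ
  have hε : ∀ k : ℕ, (0 : ℝ) < 1 / ((k : ℝ) + 1) := fun k => by positivity
  have hε0 : Tendsto (fun k : ℕ => 1 / ((k : ℝ) + 1)) atTop (𝓝 0) :=
    tendsto_one_div_add_atTop_nhds_zero_nat
  choose w ℓ hreg hw hℓ h0 hnr hn4 hineq using fun k : ℕ =>
    hv₁.exists_approx hΩ hd hT hs hsr hf hv₀ hv hr hb0 hb (hε k)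
  have W0 : TendstoLp 2 (timeMeasure b) w v :=
    TendstoLp.of_le hvb (fun k => aestronglyMeasurable_timeMeasure (V := H10sol Ω) (hreg k).1 b) hε0 hw
  have L0 : TendstoLp 2 (timeMeasure b) ℓ (flux ν f v) :=
    TendstoLp.of_le hgb (fun k => aestronglyMeasurable_timeMeasure (V := H10sol Ω) (hreg k).2.1 b) hε0 hℓ
  -- Pointwise convergence in `H¹_{0,σ}` is needed twice: for the relative energy at a fixed time
  -- and for lower semicontinuity of the Lebesgue norms.
  obtain ⟨n, hn, hlim⟩ := W0.exists_seq_tendsto_ae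
  have hεn := hε0.comp hn.tendsto_atTop
  have hrb : MemLsLr b s r v := (lintegral_mono_set hsub).trans_lt hr
  have h4b : MemLsLr b 4 4 v := (lintegral_mono_set hsub).trans_lt h4
  have K := tendstoLp_regMeasure (κ := κ) hs hvb.1
    (fun k => aestronglyMeasurable_timeMeasure (V := H10sol Ω) (hreg (n k)).1 b) (fun k t => (hreg (n k)).2.2 t r) hrb hlim hεn
    fun k => hnr (n k)
  have hlimv : ∀ᵐ t ∂(timeMeasure b), Tendsto (fun k => val (w (n k) t)) atTop (𝓝 (val (v t))) :=
    hlim.mono fun t h => (continuous_val.tendsto (v t)).comp h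
  have Tn := tendstoLp_tens (continuous_val.comp_aestronglyMeasurable hvb.1)
    (fun k => aestronglyMeasurable_timeMeasure (continuous_val.comp (hreg (n k)).1) b)
    (fun k t => (hreg (n k)).2.2 t 4) h4b hlimv hεn fun k => hn4 (n k)
  refine ⟨memLp_one_iff_integrable.1 K.memLp_limit, ?_⟩
  have main := rel_energy_of_tendsto (ν := ν) (v₁₀ := v₁₀) (W0.comp hn) (L0.comp hn)
    (hv₁.memX.memLp_H1.mono_measure hμ) (memLp_dual_mono (W := H10 Ω) hb.le hf₁) Tn K hlim
    (tendsto_of_norm_sub_le hεn fun k => h0 (n k)) fun k => ae_mono hμ (hineq (n k))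
  simp only [residual_flux, pair_sub_eq_inner] at main
  exact main

end WeakStrong

/-! ### Absorption of the difference of the forces. -/

section Stability

theorem integrable_norm_sub_sq_dual {W : Type*} [NormedAddCommGroup W] [NormedSpace ℝ W] {b : ℝ}
    {f g : ℝ → StrongDual ℝ W} (hf : MemLp f 2 (timeMeasure b)) (hg : MemLp g 2 (timeMeasure b)) :
    Integrable (fun t => ‖f t - g t‖ ^ 2) (timeMeasure b) :=
  (hf.sub hg).integrable_norm_pow (by norm_num)

theorem integrable_norm_sub_sq {V : Type*} [NormedAddCommGroup V] {b : ℝ}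
    {f g : ℝ → V} (hf : MemLp f 2 (timeMeasure b)) (hg : MemLp g 2 (timeMeasure b)) :
    Integrable (fun t => ‖f t - g t‖ ^ 2) (timeMeasure b) :=
  (hf.sub hg).integrable_norm_pow (by norm_num)

theorem integrable_inner_sub_sub {V : Type*} [NormedAddCommGroup V] [InnerProductSpace ℝ V]
    {b : ℝ} {f g x y : ℝ → V} (hf : MemLp f 2 (timeMeasure b)) (hg : MemLp g 2 (timeMeasure b))
    (hx : MemLp x 2 (timeMeasure b)) (hy : MemLp y 2 (timeMeasure b)) :
    Integrable (fun t => inner ℝ (f t - g t) (x t - y t)) (timeMeasure b) :=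
  memLp_one_iff_integrable.1 (memLp_one_inner (hf.sub hg) (hx.sub hy))

/-- Exponential weights preserve integrability. -/
theorem intervalIntegrable_mul_exp {b : ℝ} {h A : ℝ → ℝ} (hh : Integrable h (timeMeasure b))
    (hA : Integrable A (timeMeasure b)) {t : ℝ} (ht : t ∈ Ioo 0 b) :
    IntervalIntegrable (fun σ => h σ * Real.exp (∫ τ in σ..t, A τ)) volume 0 t := by
  have hsub : Ioc 0 t ⊆ Ioo 0 b := fun x hx => mem_Ioo.2 ⟨hx.1, hx.2.trans_lt ht.2⟩
  have hμ : volume.restrict (Ioc 0 t) ≤ timeMeasure b := Measure.restrict_mono hsub le_rfl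
  refine IntervalIntegrable.mul_continuousOn ?_ (Real.continuous_exp.comp_continuousOn ?_)
  · rw [intervalIntegrable_iff_integrableOn_Ioc_of_le ht.1.le]
    exact hh.mono_measure hμ
  · refine intervalIntegral.continuousOn_primitive_interval_left ?_
    rw [uIcc_of_le ht.1.le, integrableOn_Icc_iff_integrableOn_Ioc]
    exact hA.mono_measure hμ

/-- Completing the square in `(ν/2 · D - C F)² / ν`; half of the dissipation survives. -/
theorem le_add_of_abs_le_mul {ν C D F p : ℝ} (hν : 0 < ν) (h : |p| ≤ C * F * D) :
    1 / 2 * (ν / 2 * D ^ 2) - C ^ 2 / ν * F ^ 2 ≤ ν / 2 * D ^ 2 + p := by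
  have h1 := (abs_le.1 h).1
  have h2 : 0 ≤ (ν / 2 * D - C * F) ^ 2 / ν := by positivity
  have e : (ν / 2 * D - C * F) ^ 2 / ν = ν / 4 * D ^ 2 - C * F * D + C ^ 2 / ν * F ^ 2 := by
    field_simp
    ring
  rw [e] at h2
  linarith

/-- Absorption of the perturbation into the dissipation, with exponential weights. -/
theorem integral_absorb_le {b ν c : ℝ} {D F p A : ℝ → ℝ}
    (hD : Integrable D (timeMeasure b)) (hF : Integrable F (timeMeasure b))
    (hp : Integrable p (timeMeasure b)) (hA : Integrable A (timeMeasure b))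
    (h : ∀ σ, 1 / 2 * D σ - c / ν * F σ ≤ D σ + p σ) {t : ℝ} (ht : t ∈ Ioo 0 b) :
    1 / 2 * (∫ σ in (0 : ℝ)..t, D σ * Real.exp (∫ τ in σ..t, A τ)) -
      c / ν * (∫ σ in (0 : ℝ)..t, F σ * Real.exp (∫ τ in σ..t, A τ)) ≤
      ∫ σ in (0 : ℝ)..t, (D σ + p σ) * Real.exp (∫ τ in σ..t, A τ) := by
  have iD := intervalIntegrable_mul_exp hD hA ht
  have iF := intervalIntegrable_mul_exp hF hA ht
  have iS := intervalIntegrable_mul_exp (hD.add hp) hA ht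
  rw [← intervalIntegral.integral_const_mul, ← intervalIntegral.integral_const_mul,
    ← intervalIntegral.integral_sub (iD.const_mul _) (iF.const_mul _)]
  refine intervalIntegral.integral_mono_on ht.1.le ((iD.const_mul _).sub (iF.const_mul _)) iS
    fun σ _ => ?_
  have h1 := mul_le_mul_of_nonneg_right (h σ) (Real.exp_pos (∫ τ in σ..t, A τ)).le
  calc _ = (1 / 2 * D σ - c / ν * F σ) * Real.exp (∫ τ in σ..t, A τ) := by ring
    _ ≤ _ := h1

theorem ae_timeMeasure_of_forall_lt {T : ℝ} (hT : 0 < T) {P : ℝ → Prop}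
    (h : ∀ b, 0 < b → b < T → ∀ᵐ t ∂(timeMeasure b), P t) : ∀ᵐ t ∂(timeMeasure T), P t := by
  -- The shift by two keeps the end point positive already for `m = 0`.
  have hb : ∀ m : ℕ, 0 < T - T / ((m : ℝ) + 2) ∧ T - T / ((m : ℝ) + 2) < T := by
    intro m
    have h1 : (0 : ℝ) < (m : ℝ) + 2 := by positivity
    refine ⟨?_, by linarith [div_pos hT h1]⟩
    rw [sub_pos, div_lt_iff₀ h1]
    nlinarith [Nat.cast_nonneg (α := ℝ) m]
  have h1 : ∀ m : ℕ, ∀ᵐ t, t ∈ Ioo 0 (T - T / ((m : ℝ) + 2)) → P t := fun m =>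
    (ae_restrict_iff' measurableSet_Ioo).1 (h _ (hb m).1 (hb m).2)
  refine (ae_restrict_iff' measurableSet_Ioo).2 ?_
  filter_upwards [ae_all_iff.2 h1] with t ht htT
  obtain ⟨m, hm⟩ := exists_nat_gt (T / (T - t))
  have h2 : 0 < T - t := sub_pos.2 htT.2
  refine ht m (mem_Ioo.2 ⟨htT.1, ?_⟩)
  rw [div_lt_iff₀ h2] at hm
  have h3 : T / ((m : ℝ) + 2) < T - t := by
    rw [div_lt_iff₀ (by positivity)]
    nlinarith
  linarith

variable {d : ℕ} {Ω : Set (Space d)}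

/-- The dual norm refers to the full `H¹` norm, which Poincaré's inequality reduces to the gradient.
-/
theorem abs_pair_sub_le {C : ℝ} (hC : ∀ u : H10sol Ω, ‖u‖ ≤ C * ‖wgrad u‖)
    (f g : Hneg1 Ω) (u v : H10sol Ω) :
    |pair f (u - v) - pair g (u - v)| ≤ C * ‖f - g‖ * ‖wgrad u - wgrad v‖ := by
  have e : pair f (u - v) - pair g (u - v) = (f - g) (Submodule.inclusion (H10sol_le_H10 Ω) (u - v)) :=
    rfl
  rw [e, ← Real.norm_eq_abs]
  refine ((f - g).le_opNorm _).trans ?_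
  have h1 : ‖Submodule.inclusion (H10sol_le_H10 Ω) (u - v)‖ ≤ C * ‖wgrad u - wgrad v‖ := by
    rw [← wgrad_sub]
    exact hC (u - v)
  calc _ ≤ ‖f - g‖ * (C * ‖wgrad u - wgrad v‖) :=
        mul_le_mul_of_nonneg_left h1 (ContinuousLinearMap.opNorm_nonneg _)
    _ = _ := by ring

/-- Weak-strong stability of dissipative solutions with respect to a weak solution in the Serrin
class. -/
theorem IsDissipativeSolution.rel_energy_weak (hΩ : IsLipschitzDomain Ω) (hd : 2 ≤ d) {C : ℝ}
    (hC : ∀ u : H10sol Ω, ‖u‖ ≤ C * ‖wgrad u‖)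
    {T ν κ s : ℝ} {r : ℝ≥0∞} (hT : 0 < T) (hν : 0 < ν) (hs : 0 < s)
    (hsr : 2 / ENNReal.ofReal s + (d : ℝ≥0∞) / r ≤ 1)
    {f : ℝ → Hneg1 Ω} {v₀ : L2 Ω (Space d)} {v : ℝ → H10sol Ω} (hf : MemLp f 2 (timeMeasure T))
    (hv₀ : v₀ ∈ L2sol Ω) (hv : IsWeakSolution T ν f v₀ v) (hr : MemLsLr T s r v)
    {f₁ : ℝ → Hneg1 Ω} {v₁₀ : L2 Ω (Space d)} {v₁ : ℝ → H10sol Ω}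
    (hf₁ : MemLp f₁ 2 (timeMeasure T)) (hv₁ : IsDissipativeSolution T ν κ s r f₁ v₁₀ v₁) :
    ∀ᵐ t ∂(timeMeasure T), relEnergy (val (v₁ t)) (val (v t))
          + 1 / 2 * ∫ σ in (0 : ℝ)..t, relDiss ν (v₁ σ) (v σ)
              * Real.exp (∫ τ in σ..t, regMeasure κ s r (v τ))
        ≤ relEnergy v₁₀ v₀ * Real.exp (∫ τ in (0 : ℝ)..t, regMeasure κ s r (v τ))
          + C ^ 2 / ν * ∫ σ in (0 : ℝ)..t, ‖f σ - f₁ σ‖ ^ 2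
              * Real.exp (∫ τ in σ..t, regMeasure κ s r (v τ)) := by
  refine ae_timeMeasure_of_forall_lt hT fun b hb0 hb => ?_
  obtain ⟨hA, hae⟩ := hv₁.rel_energy_weak_of_lt hΩ hd hT hs hsr hf hv₀ hv hr hf₁ hb0 hb
  have hμ := timeMeasure_mono hb.le
  have hfb := memLp_dual_mono (W := H10 Ω) hb.le hf
  have hf₁b := memLp_dual_mono (W := H10 Ω) hb.le hf₁
  have hF := integrable_norm_sub_sq_dual (W := H10 Ω) hfb hf₁b
  have hD : Integrable (fun σ => relDiss ν (v₁ σ) (v σ)) (timeMeasure b) :=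
    (integrable_norm_sub_sq (hv₁.memX.memLp_wgrad.mono_measure hμ)
      (hv.memX.memLp_wgrad.mono_measure hμ)).const_mul (ν / 2)
  have hp := integrable_inner_sub_sub (V := H10sol Ω)
    (memLp_comp_dual (V := H10sol Ω) (W := H10 Ω) (riesz Ω) hfb)
    (memLp_comp_dual (V := H10sol Ω) (W := H10 Ω) (riesz Ω) hf₁b)
    (hv₁.memX.memLp_H1.mono_measure hμ) (hv.memX.memLp_H1.mono_measure hμ)
  simp only [pair_sub_eq_inner] at hp
  filter_upwards [hae, ae_restrict_mem measurableSet_Ioo] with t h1 ht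
  have h2 := integral_absorb_le (ν := ν) (c := C ^ 2) hD hF hp hA
    (fun σ => le_add_of_abs_le_mul hν (abs_pair_sub_le hC _ _ _ _)) ht
  linarith

end Stability

end NSDiss

theorem proposition3p2 {d : ℕ} (hd : 2 ≤ d) (Ω : Set (NSDiss.Space d))
    (hΩ : NSDiss.IsLipschitzDomain Ω) :
    ∃ c : ℝ, 0 < c ∧
      ∀ (T ν κ s : ℝ) (r : ℝ≥0∞), 0 < T → 0 < ν → 0 < κ → 0 < s →
        2 / ENNReal.ofReal s + (d : ℝ≥0∞) / r ≤ 1 →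
      ∀ (f : ℝ → NSDiss.Hneg1 Ω) (v₀ : NSDiss.L2 Ω (NSDiss.Space d)) (v : ℝ → NSDiss.H10sol Ω),
        MemLp f 2 (NSDiss.timeMeasure T) → v₀ ∈ NSDiss.L2sol Ω →
        NSDiss.IsWeakSolution T ν f v₀ v → NSDiss.MemLsLr T s r v →
      ∀ (f₁ : ℝ → NSDiss.Hneg1 Ω) (v₁₀ : NSDiss.L2 Ω (NSDiss.Space d))
        (v₁ : ℝ → NSDiss.H10sol Ω),
        MemLp f₁ 2 (NSDiss.timeMeasure T) → v₁₀ ∈ NSDiss.L2sol Ω →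
        NSDiss.IsDissipativeSolution T ν κ s r f₁ v₁₀ v₁ →
      ∀ᵐ t ∂(NSDiss.timeMeasure T),
        NSDiss.relEnergy (NSDiss.val (v₁ t)) (NSDiss.val (v t))
          + 1 / 2 * ∫ σ in (0 : ℝ)..t, NSDiss.relDiss ν (v₁ σ) (v σ)
              * Real.exp (∫ τ in σ..t, NSDiss.regMeasure κ s r (v τ))
        ≤ NSDiss.relEnergy v₁₀ v₀ * Real.exp (∫ τ in (0 : ℝ)..t, NSDiss.regMeasure κ s r (v τ))
          + c / ν * ∫ σ in (0 : ℝ)..t, ‖f σ - f₁ σ‖ ^ 2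
              * Real.exp (∫ τ in σ..t, NSDiss.regMeasure κ s r (v τ)) := by
  obtain ⟨C, hC0, hC⟩ := NSDiss.exists_norm_le_wgrad (Ω := Ω) hΩ.isBounded hd
  -- `C` is the Poincaré constant, fixed before `T`, `ν`, `κ`, `s`, `r` and hence dependent on `Ω`
  -- alone.
  refine ⟨C ^ 2, by positivity, ?_⟩
  intro T ν κ s r hT hν _ hs hsr f v₀ v hf hv₀ hv hr f₁ v₁₀ v₁ hf₁ _ hv₁
  exact hv₁.rel_energy_weak hΩ hd hC hT hν hs hsr hf hv₀ hv hr hf₁
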